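/- Let $n\ge 1$. For measurable functions $v_1,\dots,v_n:\mathbb R\to\mathbb R$ and a random $n\times n$ complex Hermitian matrix $X$, write $X\sim PE(v_1,\dots,v_n)$ if, for some constant $Z\neq 0$, the function $$\frac1Z\,\Delta_n(x)\,\det\big[v_k(x_j)\big]_{j,k=1}^n,\qquad \Delta_n(x)=\prod_{j<k}(x_k-x_j),$$ is (almost everywhere nonnegative and) the probability density on $\mathbb R^n$ of the eigenvalues of $X$ listed in uniformly random order. For a function $w:\mathbb R\to\mathbb R$, measurable and such that $w,w',\dots,w^{(n-2)}$ are absolutely continuous on every compact interval (so that $w^{(n-1)}$ exists almost everywhere; no condition beyond measurability if $n=1$), write $X\sim DPE(w)$ (polynomial ensemble of derivative type in the additive sense) if $X\sim PE(w,w',\dots,w^{(n-1)})$. A random Hermitian matrix $X$ is unitarily invariant if $UXU^*$ has the same distribution as $X$ for every unitary $U\in\mathrm U(n)$. Let $X$ and $Y$ be independent, unitarily invariant random $n\times n$ Hermitian matrices with $X\sim DPE(w_1)$ and $Y\sim DPE(w_2)$. Then the convolution $$(w_1*w_2)(x)=\int_{-\infty}^{\infty}w_1(x-y)\,w_2(y)\,dy$$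 converges absolutely for almost every $x\in\mathbb R$, and $$X+Y\sim DPE(w_1*w_2).$$ In particular, $w_1*w_2$ again has the regularity required of the function $w$ in the definition of $DPE(w)$. -/

import Mathlib

namespace RandomHermitian

open MeasureTheory ProbabilityTheory

open scoped ENNReal Nat

/-- The real vector space of `n × n` complex Hermitian matrices. -/
abbrev Herm (n : ℕ) : Type := selfAdjoint (Matrix (Fin n) (Fin n) ℂ)

/-- Hermitian matrices carry the Borel σ-algebra of their usual (entrywise) topology. -/
noncomputable instance instMeasurableSpaceHerm (n : ℕ) : MeasurableSpace (Herm n) := borel (Herm n)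

instance instBorelSpaceHerm (n : ℕ) : BorelSpace (Herm n) := ⟨rfl⟩

/-- The conjugate `U A U*` of a Hermitian matrix. -/
noncomputable def conjBy {n : ℕ} (U : Matrix (Fin n) (Fin n) ℂ) (A : Herm n) : Herm n :=
  ⟨U * A.1 * star U, IsSelfAdjoint.conjugate A.2 U⟩

/-- The eigenvalues of a Hermitian matrix, repeated according to multiplicity, listed in the
(decreasing) order in which Mathlib lists them. -/
noncomputable def eigenvals {n : ℕ} (A : Herm n) : Fin n → ℝ :=
  Matrix.IsHermitian.eigenvalues (A := A.1) A.2

variable {Ω : Type*} [MeasurableSpace Ω]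

/-- The random Hermitian matrix `X` is unitarily invariant: `U X U*` has the same law as `X`
for every unitary matrix `U`. -/
def UnitarilyInvariant {n : ℕ} (P : Measure Ω) (X : Ω → Herm n) : Prop :=
  ∀ U ∈ Matrix.unitaryGroup (Fin n) ℂ, IdentDistrib (fun ω => conjBy U (X ω)) X P P

/-- The distribution on `ℝⁿ` of the eigenvalues of `X`, listed in uniformly random order. -/
noncomputable def eigenvalueLaw {n : ℕ} (P : Measure Ω) (X : Ω → Herm n) :
    Measure (Fin n → ℝ) :=
  ((n ! : ℕ) : ℝ≥0∞)⁻¹ •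
    ∑ σ : Equiv.Perm (Fin n), P.map (fun ω => fun j => eigenvals (X ω) (σ j))

/-- The function `(1 / Z) * Δₙ(x) * det [v k (x j)]` on `ℝⁿ`, where `Δₙ` is the Vandermonde
determinant `∏_{j < k} (x k - x j)`. -/
noncomputable def polyDensity {n : ℕ} (v : Fin n → ℝ → ℝ) (Z : ℝ) (x : Fin n → ℝ) : ℝ :=
  Z⁻¹ * (Matrix.vandermonde x).det * (Matrix.of fun j k : Fin n => v k (x j)).det

/-- `X ∼ PE(v₁, …, vₙ)`: for some normalization constant `Z ≠ 0`, the function `polyDensity v Z`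
is a probability density on `ℝⁿ` (in particular it is nonnegative almost everywhere), and it is
the density of the eigenvalues of `X`. -/
def IsPE {n : ℕ} (P : Measure Ω) (X : Ω → Herm n) (v : Fin n → ℝ → ℝ) : Prop :=
  (∀ k, AEMeasurable (v k) volume) ∧
    ∃ Z : ℝ, Z ≠ 0 ∧ (∀ᵐ x ∂(volume : Measure (Fin n → ℝ)), 0 ≤ polyDensity v Z x) ∧
      eigenvalueLaw P X = volume.withDensity (fun x => ENNReal.ofReal (polyDensity v Z x))

/-- `w, w', …, w^{(n-2)}` are absolutely continuous on every compact interval. Equivalently, `w` is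
of class `C^{n-2}` with locally absolutely continuous `w^{(n-2)}`, so that `w^{(n-1)}` exists almost
everywhere and is locally integrable. For `n ≤ 1` there is no condition. -/
def HasDerivativesBelow (n : ℕ) (w : ℝ → ℝ) : Prop :=
  ∀ k : ℕ, k + 1 < n → ∀ a b : ℝ, AbsolutelyContinuousOnInterval (iteratedDeriv k w) a b

/-- `X ∼ DPE(w)`: the eigenvalues of `X` are the polynomial ensemble
`PE(w, w', …, w^{(n-1)})` of derivative type in the additive sense. -/
def IsDPE {n : ℕ} (P : Measure Ω) (X : Ω → Herm n) (w : ℝ → ℝ) : Prop :=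
  HasDerivativesBelow n w ∧ IsPE P X (fun k : Fin n => iteratedDeriv (k : ℕ) w)

/-- The convolution of two functions on the real line,
`x ↦ ∫ t, w₁ t * w₂ (x - t) = ∫ y, w₁ (x - y) * w₂ y`. -/
noncomputable def conv (w₁ w₂ : ℝ → ℝ) : ℝ → ℝ :=
  convolution w₁ w₂ (ContinuousLinearMap.mul ℝ ℝ) volume

end RandomHermitian

/-! A unitarily invariant law on Hermitian matrices is determined by the characteristic function of
its diagonal, because every real linear functional of a Hermitian matrix becomes, after a unitary
conjugation, a combination of diagonal entries (`exists_diag_functional`,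
`ConjInvariantMeasure.ext_of_diagChar`). For independent summands this function is multiplicative.
For `DPE(w)` it is a constant times `∏ ŵ(s_i)`, where `ŵ` is the Fourier transform of `w`
(`DerivChain.integral_orbitChar_mul`). Since `ŵ₁ ŵ₂` is the transform of `w₁ * w₂`, the sum has the
diagonal characteristic function that the a priori signed density attached to `w₁ * w₂` produces,
and uniqueness yields both nonnegativity and the eigenvalue law
(`ConjInvariantMeasure.symLaw_eq_withDensity`).

The product formula comes from `hciz_formula`, which cancels the Vandermonde factor of the density.
Andréief's identity then leaves the determinant of `(-i s_j)^k ŵ(s_j)`, whose Vandermonde factor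
cancels the one in the HCIZ formula.

The HCIZ formula is obtained algebraically. Let `Δ` be the Vandermonde polynomial. Under a
conjugation invariant functional on polynomials in the matrix entries, multiplication by `tr Aᵐ`
corresponds, through `Δ(∂)` on diagonal polynomials, to multiplication by the `m`-th power sum
(`ConjInvariant.tracePow_mul`). The case `m = 2` uses invariance and the harmonicity of `Δ`. The
general case is Harish-Chandra's trick: the `m`-fold commutator of `tr(∂ᵐ)` with `tr A²` is `2^m m!
tr Aᵐ`. On a fixed orbit symmetric polynomials therefore act as scalars, which forces an alternating
orbit sum (`exists_eq_orbitSum`), and Taylor polynomials of the exponential give HCIZ in the limit.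

The analysis needs `(1 + |x|)^(n-1) w^(k)` to be integrable. This is extracted from the
integrability of the density by Cramer's rule (`weighted_of_integrable_polyDensity`). The universal
constant `Δ(∂)Δ` is never computed: normalization at `s = 0` supplies all that is needed. -/

namespace RandomHermitian

open MeasureTheory ProbabilityTheory

open scoped ENNReal Nat

/-! ### Constant coefficient differential operators on polynomials. -/

section DiffOp

open MvPolynomial

variable {ι : Type*}

/-- The partial derivative with respect to the variable `i`, as a linear endomorphism. -/
noncomputable def partialEnd (i : ι) : Module.End ℂ (MvPolynomial ι ℂ) :=
  ((pderiv i : Derivation ℂ (MvPolynomial ι ℂ) (MvPolynomial ι ℂ)) :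
    MvPolynomial ι ℂ →ₗ[ℂ] MvPolynomial ι ℂ)

@[simp] lemma partialEnd_apply (i : ι) (p : MvPolynomial ι ℂ) : partialEnd i p = pderiv i p := rfl

lemma pderiv_pderiv_comm (i j : ι) (p : MvPolynomial ι ℂ) :
    pderiv i (pderiv j p) = pderiv j (pderiv i p) := by
  classical
  have h : ⁅(pderiv i : Derivation ℂ (MvPolynomial ι ℂ) (MvPolynomial ι ℂ)),
      (pderiv j : Derivation ℂ (MvPolynomial ι ℂ) (MvPolynomial ι ℂ))⁆ = 0 := by
    apply MvPolynomial.derivation_ext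
    intro k
    rw [Derivation.commutator_apply]
    simp only [pderiv_X, Pi.single_apply, Derivation.coe_zero, Pi.zero_apply]
    split_ifs <;> simp
  have h2 := congrArg (fun D => D p) h
  simp only [Derivation.commutator_apply, Derivation.coe_zero, Pi.zero_apply] at h2
  exact sub_eq_zero.mp h2

lemma partialEnd_comm (i j : ι) : partialEnd i * partialEnd j = partialEnd j * partialEnd i :=
  LinearMap.ext fun p => pderiv_pderiv_comm i j p

/-- The commutative algebra of constant coefficient differential operators. -/
noncomputable abbrev ConstCoeff (ι : Type*) : Subalgebra ℂ (Module.End ℂ (MvPolynomial ι ℂ)) :=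
  Algebra.adjoin ℂ (Set.range (partialEnd (ι := ι)))

/-- Evaluating a polynomial at the partial derivatives by `aeval` needs a commutative target, which
the full endomorphism algebra is not. -/
instance constCoeff_isMulCommutative : IsMulCommutative (ConstCoeff ι) :=
  Algebra.isMulCommutative_adjoin ℂ (by
    rintro _ ⟨i, rfl⟩ _ ⟨j, rfl⟩; exact partialEnd_comm i j)

open scoped IsMulCommutative in
/-- The constant coefficient differential operator `p(∂)` attached to a polynomial `p`. -/
noncomputable def diffOp : MvPolynomial ι ℂ →ₐ[ℂ] Module.End ℂ (MvPolynomial ι ℂ) :=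
  (ConstCoeff ι).val.comp
    (aeval (fun i => (⟨partialEnd i, Algebra.subset_adjoin ⟨i, rfl⟩⟩ : ConstCoeff ι)))

@[simp] lemma diffOp_X (i : ι) : diffOp (X i : MvPolynomial ι ℂ) = partialEnd i := by
  simp [diffOp]

lemma diffOp_mul_apply (p q f : MvPolynomial ι ℂ) :
    diffOp (p * q) f = diffOp p (diffOp q f) := by
  rw [map_mul]; rfl

lemma diffOp_mul_X_apply (p f : MvPolynomial ι ℂ) (i : ι) :
    diffOp (p * X i) f = diffOp p (pderiv i f) := by
  rw [diffOp_mul_apply, diffOp_X]; rfl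

lemma diffOp_C_apply (a : ℂ) (f : MvPolynomial ι ℂ) : diffOp (C a) f = C a * f := by
  have : (C a : MvPolynomial ι ℂ) = algebraMap ℂ _ a := rfl
  rw [this, AlgHom.commutes, Module.algebraMap_end_apply, MvPolynomial.smul_eq_C_mul]
  rfl

/-- Canonical commutation relation: bracketing with a coordinate differentiates the symbol of the
operator. -/
lemma diffOp_X_mul (p f : MvPolynomial ι ℂ) (i : ι) :
    diffOp p (X i * f) = X i * diffOp p f + diffOp (pderiv i p) f := by
  classical
  induction p using MvPolynomial.induction_on generalizing f with
  | C a => simp only [diffOp_C_apply, pderiv_C, map_zero, LinearMap.zero_apply]; ring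
  | add p q hp hq => simp only [map_add, LinearMap.add_apply, hp, hq]; ring
  | mul_X p j hp =>
    rw [diffOp_mul_X_apply, diffOp_mul_X_apply, Derivation.leibniz, Derivation.leibniz, pderiv_X,
      pderiv_X]
    simp only [smul_eq_mul, map_add, hp, LinearMap.add_apply]
    rw [mul_comm (X j) (pderiv i p), diffOp_mul_X_apply]
    by_cases h : j = i
    · subst h; simp only [Pi.single_eq_same, mul_one]; ring
    · rw [Pi.single_eq_of_ne h, Pi.single_eq_of_ne' h]; simp

/-- Multiplication by a polynomial, as a linear endomorphism. -/
noncomputable abbrev mulEnd (p : MvPolynomial ι ℂ) : Module.End ℂ (MvPolynomial ι ℂ) :=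
  LinearMap.mulLeft ℂ p

end DiffOp

/-! ### Iterated commutators in a ring. -/

section Ad

variable {A : Type*} [Ring A]

/-- The commutator `[a, q] = a q - q a`, as a function of `a`. -/
def commWith (q a : A) : A := a * q - q * a

lemma commWith_mul (q a b : A) : commWith q (a * b) = a * commWith q b + commWith q a * b := by
  simp only [commWith]; noncomm_ring

lemma commWith_add (q a b : A) : commWith q (a + b) = commWith q a + commWith q b := by
  simp only [commWith]; noncomm_ring

lemma commWith_iterate_zero (q : A) (k : ℕ) : (commWith q)^[k] 0 = 0 := by
  induction k with
  | zero => rfl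
  | succ k ih => rw [Function.iterate_succ_apply', ih]; simp [commWith]

lemma commWith_iterate_add (q a b : A) (k : ℕ) :
    (commWith q)^[k] (a + b) = (commWith q)^[k] a + (commWith q)^[k] b := by
  induction k with
  | zero => rfl
  | succ k ih => simp only [Function.iterate_succ_apply', ih, commWith_add]

lemma commWith_iterate_sum {κ : Type*} (q : A) (s : Finset κ) (a : κ → A) (k : ℕ) :
    (commWith q)^[k] (∑ i ∈ s, a i) = ∑ i ∈ s, (commWith q)^[k] (a i) := by
  classical
  induction s using Finset.induction_on with
  | empty => simp [commWith_iterate_zero]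
  | insert i s hi ih => rw [Finset.sum_insert hi, Finset.sum_insert hi, commWith_iterate_add, ih]

/-- The bracket with `q` is a derivation, and its second power kills `d`, so only two terms of the
Leibniz expansion survive. -/
lemma commWith_iterate_mul {q d : A} (hd : commWith q (commWith q d) = 0) (b : A) (k : ℕ) :
    (commWith q)^[k + 1] (d * b) = d * (commWith q)^[k + 1] b +
      ((k + 1 : ℕ) : A) * commWith q d * (commWith q)^[k] b := by
  induction k with
  | zero => simp [commWith_mul]
  | succ k ih =>
    rw [Function.iterate_succ_apply', ih, commWith_add, commWith_mul]
    have h1 : commWith q (((k + 1 : ℕ) : A) * commWith q d * (commWith q)^[k] b) =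
        ((k + 1 : ℕ) : A) * commWith q d * (commWith q)^[k + 1] b := by
      have hz : commWith q (((k + 1 : ℕ) : A) * commWith q d) = 0 := by
        rw [commWith_mul, hd]
        rw [mul_zero, zero_add, commWith, (Nat.cast_commute (k + 1) q).eq, sub_self, zero_mul]
      rw [commWith_mul, hz, Function.iterate_succ_apply' _ k b, zero_mul, add_zero]
    rw [h1, ← Function.iterate_succ_apply' (commWith q) (k + 1) b, Nat.cast_succ (k + 1)]
    rw [add_assoc]
    congr 1
    noncomm_ring

end Ad

/-! ### Commutators of differential operators with a quadratic form. -/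

section HarishChandra

open MvPolynomial

variable {ι : Type*}

lemma commWith_mulEnd_partialEnd (Q : MvPolynomial ι ℂ) (i : ι) :
    commWith (mulEnd Q) (partialEnd i) = mulEnd (pderiv i Q) := by
  refine LinearMap.ext fun f => ?_
  simp only [commWith, LinearMap.sub_apply, Module.End.mul_apply, LinearMap.mulLeft_apply,
    partialEnd_apply, Derivation.leibniz, smul_eq_mul]
  ring

lemma commWith_mulEnd_mulEnd (Q p : MvPolynomial ι ℂ) :
    commWith (mulEnd Q) (mulEnd p) = 0 := by
  refine LinearMap.ext fun f => ?_
  simp only [commWith, LinearMap.sub_apply, Module.End.mul_apply, LinearMap.mulLeft_apply,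
    LinearMap.zero_apply]
  ring

/-- The `k`-fold commutator of `e(∂)` with multiplication by the quadratic form `Q` is, up to the
factor `2 ^ k * k!`, multiplication by `e` composed with `τ`. -/
def IteratedCommutator (Q : MvPolynomial ι ℂ) (τ : ι → ι) (k : ℕ) (e : MvPolynomial ι ℂ) : Prop :=
  (commWith (mulEnd Q))^[k] (diffOp e) = mulEnd (C ((2 : ℂ) ^ k * (k ! : ℂ)) * rename τ e)

lemma IteratedCommutator.sum {Q : MvPolynomial ι ℂ} {τ : ι → ι} {k : ℕ} {κ : Type*}
    (s : Finset κ) {e : κ → MvPolynomial ι ℂ} (h : ∀ i ∈ s, IteratedCommutator Q τ k (e i)) :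
    IteratedCommutator Q τ k (∑ i ∈ s, e i) := by
  unfold IteratedCommutator
  rw [map_sum, commWith_iterate_sum, Finset.sum_congr rfl h]
  refine LinearMap.ext fun f => ?_
  simp [LinearMap.sum_apply, Finset.mul_sum, Finset.sum_mul, mul_assoc]

lemma IteratedCommutator.C (Q : MvPolynomial ι ℂ) (τ : ι → ι) (a : ℂ) :
    IteratedCommutator Q τ 0 (MvPolynomial.C a) := by
  unfold IteratedCommutator
  refine LinearMap.ext fun f => ?_
  simp [MvPolynomial.smul_eq_C_mul]

/-- The bracket of `∂_i` with `Q` is multiplication by `2 X (τ i)`, which commutes with `Q`. Of the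
two Leibniz terms, the one with `k + 1` brackets on `e` vanishes since `k` brackets already give a
multiplication operator; the other contributes the new factor `2 (k + 1)`. -/
lemma IteratedCommutator.X_mul {Q : MvPolynomial ι ℂ} {τ : ι → ι}
    (hQ : ∀ i, pderiv i Q = MvPolynomial.C 2 * X (τ i)) {k : ℕ}
    {e : MvPolynomial ι ℂ} (h : IteratedCommutator Q τ k e) (i : ι) :
    IteratedCommutator Q τ (k + 1) (X i * e) := by
  unfold IteratedCommutator at h ⊢
  rw [map_mul, diffOp_X, commWith_iterate_mul, Function.iterate_succ_apply', h,
    commWith_mulEnd_mulEnd, commWith_mulEnd_partialEnd, hQ]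
  · refine LinearMap.ext fun f => ?_
    simp only [mul_zero, zero_add, Module.End.mul_apply, LinearMap.mulLeft_apply, map_mul,
      rename_X]
    have : ∀ g : MvPolynomial ι ℂ, ((k + 1 : ℕ) : Module.End ℂ (MvPolynomial ι ℂ)) g
        = MvPolynomial.C ((k + 1 : ℕ) : ℂ) * g := by
      intro g
      rw [← nsmul_one, LinearMap.smul_apply, Module.End.one_apply, nsmul_eq_mul]
      simp
    rw [this]
    simp only [← mul_assoc, ← map_mul]
    rw [Nat.factorial_succ, pow_succ]
    push_cast
    simp only [map_mul, map_add, map_natCast, map_one, map_pow]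
    ring
  · rw [commWith_mulEnd_partialEnd, commWith_mulEnd_mulEnd]

end HarishChandra

/-! ### Infinitesimal conjugation and invariant functionals. -/

section Invariant

open MvPolynomial

variable {n : ℕ}

/-- Polynomials in the entries of an `n × n` matrix. -/
abbrev EntryPoly (n : ℕ) : Type := MvPolynomial (Fin n × Fin n) ℂ

/-- The generic `n × n` matrix. -/
noncomputable def genericMat (n : ℕ) : Matrix (Fin n) (Fin n) (EntryPoly n) :=
  Matrix.of fun i j => X (i, j)

/-- The commutator of the matrix unit `E_{ij}` with a matrix `M` of polynomials. -/
noncomputable def unitComm (i j : Fin n) (M : Matrix (Fin n) (Fin n) (EntryPoly n)) :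
    Matrix (Fin n) (Fin n) (EntryPoly n) :=
  Matrix.single i j 1 * M - M * Matrix.single i j 1

/-- The derivation of the algebra of entry polynomials with `A ↦ E_{ij} A - A E_{ij}`, where `A` is
the generic matrix. -/
noncomputable def adDeriv (i j : Fin n) : Derivation ℂ (EntryPoly n) (EntryPoly n) :=
  mkDerivation ℂ fun kl =>
    unitComm i j (genericMat n) kl.1 kl.2

lemma adDeriv_X (i j k l : Fin n) : adDeriv i j (X (k, l)) =
    (if k = i then X (j, l) else 0) - (if l = j then X (k, i) else 0) := by
  rw [adDeriv, mkDerivation_X, unitComm, Matrix.sub_apply]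
  congr 1
  · split_ifs with h
    · subst h; simp [genericMat]
    · exact Matrix.single_mul_apply_of_ne _ _ _ _ _ h _
  · split_ifs with h
    · subst h; simp [genericMat]
    · exact Matrix.mul_single_apply_of_ne _ _ _ _ _ h _

lemma adDeriv_genericMat_pow (i j : Fin n) (m : ℕ) (k l : Fin n) :
    adDeriv i j ((genericMat n ^ m) k l) =
      unitComm i j (genericMat n ^ m) k l := by
  induction m generalizing k l with
  | zero =>
    simp only [unitComm, pow_zero, mul_one, one_mul, sub_self, Matrix.zero_apply]
    rw [Matrix.one_apply]; split_ifs <;> simp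
  | succ m ih =>
    have h1 : ∀ k l, adDeriv i j (genericMat n k l) =
        unitComm i j (genericMat n) k l := by
      intro k l
      rw [genericMat, Matrix.of_apply, adDeriv, mkDerivation_X]; rfl
    have : unitComm i j (genericMat n ^ (m + 1)) =
        unitComm i j (genericMat n ^ m) * genericMat n +
          genericMat n ^ m * unitComm i j (genericMat n) := by
      simp only [unitComm, pow_succ]; noncomm_ring
    rw [this, pow_succ, Matrix.mul_apply, map_sum, Matrix.add_apply, Matrix.mul_apply,
      Matrix.mul_apply, ← Finset.sum_add_distrib]
    refine Finset.sum_congr rfl fun a _ => ?_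
    rw [Derivation.leibniz, ih, h1, smul_eq_mul, smul_eq_mul]
    ring

/-- The trace of the `k`-th power of the generic matrix. -/
noncomputable def tracePow (n k : ℕ) : EntryPoly n := (genericMat n ^ k).trace

lemma adDeriv_tracePow (i j : Fin n) (k : ℕ) : adDeriv i j (tracePow n k) = 0 := by
  simp only [tracePow, Matrix.trace, map_sum, Matrix.diag_apply]
  simp_rw [adDeriv_genericMat_pow]
  have := Matrix.trace_sub (Matrix.single i j 1 * genericMat n ^ k)
    (genericMat n ^ k * Matrix.single i j 1)
  rw [Matrix.trace_mul_comm, sub_self] at this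
  exact this

/-- A commutator of derivations is a derivation, so the identity needs checking only on the
variables. -/
lemma pderiv_adDeriv (k l i j : Fin n) (f : EntryPoly n) :
    pderiv (k, l) (adDeriv i j f) = adDeriv i j (pderiv (k, l) f) +
      ((if k = j then pderiv (i, l) f else 0) - (if l = i then pderiv (k, j) f else 0)) := by
  have h : ⁅(pderiv (k, l) : Derivation ℂ (EntryPoly n) (EntryPoly n)), adDeriv i j⁆ =
      (if k = j then pderiv (i, l) else 0) - (if l = i then pderiv (k, j) else 0) := by
    apply MvPolynomial.derivation_ext
    rintro ⟨a, b⟩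
    have hz : adDeriv i j (Pi.single (M := fun _ => EntryPoly n) (k, l) 1 (a, b)) = 0 := by
      rw [Pi.single_apply]; split_ifs <;> simp
    rw [Derivation.commutator_apply, adDeriv_X, pderiv_X, hz, sub_zero, Derivation.sub_apply,
      map_sub]
    have hp : ∀ x y : Fin n × Fin n, pderiv x (X y : EntryPoly n) = if x = y then 1 else 0 := by
      intro x y
      rw [pderiv_X, Pi.single_apply]
      simp only [eq_comm]
    refine congrArg₂ (· - ·) ?_ ?_
    · by_cases h2 : k = j
      · subst h2
        rw [if_pos rfl, hp]
        by_cases h1 : a = i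
        · subst h1
          rw [if_pos rfl, hp]
          simp
        · rw [if_neg h1, map_zero, if_neg (fun h => h1 (Prod.ext_iff.mp h).1.symm)]
      · rw [if_neg h2, Derivation.zero_apply]
        split_ifs
        · rw [hp, if_neg (fun h => h2 (Prod.ext_iff.mp h).1)]
        · exact map_zero _
    · by_cases h2 : l = i
      · subst h2
        rw [if_pos rfl, hp]
        by_cases h1 : b = j
        · subst h1
          rw [if_pos rfl, hp]
          simp
        · rw [if_neg h1, map_zero, if_neg (fun h => h1 (Prod.ext_iff.mp h).2.symm)]
      · rw [if_neg h2, Derivation.zero_apply]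
        split_ifs
        · rw [hp, if_neg (fun h => h2 (Prod.ext_iff.mp h).2)]
        · exact map_zero _
  have h2 := congrArg (fun D => D f) h
  simp only [Derivation.commutator_apply, Derivation.sub_apply] at h2
  rw [← sub_eq_iff_eq_add', h2]
  split_ifs <;> simp

/-- Derivatives transform dually to the entries, which is why the symbol is moved by `adDeriv j i`,
with the indices exchanged. In particular `e(∂)` commutes with infinitesimal conjugation when `e` is
invariant. -/
lemma diffOp_adDeriv (e f : EntryPoly n) (i j : Fin n) :
    diffOp e (adDeriv i j f) = adDeriv i j (diffOp e f) + diffOp (adDeriv j i e) f := by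
  induction e using MvPolynomial.induction_on generalizing f with
  | C a =>
    rw [diffOp_C_apply, diffOp_C_apply, Derivation.leibniz, MvPolynomial.derivation_C,
      MvPolynomial.derivation_C]
    simp
  | add p q hp hq => simp only [map_add, LinearMap.add_apply, hp, hq]; ring
  | mul_X p kl hp =>
    obtain ⟨k, l⟩ := kl
    rw [diffOp_mul_X_apply, diffOp_mul_X_apply, pderiv_adDeriv, map_add, hp, Derivation.leibniz,
      adDeriv_X, map_add, LinearMap.add_apply, smul_eq_mul, smul_eq_mul,
      mul_comm (X (k, l)), diffOp_mul_X_apply, mul_sub, map_sub, map_sub, LinearMap.sub_apply]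
    have h1 : diffOp p (if k = j then pderiv (i, l) f else 0) =
        diffOp (p * if k = j then X (i, l) else 0) f := by
      split_ifs
      · rw [diffOp_mul_X_apply]
      · simp
    have h2 : diffOp p (if l = i then pderiv (k, j) f else 0) =
        diffOp (p * if l = i then X (k, j) else 0) f := by
      split_ifs
      · rw [diffOp_mul_X_apply]
      · simp
    rw [h1, h2]
    ring

/-- A linear functional on entry polynomials that is invariant under infinitesimal conjugation. -/
def ConjInvariant (Φ : EntryPoly n →ₗ[ℂ] ℂ) : Prop := ∀ i j f, Φ (adDeriv i j f) = 0

lemma ConjInvariant.comp_mulEnd {Φ : EntryPoly n →ₗ[ℂ] ℂ} (hΦ : ConjInvariant Φ) {e : EntryPoly n}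
    (he : ∀ i j, adDeriv i j e = 0) : ConjInvariant (Φ ∘ₗ mulEnd e) := by
  intro i j f
  have := hΦ i j (e * f)
  rw [Derivation.leibniz, he, smul_zero, add_zero] at this
  exact this

lemma ConjInvariant.comp_diffOp {Φ : EntryPoly n →ₗ[ℂ] ℂ} (hΦ : ConjInvariant Φ) {e : EntryPoly n}
    (he : ∀ i j, adDeriv i j e = 0) : ConjInvariant (Φ ∘ₗ diffOp e) := by
  intro i j f
  rw [LinearMap.comp_apply, diffOp_adDeriv, he, map_zero, LinearMap.zero_apply, add_zero, hΦ]

/-- The inclusion of polynomials in the diagonal entries. -/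
noncomputable def diagIncl (n : ℕ) : MvPolynomial (Fin n) ℂ →ₐ[ℂ] EntryPoly n :=
  rename fun i => (i, i)

/-- The restriction of entry polynomials to diagonal matrices. -/
noncomputable def diagRestrict (n : ℕ) : EntryPoly n →ₐ[ℂ] MvPolynomial (Fin n) ℂ :=
  aeval fun kl => if kl.1 = kl.2 then X kl.1 else 0

lemma pderiv_diagIncl (k l : Fin n) (q : MvPolynomial (Fin n) ℂ) :
    pderiv (k, l) (diagIncl n q) = if k = l then diagIncl n (pderiv k q) else 0 := by
  have hinj : Function.Injective (fun i : Fin n => (i, i)) := fun a b h => (Prod.ext_iff.mp h).1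
  split_ifs with h
  · subst h
    exact pderiv_rename hinj _ _
  · induction q using MvPolynomial.induction_on with
    | C a => simp [diagIncl]
    | add p q hp hq => simp [hp, hq]
    | mul_X p i hp =>
      rw [map_mul, Derivation.leibniz, hp]
      have : (k, l) ≠ (i, i) := by
        rintro ⟨⟩; exact h rfl
      simp [diagIncl, pderiv_X, this]

/-- Derivatives in off-diagonal entries annihilate functions of the diagonal, so only the
restriction of the symbol matters. -/
lemma diffOp_diagIncl (e : EntryPoly n) (q : MvPolynomial (Fin n) ℂ) :
    diffOp e (diagIncl n q) = diagIncl n (diffOp (diagRestrict n e) q) := by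
  induction e using MvPolynomial.induction_on generalizing q with
  | C a =>
    rw [diffOp_C_apply]
    have : diagRestrict n (C a) = C a := by
      rw [diagRestrict, aeval_C]; rfl
    rw [this, diffOp_C_apply, map_mul]
    simp [diagIncl]
  | add p q hp hq => simp only [map_add, LinearMap.add_apply, hp, hq]
  | mul_X p kl hp =>
    obtain ⟨k, l⟩ := kl
    rw [diffOp_mul_X_apply, pderiv_diagIncl, map_mul, diagRestrict, aeval_X]
    by_cases h : k = l
    · simp only [h, if_true]
      rw [diffOp_mul_X_apply, hp]; rfl
    · simp [h]

lemma adDeriv_diagIncl (i j : Fin n) (q : MvPolynomial (Fin n) ℂ) (hij : i ≠ j) :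
    adDeriv i j (diagIncl n q) = X (j, i) * diagIncl n (pderiv i q - pderiv j q) := by
  induction q using MvPolynomial.induction_on with
  | C a => simp [diagIncl]
  | add p q hp hq => simp only [map_add, hp, hq, map_sub]; ring
  | mul_X p k hp =>
    rw [map_mul, Derivation.leibniz, hp]
    have : diagIncl n (X k) = X (k, k) := by simp [diagIncl]
    rw [this, adDeriv_X]
    simp only [Derivation.leibniz, pderiv_X, smul_eq_mul, map_sub, map_add, map_mul, this]
    by_cases h1 : k = i
    · subst h1; simp [hij]; ring
    · by_cases h2 : k = j
      · subst h2; simp [h1]; ring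
      · simp [h1, h2, Ne.symm h1, Ne.symm h2]; ring

/-- This is integration by parts along the orbit: invariance is applied to `X (i, j) * r`. It trades
the off-diagonal quadratic term for a factor in the diagonal entries, at the price of a derivative
`∂_i - ∂_j`. -/
lemma ConjInvariant.offDiag {Φ : EntryPoly n →ₗ[ℂ] ℂ} (hΦ : ConjInvariant Φ) {i j : Fin n}
    (hij : i ≠ j) (r : MvPolynomial (Fin n) ℂ) :
    Φ (X (i, j) * X (j, i) * diagIncl n (pderiv i r - pderiv j r)) =
      Φ (diagIncl n ((X i - X j) * r)) := by
  have h := hΦ i j (X (i, j) * diagIncl n r)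
  rw [Derivation.leibniz, adDeriv_diagIncl i j r hij, adDeriv_X] at h
  have hX : ∀ k, diagIncl n (X k) = X (k, k) := fun k => by simp [diagIncl]
  simp only [if_true, smul_eq_mul] at h
  rw [map_add] at h
  rw [mul_assoc, eq_neg_of_add_eq_zero_left h, ← map_neg]
  congr 1
  rw [map_mul, map_sub, hX, hX]
  ring

end Invariant

/-! ### The Vandermonde polynomial and its harmonicity. -/

section Vandermonde

open MvPolynomial

variable {n : ℕ}

lemma mvPolynomial_C_two {ι : Type*} : (C 2 : MvPolynomial ι ℂ) = 2 := map_ofNat C 2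

/-- The pairs `(i, j)` of indices with `i < j`. -/
def orderedPairs (n : ℕ) : Finset (Fin n × Fin n) := Finset.univ.filter fun p => p.1 < p.2

lemma det_vandermonde_eq_prod_orderedPairs {R : Type*} [CommRing R] (v : Fin n → R) :
    (Matrix.vandermonde v).det = ∏ p ∈ orderedPairs n, (v p.2 - v p.1) := by
  rw [Matrix.det_vandermonde, orderedPairs, Finset.prod_filter, ← Finset.univ_product_univ,
    Finset.prod_product]
  refine Finset.prod_congr rfl fun i _ => ?_
  rw [← Finset.prod_filter]
  refine Finset.prod_congr ?_ fun _ _ => rfl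
  ext j; simp

/-- The Vandermonde polynomial. -/
noncomputable def vdm (n : ℕ) : MvPolynomial (Fin n) ℂ := (Matrix.vandermonde X).det

/-- The Vandermonde polynomial with one factor removed. -/
noncomputable def vdmErase (p : Fin n × Fin n) : MvPolynomial (Fin n) ℂ :=
  ∏ r ∈ (orderedPairs n).erase p, (X r.2 - X r.1)

lemma vdm_eq_prod : vdm n = ∏ p ∈ orderedPairs n, (X p.2 - X p.1) :=
  det_vandermonde_eq_prod_orderedPairs _

lemma vdm_eq_mul_erase {p : Fin n × Fin n} (hp : p ∈ orderedPairs n) :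
    vdm n = (X p.2 - X p.1) * vdmErase p := by
  rw [vdm_eq_prod, vdmErase]
  exact (Finset.mul_prod_erase _ (fun r : Fin n × Fin n => (X r.2 - X r.1 : MvPolynomial (Fin n) ℂ)) hp).symm

lemma eval_vdm (x : Fin n → ℂ) : eval x (vdm n) = (Matrix.vandermonde x).det := by
  rw [vdm_eq_prod, det_vandermonde_eq_prod_orderedPairs]
  simp

lemma derivation_prod {R A κ : Type*} [CommSemiring R] [CommSemiring A] [Algebra R A]
    [DecidableEq κ] (D : Derivation R A A) (s : Finset κ) (f : κ → A) :
    D (∏ i ∈ s, f i) = ∑ i ∈ s, (∏ j ∈ s.erase i, f j) * D (f i) := by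
  induction s using Finset.induction_on with
  | empty => simp
  | insert a s ha ih =>
    rw [Finset.prod_insert ha, Derivation.leibniz, ih, Finset.sum_insert ha,
      Finset.erase_insert ha, smul_eq_mul, smul_eq_mul, add_comm, Finset.mul_sum]
    congr 1
    refine Finset.sum_congr rfl fun i hi => ?_
    have hne : a ≠ i := fun h => ha (h ▸ hi)
    rw [Finset.erase_insert_of_ne hne, Finset.prod_insert (by simp [ha]), mul_assoc]

lemma pderiv_vdm (k : Fin n) : pderiv k (vdm n) =
    ∑ p ∈ orderedPairs n, vdmErase p * ((if p.2 = k then 1 else 0) - if p.1 = k then 1 else 0) := by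
  rw [vdm_eq_prod, derivation_prod]
  refine Finset.sum_congr rfl fun p _ => ?_
  rw [map_sub, pderiv_X, pderiv_X, Pi.single_apply, Pi.single_apply, vdmErase]

lemma pderiv_prod_aeval (σ : Equiv.Perm (Fin n)) (g : Fin n → Polynomial ℂ) (k : Fin n) :
    pderiv k (∏ i, Polynomial.aeval (X (σ i) : MvPolynomial (Fin n) ℂ) (g i)) =
      ∏ i, Polynomial.aeval (X (σ i) : MvPolynomial (Fin n) ℂ)
        (Function.update g (σ.symm k) (Polynomial.derivative (g (σ.symm k))) i) := by
  rw [derivation_prod, Finset.sum_eq_single (σ.symm k)]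
  · rw [← Finset.prod_erase_mul _ _ (Finset.mem_univ (σ.symm k)), Derivation.map_aeval]
    simp only [Equiv.apply_symm_apply, pderiv_X_self, smul_eq_mul, mul_one, Function.update_self]
    congr 1
    refine Finset.prod_congr rfl fun i hi => ?_
    rw [Function.update_of_ne (Finset.ne_of_mem_erase hi)]
  · intro i _ hi
    rw [Derivation.map_aeval, pderiv_X_of_ne, smul_zero, mul_zero]
    intro h
    exact hi (by rw [← h, Equiv.symm_apply_apply])
  · simp

lemma det_of_aeval (g : Fin n → Polynomial ℂ) :
    (Matrix.of fun i j => Polynomial.aeval (X i : MvPolynomial (Fin n) ℂ) (g j)).det =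
      ∑ σ : Equiv.Perm (Fin n), (Equiv.Perm.sign σ : ℤ) •
        ∏ i, Polynomial.aeval (X (σ i) : MvPolynomial (Fin n) ℂ) (g i) := by
  rw [Matrix.det_apply]
  rfl

lemma vdm_eq_det_aeval : vdm n =
    (Matrix.of fun i j : Fin n => Polynomial.aeval (X i : MvPolynomial (Fin n) ℂ)
      (Polynomial.X ^ (j : ℕ) : Polynomial ℂ)).det := by
  rw [vdm]
  congr 1
  ext1 i j
  simp [Matrix.vandermonde_apply]

/-- Differentiating column `m` of the Vandermonde matrix twice gives `m (m - 1)` times column `m -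
2`, hence a determinant with two proportional columns, or a zero column when `m < 2`. -/
lemma laplacian_vdm : ∑ k, pderiv k (pderiv k (vdm n)) = 0 := by
  set g : Fin n → Polynomial ℂ := fun j => Polynomial.X ^ (j : ℕ) with hg
  have h1 : ∑ k, pderiv k (pderiv k (vdm n)) =
      ∑ m, (Matrix.of fun i j => Polynomial.aeval (X i : MvPolynomial (Fin n) ℂ)
        (Function.update g m (Polynomial.derivative (Polynomial.derivative (g m))) j)).det := by
    rw [vdm_eq_det_aeval, det_of_aeval]
    simp only [map_sum, map_zsmul, pderiv_prod_aeval, Function.update_self,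
      Function.update_idem, det_of_aeval]
    rw [Finset.sum_comm]
    conv_rhs => rw [Finset.sum_comm]
    refine Finset.sum_congr rfl fun σ _ => ?_
    exact Fintype.sum_equiv σ.symm _ _ fun k => rfl
  rw [h1]
  refine Finset.sum_eq_zero fun m _ => ?_
  by_cases hm : 2 ≤ (m : ℕ)
  · have hlt : (m : ℕ) - 2 < n := by omega
    have hne : (⟨m - 2, hlt⟩ : Fin n) ≠ m := by
      intro h
      have := congrArg Fin.val h
      simp only at this
      omega
    have hcol : (Matrix.of fun i j => Polynomial.aeval (X i : MvPolynomial (Fin n) ℂ)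
        (Function.update g m (Polynomial.derivative (Polynomial.derivative (g m))) j)) =
        Matrix.updateCol (Matrix.of fun i j => Polynomial.aeval (X i : MvPolynomial (Fin n) ℂ) (g j))
          m ((((m : ℕ) * ((m : ℕ) - 1 : ℕ) : ℕ) : MvPolynomial (Fin n) ℂ) •
            fun i => Polynomial.aeval (X i : MvPolynomial (Fin n) ℂ) (g ⟨m - 2, hlt⟩)) := by
      ext1 i j
      rw [Matrix.updateCol_apply]
      split_ifs with h
      · subst h
        rw [Matrix.of_apply, Function.update_self]
        simp only [hg, Polynomial.derivative_X_pow, Polynomial.derivative_mul, Pi.smul_apply,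
          Polynomial.derivative_natCast, zero_mul, zero_add,
          smul_eq_mul, map_mul, map_pow, Polynomial.aeval_X, map_natCast,
          Nat.sub_sub]
        push_cast
        ring
      · rw [Matrix.of_apply, Function.update_of_ne h]; rfl
    rw [hcol, Matrix.det_updateCol_smul]
    rw [Matrix.det_zero_of_column_eq (i := (⟨m - 2, hlt⟩ : Fin n)) (j := m) hne, mul_zero]
    intro i
    rw [Matrix.updateCol_self, Matrix.updateCol_ne hne]
    rfl
  · refine Matrix.det_eq_zero_of_column_eq_zero m fun i => ?_
    rw [Matrix.of_apply, Function.update_self]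
    have : (m : ℕ) = 0 ∨ (m : ℕ) = 1 := by omega
    rcases this with h | h <;> simp [hg, h]

lemma rename_vdm (σ : Equiv.Perm (Fin n)) :
    rename σ (vdm n) = (Equiv.Perm.sign σ : ℤ) • vdm n := by
  have h : rename σ (vdm n) = ((Matrix.vandermonde (X : Fin n → MvPolynomial (Fin n) ℂ)).submatrix
      σ id).det := by
    rw [vdm, AlgHom.map_det]
    congr 1
    ext1 i j
    simp [Matrix.vandermonde_apply]
  rw [h, Matrix.det_permute, vdm]
  simp

/-- `Q`, the sum of the squares of the variables. -/
noncomputable def sumSq (n : ℕ) : MvPolynomial (Fin n) ℂ := psum (Fin n) ℂ 2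

lemma diffOp_sumSq_mul (p q : MvPolynomial (Fin n) ℂ) :
    diffOp p (sumSq n * q) = sumSq n * diffOp p q +
      C 2 * ∑ i, X i * diffOp (pderiv i p) q + diffOp (∑ i, pderiv i (pderiv i p)) q := by
  have h : ∀ i, diffOp p (X i ^ 2 * q) = X i ^ 2 * diffOp p q +
      C 2 * (X i * diffOp (pderiv i p) q) + diffOp (pderiv i (pderiv i p)) q := by
    intro i
    rw [pow_two, mul_assoc, diffOp_X_mul, diffOp_X_mul, diffOp_X_mul]
    rw [mvPolynomial_C_two]
    ring
  rw [sumSq, psum, Finset.sum_mul, map_sum, Finset.sum_congr rfl fun i _ => h i,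
    Finset.sum_add_distrib, Finset.sum_add_distrib, ← Finset.sum_mul, ← Finset.mul_sum, map_sum,
    LinearMap.sum_apply]

/-- Harmonicity removes the second-order term. In the first-order term each factor of `Δ` is
differentiated separately, and the two indices of a pair recombine into a difference of coordinates.
-/
lemma diffOp_vdm_sumSq_mul (q : MvPolynomial (Fin n) ℂ) :
    diffOp (vdm n) (sumSq n * q) = sumSq n * diffOp (vdm n) q +
      ∑ p ∈ orderedPairs n, C 2 * ((X p.2 - X p.1) * diffOp (vdmErase p) q) := by
  rw [diffOp_sumSq_mul, laplacian_vdm, map_zero, LinearMap.zero_apply, add_zero]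
  congr 1
  rw [← Finset.mul_sum]
  congr 1
  simp only [pderiv_vdm, map_sum, LinearMap.sum_apply, Finset.mul_sum]
  rw [Finset.sum_comm]
  refine Finset.sum_congr rfl fun p _ => ?_
  have h : ∀ i, X i * diffOp (vdmErase p * ((if p.2 = i then 1 else 0) - if p.1 = i then 1 else 0)) q
      = (if p.2 = i then X i * diffOp (vdmErase p) q else 0) -
        (if p.1 = i then X i * diffOp (vdmErase p) q else 0) := by
    intro i
    split_ifs <;> simp
  simp only [h, Finset.sum_sub_distrib, Finset.sum_ite_eq, Finset.mem_univ, if_true]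
  ring

end Vandermonde

/-! ### Harish-Chandra's radial part theorem in dual form. -/

section Intertwining

open MvPolynomial

variable {n : ℕ}

lemma tracePow_two : tracePow n 2 = ∑ i, ∑ j, X (i, j) * X (j, i) := by
  simp [tracePow, Matrix.trace, pow_two, Matrix.mul_apply, genericMat]

lemma sum_sum_eq_diag_add_orderedPairs {M : Type*} [AddCommMonoid M] (f : Fin n → Fin n → M)
    (hf : ∀ i j, f i j = f j i) :
    ∑ i, ∑ j, f i j = ∑ i, f i i + ∑ p ∈ orderedPairs n, 2 • f p.1 p.2 := by
  have h : ∀ i j, f i j = (if i = j then f i j else 0) + ((if i < j then f i j else 0) +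
      if j < i then f i j else 0) := by
    intro i j
    rcases lt_trichotomy i j with h | h | h
    · simp [h, h.ne, h.not_gt]
    · simp [h]
    · simp [h, h.ne', h.not_gt]
  have h2 : ∑ i, ∑ j, f i j = ∑ i, ∑ j, ((if i = j then f i j else 0) +
      ((if i < j then f i j else 0) + if j < i then f i j else 0)) :=
    Finset.sum_congr rfl fun i _ => Finset.sum_congr rfl fun j _ => h i j
  rw [h2]
  simp only [Finset.sum_add_distrib, Finset.sum_ite_eq, Finset.mem_univ, if_true]
  congr 1
  rw [Finset.sum_comm (f := fun i j => if j < i then f i j else 0)]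
  rw [orderedPairs, Finset.sum_filter, ← Finset.univ_product_univ, Finset.sum_product,
    ← Finset.sum_add_distrib]
  refine Finset.sum_congr rfl fun i _ => ?_
  rw [← Finset.sum_add_distrib]
  refine Finset.sum_congr rfl fun j _ => ?_
  split_ifs
  · rw [hf j i, two_nsmul]
  · simp

lemma tracePow_two_eq : tracePow n 2 = diagIncl n (sumSq n) +
    ∑ p ∈ orderedPairs n, C 2 * (X (p.1, p.2) * X (p.2, p.1)) := by
  rw [tracePow_two, sum_sum_eq_diag_add_orderedPairs _ fun i j => mul_comm _ _]
  congr 1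
  · simp [sumSq, psum, diagIncl, pow_two]
  · refine Finset.sum_congr rfl fun p _ => ?_
    rw [two_nsmul, ← two_mul, mvPolynomial_C_two]

lemma pderiv_tracePow_two (kl : Fin n × Fin n) :
    pderiv kl (tracePow n 2) = C 2 * X kl.swap := by
  obtain ⟨k, l⟩ := kl
  have h : ∀ i j, pderiv (k, l) (X (i, j) * X (j, i) : EntryPoly n) =
      (if j = k then if i = l then X (i, j) else 0 else 0) +
        (if i = k then if j = l then X (j, i) else 0 else 0) := by
    intro i j
    rw [Derivation.leibniz, pderiv_X, pderiv_X, Pi.single_apply, Pi.single_apply]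
    simp only [Prod.mk.injEq, smul_eq_mul, mul_ite, mul_one, mul_zero]
    congr 1
    · by_cases h1 : j = k <;> by_cases h2 : i = l <;> simp [h1, h2]
    · by_cases h1 : i = k <;> by_cases h2 : j = l <;> simp [h1, h2]
  rw [tracePow_two]
  simp only [map_sum, h, Finset.sum_add_distrib]
  rw [Finset.sum_comm]
  simp [two_mul, mvPolynomial_C_two]

/-- Here `τ` is the transposition of indices, as the gradient of `tr A²` is twice the transpose of
`A`. It disappears after taking traces, by `rename_swap_tracePow`. -/
lemma iteratedCommutator_genericMat_pow (m : ℕ) (i j : Fin n) :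
    IteratedCommutator (tracePow n 2) Prod.swap m ((genericMat n ^ m) i j) := by
  induction m generalizing i j with
  | zero =>
    rw [pow_zero, Matrix.one_apply]
    split_ifs
    · simpa using IteratedCommutator.C (tracePow n 2) Prod.swap 1
    · simpa using IteratedCommutator.C (tracePow n 2) Prod.swap 0
  | succ m ih =>
    rw [pow_succ', Matrix.mul_apply]
    exact IteratedCommutator.sum _ fun k _ =>
      IteratedCommutator.X_mul pderiv_tracePow_two (ih k j) _

lemma rename_swap_tracePow (m : ℕ) : rename Prod.swap (tracePow n m) = tracePow n m := by
  have h : (genericMat n).map (rename Prod.swap : EntryPoly n →ₐ[ℂ] EntryPoly n) =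
      (genericMat n).transpose := by
    ext1 i j; simp [genericMat]
  have h2 : rename Prod.swap (tracePow n m) =
      (((genericMat n) ^ m).map (rename Prod.swap : EntryPoly n →ₐ[ℂ] EntryPoly n)).trace := by
    simp [tracePow, Matrix.trace, map_sum]
  have h3 := Matrix.map_pow (genericMat n)
    ((rename Prod.swap : EntryPoly n →ₐ[ℂ] EntryPoly n) : EntryPoly n →+* EntryPoly n) m
  have h4 : (((genericMat n) ^ m).map (rename Prod.swap : EntryPoly n →ₐ[ℂ] EntryPoly n)) =
      ((genericMat n).map (rename Prod.swap : EntryPoly n →ₐ[ℂ] EntryPoly n)) ^ m := h3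
  rw [h2, h4, h, ← Matrix.transpose_pow, Matrix.trace_transpose, tracePow]

lemma iteratedCommutator_tracePow (m : ℕ) :
    (commWith (mulEnd (tracePow n 2)))^[m] (diffOp (tracePow n m)) =
      mulEnd (C ((2 : ℂ) ^ m * (m ! : ℂ)) * tracePow n m) := by
  have h : IteratedCommutator (tracePow n 2) Prod.swap m (tracePow n m) :=
    IteratedCommutator.sum Finset.univ fun i _ => iteratedCommutator_genericMat_pow m i i
  rw [IteratedCommutator, rename_swap_tracePow] at h
  exact h

lemma iteratedCommutator_psum (m : ℕ) :
    (commWith (mulEnd (sumSq n)))^[m] (diffOp (psum (Fin n) ℂ m)) =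
      mulEnd (C ((2 : ℂ) ^ m * (m ! : ℂ)) * psum (Fin n) ℂ m) := by
  have h0 : ∀ i, pderiv i (sumSq n) = C 2 * X (id i) := by
    intro i
    simp [sumSq, psum, Derivation.leibniz_pow, pderiv_X, Pi.single_apply, mvPolynomial_C_two]
  have h1 : ∀ i, IteratedCommutator (sumSq n) id m (X i ^ m) := by
    intro i
    induction m with
    | zero => simpa using IteratedCommutator.C (sumSq n) id 1
    | succ m ih => rw [pow_succ']; exact IteratedCommutator.X_mul h0 ih i
  have h : IteratedCommutator (sumSq n) id m (psum (Fin n) ℂ m) :=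
    IteratedCommutator.sum Finset.univ fun i _ => h1 i
  rw [IteratedCommutator, rename_id_apply] at h
  exact h

/-- `A` on entry polynomials and `A₀` on diagonal polynomials correspond to each other under all
conjugation invariant functionals. -/
def Intertwines (A : Module.End ℂ (EntryPoly n)) (A₀ : Module.End ℂ (MvPolynomial (Fin n) ℂ)) :
    Prop :=
  ∀ Φ : EntryPoly n →ₗ[ℂ] ℂ, ConjInvariant Φ → ConjInvariant (Φ ∘ₗ A) ∧
    ∀ q, Φ (A (diagIncl n (diffOp (vdm n) q))) = Φ (diagIncl n (diffOp (vdm n) (A₀ q)))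

lemma Intertwines.mul {A B : Module.End ℂ (EntryPoly n)}
    {A₀ B₀ : Module.End ℂ (MvPolynomial (Fin n) ℂ)} (hA : Intertwines A A₀)
    (hB : Intertwines B B₀) : Intertwines (A * B) (A₀ * B₀) := by
  intro Φ hΦ
  obtain ⟨h1, h2⟩ := hA Φ hΦ
  obtain ⟨h3, h4⟩ := hB _ h1
  refine ⟨h3, fun q => ?_⟩
  have := h4 q
  simp only [LinearMap.comp_apply] at this
  rw [Module.End.mul_apply, this, h2, Module.End.mul_apply]

lemma Intertwines.sub {A B : Module.End ℂ (EntryPoly n)}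
    {A₀ B₀ : Module.End ℂ (MvPolynomial (Fin n) ℂ)} (hA : Intertwines A A₀)
    (hB : Intertwines B B₀) : Intertwines (A - B) (A₀ - B₀) := by
  intro Φ hΦ
  obtain ⟨h1, h2⟩ := hA Φ hΦ
  obtain ⟨h3, h4⟩ := hB Φ hΦ
  refine ⟨fun i j f => ?_, fun q => ?_⟩
  · have e1 := h1 i j f
    have e2 := h3 i j f
    simp only [LinearMap.comp_apply] at e1 e2
    simp [e1, e2]
  · simp [h2, h4]

lemma Intertwines.commWith_iterate {A Q : Module.End ℂ (EntryPoly n)}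
    {A₀ Q₀ : Module.End ℂ (MvPolynomial (Fin n) ℂ)} (hQ : Intertwines Q Q₀)
    (hA : Intertwines A A₀) (m : ℕ) :
    Intertwines ((commWith Q)^[m] A) ((commWith Q₀)^[m] A₀) := by
  induction m with
  | zero => exact hA
  | succ m ih =>
    rw [Function.iterate_succ_apply', Function.iterate_succ_apply']
    exact (ih.mul hQ).sub (hQ.mul ih)

/-- Off-diagonal terms of `tr A²` are removed by `ConjInvariant.offDiag` with `r` equal to `vdmErase
p` at `∂`, applied to `q`: since `Δ = (X p.2 - X p.1) * vdmErase p`, the function `Δ(∂) q` is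
exactly the required difference of derivatives of `r`. The result is the first-order term in
`diffOp_vdm_sumSq_mul`. -/
lemma intertwines_tracePow_two : Intertwines (mulEnd (tracePow n 2)) (mulEnd (sumSq n)) := by
  intro Φ hΦ
  refine ⟨hΦ.comp_mulEnd fun i j => adDeriv_tracePow i j 2, fun q => ?_⟩
  simp only [LinearMap.mulLeft_apply]
  rw [diffOp_vdm_sumSq_mul, tracePow_two_eq, add_mul, map_add, map_add, map_add, map_mul (diagIncl n) (sumSq n)]
  congr 1
  rw [Finset.sum_mul, map_sum, map_sum, map_sum]
  refine Finset.sum_congr rfl fun p hp => ?_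
  have hne : p.2 ≠ p.1 := ((Finset.mem_filter.mp hp).2).ne'
  have hC : diagIncl n (C 2) = C 2 := by simp [diagIncl]
  have hd : diffOp (vdm n) q =
      pderiv p.2 (diffOp (vdmErase p) q) - pderiv p.1 (diffOp (vdmErase p) q) := by
    rw [vdm_eq_mul_erase hp, sub_mul, map_sub, map_mul, map_mul, diffOp_X, diffOp_X]
    rfl
  rw [map_mul (diagIncl n) (C 2), hC, ← MvPolynomial.smul_eq_C_mul, ← MvPolynomial.smul_eq_C_mul, map_smul,
    ← hΦ.offDiag hne, smul_mul_assoc, map_smul, hd, mul_comm (X (p.1, p.2))]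

lemma diagRestrict_tracePow (m : ℕ) : diagRestrict n (tracePow n m) = psum (Fin n) ℂ m := by
  have h : (genericMat n).map (diagRestrict n) = Matrix.diagonal X := by
    ext1 i j
    simp only [Matrix.map_apply, genericMat, Matrix.of_apply, diagRestrict, aeval_X,
      Matrix.diagonal_apply]
  have h3 : (((genericMat n) ^ m).map (diagRestrict n)) = ((genericMat n).map (diagRestrict n)) ^ m :=
    Matrix.map_pow (genericMat n)
      (diagRestrict n : EntryPoly n →+* MvPolynomial (Fin n) ℂ) m
  have h2 : diagRestrict n (tracePow n m) = (((genericMat n) ^ m).map (diagRestrict n)).trace := by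
    simp [tracePow, Matrix.trace, map_sum]
  rw [h2, h3, h, Matrix.diagonal_pow, Matrix.trace_diagonal, psum]
  rfl

lemma intertwines_diffOp_tracePow (m : ℕ) :
    Intertwines (diffOp (tracePow n m)) (diffOp (psum (Fin n) ℂ m)) := by
  intro Φ hΦ
  refine ⟨hΦ.comp_diffOp fun i j => adDeriv_tracePow i j m, fun q => ?_⟩
  rw [diffOp_diagIncl, diagRestrict_tracePow, ← diffOp_mul_apply, ← diffOp_mul_apply, mul_comm]

/-- Harish-Chandra's radial part theorem, in dual form: multiplication by `tr Aᵐ` corresponds to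
multiplication by the power sum `pₘ`. -/
lemma ConjInvariant.tracePow_mul {Φ : EntryPoly n →ₗ[ℂ] ℂ} (hΦ : ConjInvariant Φ) (m : ℕ)
    (q : MvPolynomial (Fin n) ℂ) :
    Φ (tracePow n m * diagIncl n (diffOp (vdm n) q)) =
      Φ (diagIncl n (diffOp (vdm n) (psum (Fin n) ℂ m * q))) := by
  -- Commutators of intertwined operators are intertwined, and the `m`-fold commutators on the
  -- matrix and diagonal sides carry the same nonzero factor `2^m m!`.
  have h := (intertwines_tracePow_two.commWith_iterate
    (intertwines_diffOp_tracePow (n := n) m) m Φ hΦ).2 q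
  rw [iteratedCommutator_tracePow, iteratedCommutator_psum] at h
  have hC : ∀ a : ℂ, diagIncl n (C a) = C a := by simp [diagIncl]
  have hne : ((2 : ℂ) ^ m * (m ! : ℂ)) ≠ 0 :=
    mul_ne_zero (pow_ne_zero _ two_ne_zero) (Nat.cast_ne_zero.mpr (Nat.factorial_ne_zero m))
  simp only [LinearMap.mulLeft_apply, mul_assoc, ← MvPolynomial.smul_eq_C_mul, map_smul,
    smul_eq_mul, smul_mul_assoc] at h
  exact mul_left_cancel₀ hne (by simpa [mul_assoc] using h)

end Intertwining

/-! ### Alternating functionals supported on one orbit, and the derivative principle. -/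

section OrbitSum

open MvPolynomial

variable {n : ℕ}

/-- The polynomials acting as their value at `x` on the functional `ψ`. -/
noncomputable def scalarActing (ψ : MvPolynomial (Fin n) ℂ →ₗ[ℂ] ℂ) (x : Fin n → ℂ) :
    Subalgebra ℂ (MvPolynomial (Fin n) ℂ) where
  carrier := {p | ∀ q, ψ (p * q) = eval x p * ψ q}
  mul_mem' {a b} ha hb q := by rw [mul_assoc, ha, hb, map_mul, mul_assoc]
  add_mem' {a b} ha hb q := by rw [add_mul, map_add, ha, hb, map_add, add_mul]
  algebraMap_mem' c q := by
    rw [MvPolynomial.algebraMap_eq, ← MvPolynomial.smul_eq_C_mul, map_smul, eval_C, smul_eq_mul]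

lemma mem_scalarActing {ψ : MvPolynomial (Fin n) ℂ →ₗ[ℂ] ℂ} {x : Fin n → ℂ}
    {p : MvPolynomial (Fin n) ℂ} :
    p ∈ scalarActing ψ x ↔ ∀ q, ψ (p * q) = eval x p * ψ q := Iff.rfl

/-- Newton's identities express elementary symmetric polynomials through power sums in
characteristic zero. -/
lemma esymm_mem_scalarActing {ψ : MvPolynomial (Fin n) ℂ →ₗ[ℂ] ℂ} {x : Fin n → ℂ}
    (h : ∀ m, psum (Fin n) ℂ m ∈ scalarActing ψ x) (k : ℕ) :
    esymm (Fin n) ℂ k ∈ scalarActing ψ x := by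
  induction k using Nat.strong_induction_on with
  | _ k ih =>
    rcases Nat.eq_zero_or_pos k with rfl | hk
    · rw [esymm_zero]; exact one_mem _
    · have hk' : (k : ℂ) ≠ 0 := Nat.cast_ne_zero.mpr hk.ne'
      have h1 := mul_esymm_eq_sum (Fin n) ℂ k
      have h2 : esymm (Fin n) ℂ k = C ((k : ℂ)⁻¹) * ((-1) ^ (k + 1) *
          ∑ a ∈ Finset.HasAntidiagonal.antidiagonal k with a.1 < k,
            (-1) ^ a.1 * esymm (Fin n) ℂ a.1 * psum (Fin n) ℂ a.2) := by
        rw [← h1, ← mul_assoc, ← map_natCast C, ← map_mul, inv_mul_cancel₀ hk', map_one, one_mul]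
      rw [h2]
      have hneg : (-1 : MvPolynomial (Fin n) ℂ) ∈ scalarActing ψ x := neg_mem (one_mem _)
      refine mul_mem (Subalgebra.algebraMap_mem _ _) (mul_mem (pow_mem hneg _) (sum_mem ?_))
      intro a ha
      exact mul_mem (mul_mem (pow_mem hneg _) (ih _ (Finset.mem_filter.mp ha).2)) (h _)

/-- By Vieta, `X i` is a root of the polynomial whose coefficients are the signed elementary
symmetric polynomials in the variables. Under `ψ` these coefficients may be replaced by their values
at `x`. -/
lemma map_nodal_mul_eq_zero {ψ : MvPolynomial (Fin n) ℂ →ₗ[ℂ] ℂ} {x : Fin n → ℂ}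
    (h : ∀ m, psum (Fin n) ℂ m ∈ scalarActing ψ x) (i : Fin n) (q : MvPolynomial (Fin n) ℂ) :
    ψ ((∏ j, (C (x j) - X i)) * q) = 0 := by
  have hV := MvPolynomial.prod_C_add_X_eq_sum_esymm ℂ (Fin n)
  have h1 := congrArg (Polynomial.eval (-X i : MvPolynomial (Fin n) ℂ)) hV
  have h2 := congrArg (Polynomial.eval₂ ((C : ℂ →+* MvPolynomial (Fin n) ℂ).comp (eval x))
    (-X i : MvPolynomial (Fin n) ℂ)) hV
  simp only [Polynomial.eval_prod, Polynomial.eval_add, Polynomial.eval_X, Polynomial.eval_C,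
    Polynomial.eval_finsetSum, Polynomial.eval_mul, Polynomial.eval_pow] at h1
  simp only [Polynomial.eval₂_finsetProd, Polynomial.eval₂_add, Polynomial.eval₂_X,
    Polynomial.eval₂_C, Polynomial.eval₂_finsetSum, Polynomial.eval₂_mul, Polynomial.eval₂_pow,
    RingHom.comp_apply, eval_X] at h2
  rw [Finset.prod_eq_zero (Finset.mem_univ i) (neg_add_cancel _)] at h1
  have h3 : ∏ j, (C (x j) - X i : MvPolynomial (Fin n) ℂ) = ∏ j, (-X i + C (x j)) :=
    Finset.prod_congr rfl fun j _ => by ring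
  rw [h3, h2, Finset.sum_mul, map_sum]
  calc _ = ∑ k ∈ Finset.range (Fintype.card (Fin n) + 1),
        ψ ((esymm (Fin n) ℂ k * (-X i) ^ (Fintype.card (Fin n) - k)) * q) := by
        refine Finset.sum_congr rfl fun k _ => ?_
        rw [mul_assoc, mul_assoc, mem_scalarActing.mp (esymm_mem_scalarActing h k),
          ← MvPolynomial.smul_eq_C_mul, map_smul, smul_eq_mul]
    _ = 0 := by rw [← map_sum, ← Finset.sum_mul, ← h1, zero_mul, map_zero]

/-- The product of Lagrange basis polynomials that is the indicator of `x ∘ f` on the grid. -/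
noncomputable def gridBasis (x : Fin n → ℂ) (f : Fin n → Fin n) : MvPolynomial (Fin n) ℂ :=
  ∏ i, Polynomial.aeval (X i : MvPolynomial (Fin n) ℂ) (Lagrange.basis Finset.univ x (f i))

/-- The largest ideal on which `ψ` vanishes. -/
def kernelIdeal (ψ : MvPolynomial (Fin n) ℂ →ₗ[ℂ] ℂ) : Ideal (MvPolynomial (Fin n) ℂ) where
  carrier := {p | ∀ q, ψ (p * q) = 0}
  add_mem' {a b} ha hb q := by rw [add_mul, map_add, ha, hb, add_zero]
  zero_mem' q := by rw [zero_mul, map_zero]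
  smul_mem' c p hp q := by rw [smul_eq_mul, mul_comm c p, mul_assoc, hp]

lemma mem_kernelIdeal {ψ : MvPolynomial (Fin n) ℂ →ₗ[ℂ] ℂ} {p : MvPolynomial (Fin n) ℂ} :
    p ∈ kernelIdeal ψ ↔ ∀ q, ψ (p * q) = 0 := Iff.rfl

lemma nodal_dvd_sub_interpolate {x : Fin n → ℂ} (hx : Function.Injective x) (g : Polynomial ℂ) :
    Lagrange.nodal Finset.univ x ∣
      g - Lagrange.interpolate Finset.univ x (fun j => g.eval (x j)) := by
  rw [Lagrange.nodal_eq]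
  refine Finset.prod_dvd_of_coprime
    (fun a _ b _ hab => Polynomial.pairwise_coprime_X_sub_C hx hab) fun j _ => ?_
  rw [Polynomial.dvd_iff_isRoot, Polynomial.IsRoot, Polynomial.eval_sub,
    Lagrange.eval_interpolate_at_node _ hx.injOn (Finset.mem_univ j), sub_self]

/-- Modulo `kernelIdeal ψ` every variable satisfies `∏ (t - x j) = 0`, so a polynomial in one
variable reduces to its Lagrange interpolant at the `x j`. Multiplying over the variables gives
interpolation on the grid of points `x ∘ f`. -/
lemma sub_gridInterpolate_mem {ψ : MvPolynomial (Fin n) ℂ →ₗ[ℂ] ℂ} {x : Fin n → ℂ}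
    (hx : Function.Injective x)
    (h : ∀ m, psum (Fin n) ℂ m ∈ scalarActing ψ x) (q : MvPolynomial (Fin n) ℂ) :
    q - ∑ f : Fin n → Fin n, C (eval (x ∘ f) q) * gridBasis x f ∈ kernelIdeal ψ := by
  rw [← Ideal.Quotient.mk_eq_mk_iff_sub_mem]
  set mk := Ideal.Quotient.mk (kernelIdeal ψ) with hmk
  have huni : ∀ (i : Fin n) (g : Polynomial ℂ),
      mk (Polynomial.aeval (X i : MvPolynomial (Fin n) ℂ) g) = ∑ j, mk (C (g.eval (x j))) *
        mk (Polynomial.aeval (X i : MvPolynomial (Fin n) ℂ) (Lagrange.basis Finset.univ x j)) := by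
    intro i g
    have h1 : Polynomial.aeval (X i : MvPolynomial (Fin n) ℂ) g -
        Polynomial.aeval (X i : MvPolynomial (Fin n) ℂ)
          (Lagrange.interpolate Finset.univ x (fun j => g.eval (x j))) ∈ kernelIdeal ψ := by
      rw [← map_sub]
      obtain ⟨r, hr⟩ := nodal_dvd_sub_interpolate hx g
      rw [hr, map_mul]
      refine Ideal.mul_mem_right _ _ ?_
      have h2 : Polynomial.aeval (X i : MvPolynomial (Fin n) ℂ) (Lagrange.nodal Finset.univ x) =
          (-1) ^ n * ∏ j, (C (x j) - X i) := by
        rw [Lagrange.nodal_eq, map_prod]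
        have : ((-1) ^ n : MvPolynomial (Fin n) ℂ) = ∏ _j : Fin n, (-1) := by simp
        rw [this, ← Finset.prod_mul_distrib]
        refine Finset.prod_congr rfl fun j _ => ?_
        simp [MvPolynomial.algebraMap_eq]
      rw [h2]
      exact Ideal.mul_mem_left _ _ (map_nodal_mul_eq_zero h i)
    rw [← Ideal.Quotient.mk_eq_mk_iff_sub_mem] at h1
    rw [hmk, h1, Lagrange.interpolate_apply, map_sum, map_sum]
    refine Finset.sum_congr rfl fun j _ => ?_
    rw [map_mul, map_mul, Polynomial.aeval_C, MvPolynomial.algebraMap_eq]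
  induction q using MvPolynomial.induction_on' with
  | add p q hp hq =>
    rw [map_add, hp, hq, ← map_add, ← Finset.sum_add_distrib]
    congr 1
    refine Finset.sum_congr rfl fun f _ => ?_
    rw [map_add, map_add, add_mul]
  | monomial α a =>
    have h1 : (monomial α a : MvPolynomial (Fin n) ℂ) =
        C a * ∏ i, Polynomial.aeval (X i : MvPolynomial (Fin n) ℂ) (Polynomial.X ^ α i : Polynomial ℂ) := by
      rw [monomial_eq, Finsupp.prod_fintype _ _ fun i => pow_zero _]
      simp
    have h2 : ∀ f : Fin n → Fin n, eval (x ∘ f) (monomial α a) =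
        a * ∏ i, (Polynomial.X ^ α i : Polynomial ℂ).eval (x (f i)) := by
      intro f
      rw [h1]
      simp [map_prod]
    have h3 := Finset.prod_congr (rfl : (Finset.univ : Finset (Fin n)) = Finset.univ)
      fun i _ => huni i (Polynomial.X ^ α i)
    rw [h1, map_mul, map_prod, h3, Finset.prod_univ_sum,
      Fintype.piFinset_univ, Finset.mul_sum, ← h1, map_sum]
    refine Finset.sum_congr rfl fun f _ => ?_
    rw [h2 f, gridBasis, map_mul, map_mul, map_mul, map_prod, map_prod, map_prod,
      Finset.prod_mul_distrib, mul_assoc]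

lemma rename_gridBasis (x : Fin n → ℂ) (f : Fin n → Fin n) (σ : Equiv.Perm (Fin n)) :
    rename σ (gridBasis x f) = gridBasis x (f ∘ σ.symm) := by
  rw [gridBasis, gridBasis, map_prod]
  refine Fintype.prod_equiv σ _ _ fun i => ?_
  rw [← Polynomial.aeval_algHom_apply, rename_X, Function.comp_apply, Equiv.symm_apply_apply]

/-- An alternating functional on which symmetric polynomials act through evaluation at `x` is
a multiple of the alternating sum over the orbit of `x`. -/
lemma exists_eq_orbitSum {ψ : MvPolynomial (Fin n) ℂ →ₗ[ℂ] ℂ} {x : Fin n → ℂ}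
    (hx : Function.Injective x) (h : ∀ m q, ψ (psum (Fin n) ℂ m * q) = (∑ i, x i ^ m) * ψ q)
    (hanti : ∀ (σ : Equiv.Perm (Fin n)) q, ψ (rename σ q) = (Equiv.Perm.sign σ : ℤ) * ψ q) :
    ∃ c : ℂ, ∀ q, ψ q = c * ∑ σ : Equiv.Perm (Fin n),
      ((Equiv.Perm.sign σ : ℤ) : ℂ) * eval (x ∘ σ) q := by
  have h' : ∀ m, psum (Fin n) ℂ m ∈ scalarActing ψ x := by
    intro m q
    rw [h, psum]
    simp
  refine ⟨ψ (gridBasis x id), fun q => ?_⟩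
  have h1 := mem_kernelIdeal.mp (sub_gridInterpolate_mem hx h' q) 1
  rw [mul_one, map_sub, sub_eq_zero, map_sum] at h1
  rw [h1, Finset.mul_sum]
  symm
  refine Fintype.sum_of_injective (fun σ : Equiv.Perm (Fin n) => (σ : Fin n → Fin n))
    DFunLike.coe_injective _ _ ?_ ?_
  -- A grid point with a repeated coordinate is fixed by a transposition, so the alternating `ψ`
  -- vanishes on its basis polynomial.
  · intro f hf
    have hninj : ¬ Function.Injective f := by
      intro hinj
      exact hf ⟨Equiv.ofBijective f (Finite.injective_iff_bijective.mp hinj), rfl⟩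
    simp only [Function.Injective, not_forall] at hninj
    obtain ⟨i, j, hij, hne⟩ := hninj
    have hs := hanti (Equiv.swap i j) (gridBasis x f)
    have hfs : f ∘ (Equiv.swap i j).symm = f := by
      ext1 k
      rw [Equiv.symm_swap, Function.comp_apply]
      by_cases hki : k = i
      · rw [hki, Equiv.swap_apply_left, hij]
      · by_cases hkj : k = j
        · rw [hkj, Equiv.swap_apply_right, hij]
        · rw [Equiv.swap_apply_of_ne_of_ne hki hkj]
    rw [rename_gridBasis, hfs, Equiv.Perm.sign_swap hne] at hs
    have hz : ψ (gridBasis x f) = 0 := by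
      push_cast at hs
      linear_combination (1 / 2 : ℂ) * hs
    rw [← MvPolynomial.smul_eq_C_mul, map_smul, hz, smul_zero]
  · intro σ
    have hs := hanti σ⁻¹ (gridBasis x id)
    rw [rename_gridBasis] at hs
    have : (id ∘ ⇑(σ⁻¹).symm : Fin n → Fin n) = σ := by ext1 k; rfl
    rw [this, Equiv.Perm.sign_inv] at hs
    rw [← MvPolynomial.smul_eq_C_mul, map_smul, hs, smul_eq_mul]
    ring

lemma diffOp_rename (σ : Equiv.Perm (Fin n)) (p q : MvPolynomial (Fin n) ℂ) :
    diffOp p (rename σ q) = rename σ (diffOp (rename σ.symm p) q) := by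
  induction p using MvPolynomial.induction_on generalizing q with
  | C a => simp
  | add p q hp hq => simp only [map_add, LinearMap.add_apply, hp, hq]
  | mul_X p k hp =>
    have h := pderiv_rename σ.injective (σ.symm k) q
    rw [Equiv.apply_symm_apply] at h
    rw [diffOp_mul_X_apply, h, hp, map_mul, rename_X, diffOp_mul_X_apply]

lemma isHomogeneous_pderiv {ι : Type*} {p : MvPolynomial ι ℂ} {d : ℕ}
    (hp : p.IsHomogeneous (d + 1)) (i : ι) : (pderiv i p).IsHomogeneous d := by
  simpa using hp.pderiv

lemma isHomogeneous_diffOp_prod (s : Finset (Fin n × Fin n)) (d : ℕ) {q : MvPolynomial (Fin n) ℂ}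
    (hq : q.IsHomogeneous (d + s.card)) :
    (diffOp (∏ p ∈ s, (X p.2 - X p.1)) q).IsHomogeneous d := by
  induction s using Finset.induction_on generalizing d with
  | empty => simpa using hq
  | insert a s ha ih =>
    rw [Finset.prod_insert ha, sub_mul, map_sub, map_mul, map_mul, diffOp_X, diffOp_X]
    rw [Finset.card_insert_of_notMem ha, ← add_assoc, add_right_comm] at hq
    have := ih (d + 1) hq
    exact (isHomogeneous_pderiv this _).sub (isHomogeneous_pderiv this _)

lemma isHomogeneous_vdm : (vdm n).IsHomogeneous (orderedPairs n).card := by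
  rw [vdm_eq_prod]
  have := MvPolynomial.IsHomogeneous.prod (orderedPairs n)
    (fun p => (X p.2 - X p.1 : MvPolynomial (Fin n) ℂ)) (fun _ => 1)
    (fun p _ => (isHomogeneous_X _ _).sub (isHomogeneous_X _ _))
  simpa using this

/-- The constant `Δ(∂) Δ`. -/
noncomputable def vdmConst (n : ℕ) : ℂ := coeff 0 (diffOp (vdm n) (vdm n))

lemma diffOp_vdm_vdm : diffOp (vdm n) (vdm n) = C (vdmConst n) := by
  have h : (diffOp (vdm n) (vdm n)).IsHomogeneous 0 := by
    have := isHomogeneous_diffOp_prod (orderedPairs n) 0 (q := vdm n)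
      (by rw [zero_add]; exact isHomogeneous_vdm)
    rwa [← vdm_eq_prod] at this
  exact totalDegree_eq_zero_iff_eq_C.mp ((totalDegree_zero_iff_isHomogeneous _).mpr h)

/-- The derivative principle: the alternating orbit sum of `q` is obtained, up to a constant, by
integrating `Δ(∂) q` over the diagonal of a conjugation invariant functional with spectrum `x`. -/
theorem ConjInvariant.derivative_principle {Φ : EntryPoly n →ₗ[ℂ] ℂ} (hΦ : ConjInvariant Φ)
    {x : Fin n → ℂ} (hx : Function.Injective x)
    (hspec : ∀ m f, Φ (tracePow n m * f) = (∑ i, x i ^ m) * Φ f)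
    (hperm : ∀ (σ : Equiv.Perm (Fin n)) q, Φ (diagIncl n (rename σ q)) = Φ (diagIncl n q))
    (q : MvPolynomial (Fin n) ℂ) :
    n ! * (Matrix.vandermonde x).det * Φ (diagIncl n (diffOp (vdm n) q)) =
      vdmConst n * Φ 1 * ∑ σ : Equiv.Perm (Fin n),
        ((Equiv.Perm.sign σ : ℤ) : ℂ) * eval (x ∘ σ) q := by
  set ψ : MvPolynomial (Fin n) ℂ →ₗ[ℂ] ℂ :=
    Φ ∘ₗ (diagIncl n).toLinearMap ∘ₗ diffOp (vdm n) with hψ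
  have hψa : ∀ q, ψ q = Φ (diagIncl n (diffOp (vdm n) q)) := fun q => rfl
  obtain ⟨c, hc⟩ := exists_eq_orbitSum (ψ := ψ) hx
    (fun m q => by rw [hψa, ← hΦ.tracePow_mul, hspec, hψa])
    (fun σ q => by
      rw [hψa, hψa, diffOp_rename, hperm, rename_vdm, map_zsmul, LinearMap.smul_apply, map_zsmul,
        map_zsmul, Equiv.Perm.sign_symm, zsmul_eq_mul])
  -- The unknown multiple is identified by testing on `Δ`, where `Δ(∂)Δ` is constant and all `n!`
  -- terms of the orbit sum coincide.
  have h1 := hc (vdm n)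
  have h2 : ∑ σ : Equiv.Perm (Fin n), ((Equiv.Perm.sign σ : ℤ) : ℂ) * eval (x ∘ σ) (vdm n) =
      n ! * (Matrix.vandermonde x).det := by
    have : ∀ σ : Equiv.Perm (Fin n), ((Equiv.Perm.sign σ : ℤ) : ℂ) * eval (x ∘ σ) (vdm n) =
        (Matrix.vandermonde x).det := by
      intro σ
      rw [← eval_rename, rename_vdm, map_zsmul, eval_vdm, zsmul_eq_mul, ← mul_assoc,
        ← Int.cast_mul, ← Units.val_mul, Int.units_mul_self]
      simp
    rw [Finset.sum_congr rfl fun σ _ => this σ, Finset.sum_const, Finset.card_univ,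
      Fintype.card_perm, Fintype.card_fin, nsmul_eq_mul]
  rw [h2, hψa, diffOp_vdm_vdm] at h1
  have h3 : Φ (diagIncl n (C (vdmConst n))) = vdmConst n * Φ 1 := by
    have : diagIncl n (C (vdmConst n)) = vdmConst n • (1 : EntryPoly n) := by
      rw [MvPolynomial.smul_eq_C_mul, mul_one]; simp [diagIncl]
    rw [this, map_smul, smul_eq_mul]
  rw [h3] at h1
  rw [← hψa, hc q, h1]
  ring

end OrbitSum

/-! ### Haar averages over unitary orbits. -/

section UnitaryGroup

/-- The unitary group `U(n)` as a topological group. -/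
abbrev UGroup (n : ℕ) : Type := Matrix.unitaryGroup (Fin n) ℂ

variable {n : ℕ}

instance secondCountableTopology_matrix :
    SecondCountableTopology (Matrix (Fin n) (Fin n) ℂ) :=
  inferInstanceAs (SecondCountableTopology (Fin n → Fin n → ℂ))

instance secondCountableTopology_unitary : SecondCountableTopology (UGroup n) :=
  inferInstanceAs (SecondCountableTopology
    ((Matrix.unitaryGroup (Fin n) ℂ : Set (Matrix (Fin n) (Fin n) ℂ))))

noncomputable instance measurableSpaceUnitary : MeasurableSpace (UGroup n) := borel _

instance borelSpaceUnitary : BorelSpace (UGroup n) := ⟨rfl⟩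

instance compactSpaceUnitary : CompactSpace (UGroup n) := by
  refine isCompact_iff_compactSpace.mp ?_
  have hK : IsCompact (Set.univ.pi fun _ : Fin n => Set.univ.pi fun _ : Fin n =>
      Metric.closedBall (0 : ℂ) 1) :=
    isCompact_univ_pi fun _ => isCompact_univ_pi fun _ => isCompact_closedBall _ _
  refine hK.of_isClosed_subset (isClosed_unitary (R := Matrix (Fin n) (Fin n) ℂ)) ?_
  intro U hU i _ j _
  rw [mem_closedBall_zero_iff]
  exact entry_norm_bound_of_unitary hU i j

/-- The Haar probability measure of the unitary group. -/
noncomputable def haarU (n : ℕ) : Measure (UGroup n) := Measure.haarMeasure ⊤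

instance isProbabilityMeasure_haarU : IsProbabilityMeasure (haarU n) :=
  ⟨by
    have := Measure.haarMeasure_self (K₀ := (⊤ : TopologicalSpace.PositiveCompacts (UGroup n)))
    rwa [TopologicalSpace.PositiveCompacts.coe_top] at this⟩

instance isMulLeftInvariant_haarU : (haarU n).IsMulLeftInvariant := by
  unfold haarU; infer_instance

lemma integrable_haarU_of_continuous {E : Type*} [NormedAddCommGroup E] [SecondCountableTopology E]
    {f : UGroup n → E} (hf : Continuous f) : Integrable f (haarU n) := by
  obtain ⟨C, hC⟩ := isCompact_univ.exists_bound_of_continuousOn hf.continuousOn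
  let _ : MeasurableSpace E := borel E
  have _ : BorelSpace E := ⟨rfl⟩
  exact Integrable.of_bound hf.measurable.aestronglyMeasurable C
    (Filter.Eventually.of_forall fun U => hC U (Set.mem_univ U))

/-- The conjugate `U B U*` of a matrix by a unitary matrix. -/
noncomputable def orbitPoint (B : Matrix (Fin n) (Fin n) ℂ) (U : UGroup n) :
    Matrix (Fin n) (Fin n) ℂ := U.1 * B * star U.1

lemma continuous_orbitPoint (B : Matrix (Fin n) (Fin n) ℂ) : Continuous (orbitPoint B) := by
  unfold orbitPoint
  fun_prop

lemma orbitPoint_mul (B : Matrix (Fin n) (Fin n) ℂ) (V U : UGroup n) :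
    orbitPoint B (V * U) = V.1 * orbitPoint B U * star V.1 := by
  simp only [orbitPoint, Submonoid.coe_mul, star_mul, mul_assoc]

/-- The entries of a matrix, indexed by pairs. -/
def entries (M : Matrix (Fin n) (Fin n) ℂ) : Fin n × Fin n → ℂ := fun kl => M kl.1 kl.2

lemma continuous_entries : Continuous (entries (n := n)) := by
  unfold entries
  exact continuous_pi fun kl => (continuous_apply kl.2).comp (continuous_apply kl.1)

lemma continuous_eval_entries (f : EntryPoly n) :
    Continuous fun M : Matrix (Fin n) (Fin n) ℂ => MvPolynomial.eval (entries M) f :=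
  (MvPolynomial.continuous_eval f).comp continuous_entries

/-- The functional averaging an entry polynomial over the unitary orbit of `B`. -/
noncomputable def orbitFunctional (B : Matrix (Fin n) (Fin n) ℂ) : EntryPoly n →ₗ[ℂ] ℂ where
  toFun f := ∫ U, MvPolynomial.eval (entries (orbitPoint B U)) f ∂haarU n
  map_add' f g := by
    simp only [map_add]
    exact integral_add
      (integrable_haarU_of_continuous ((continuous_eval_entries f).comp (continuous_orbitPoint B)))
      (integrable_haarU_of_continuous ((continuous_eval_entries g).comp (continuous_orbitPoint B)))
  map_smul' c f := by
    simp only [MvPolynomial.smul_eval, RingHom.id_apply, smul_eq_mul]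
    exact integral_const_mul _ _

lemma orbitFunctional_apply (B : Matrix (Fin n) (Fin n) ℂ) (f : EntryPoly n) :
    orbitFunctional B f = ∫ U, MvPolynomial.eval (entries (orbitPoint B U)) f ∂haarU n := rfl

lemma eval_derivation {ι : Type*} [Fintype ι]
    (D : Derivation ℂ (MvPolynomial ι ℂ) (MvPolynomial ι ℂ)) (a : ι → ℂ) (f : MvPolynomial ι ℂ) :
    MvPolynomial.eval a (D f) = ∑ x, MvPolynomial.eval a (D (MvPolynomial.X x)) *
      MvPolynomial.eval a (MvPolynomial.pderiv x f) := by
  classical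
  induction f using MvPolynomial.induction_on with
  | C c => simp
  | add p q hp hq => simp only [map_add, hp, hq, mul_add, Finset.sum_add_distrib]
  | mul_X p i hp =>
    simp only [Derivation.leibniz, smul_eq_mul, map_add, map_mul, hp, MvPolynomial.pderiv_X,
      Pi.single_apply, MvPolynomial.eval_X, mul_add, Finset.sum_add_distrib, Finset.mul_sum]
    congr 1
    · rw [Finset.sum_eq_single i]
      · simp; ring
      · intro b _ hb; simp [Ne.symm hb]
      · simp
    · exact Finset.sum_congr rfl fun x _ => by ring

lemma hasDerivAt_eval {ι : Type*} [Fintype ι] {c : ℝ → ι → ℂ} {c' : ι → ℂ} {t : ℝ}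
    (h : ∀ x, HasDerivAt (fun s => c s x) (c' x) t) (f : MvPolynomial ι ℂ) :
    HasDerivAt (fun s => MvPolynomial.eval (c s) f)
      (∑ x, c' x * MvPolynomial.eval (c t) (MvPolynomial.pderiv x f)) t := by
  classical
  induction f using MvPolynomial.induction_on with
  | C a => simpa using hasDerivAt_const t a
  | add p q hp hq =>
    simp only [map_add, mul_add, Finset.sum_add_distrib]
    exact hp.add hq
  | mul_X p i hp =>
    have := hp.mul (h i)
    simp only [map_mul, MvPolynomial.eval_X]
    refine this.congr_deriv ?_
    simp only [Derivation.leibniz, smul_eq_mul, map_add, map_mul, MvPolynomial.pderiv_X,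
      Pi.single_apply, MvPolynomial.eval_X, mul_add, Finset.sum_add_distrib, Finset.sum_mul]
    rw [add_comm]
    congr 1
    · rw [Finset.sum_eq_single i]
      · simp; ring
      · intro b _ hb; simp [Ne.symm hb]
      · simp
    · exact Finset.sum_congr rfl fun x _ => by ring

/-- The derivative of the entry polynomial `f` at the matrix `A` in the direction `K A - A K`. -/
noncomputable def commDeriv (f : EntryPoly n) (K A : Matrix (Fin n) (Fin n) ℂ) : ℂ :=
  ∑ x, entries (K * A - A * K) x * MvPolynomial.eval (entries A) (MvPolynomial.pderiv x f)

lemma continuous_commDeriv (f : EntryPoly n) (K : Matrix (Fin n) (Fin n) ℂ) :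
    Continuous (commDeriv f K) := by
  unfold commDeriv
  refine continuous_finsetSum _ fun x _ => Continuous.mul ?_ (continuous_eval_entries _)
  have : Continuous fun A : Matrix (Fin n) (Fin n) ℂ => K * A - A * K := by fun_prop
  exact (continuous_apply x).comp (continuous_entries.comp this)

lemma commDeriv_add (f : EntryPoly n) (K L A : Matrix (Fin n) (Fin n) ℂ) :
    commDeriv f (K + L) A = commDeriv f K A + commDeriv f L A := by
  unfold commDeriv
  rw [← Finset.sum_add_distrib]
  refine Finset.sum_congr rfl fun x _ => ?_
  have : (K + L) * A - A * (K + L) = (K * A - A * K) + (L * A - A * L) := by noncomm_ring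
  rw [this, entries, Matrix.add_apply, add_mul]
  rfl

lemma commDeriv_smul (f : EntryPoly n) (c : ℂ) (K A : Matrix (Fin n) (Fin n) ℂ) :
    commDeriv f (c • K) A = c * commDeriv f K A := by
  unfold commDeriv
  rw [Finset.mul_sum]
  refine Finset.sum_congr rfl fun x _ => ?_
  have : (c • K) * A - A * (c • K) = c • (K * A - A * K) := by
    rw [smul_mul_assoc, mul_smul_comm, smul_sub]
  rw [this, entries, Matrix.smul_apply, smul_eq_mul, mul_assoc]
  rfl

lemma eval_adDeriv (f : EntryPoly n) (i j : Fin n) (A : Matrix (Fin n) (Fin n) ℂ) :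
    MvPolynomial.eval (entries A) (adDeriv i j f) = commDeriv f (Matrix.single i j 1) A := by
  rw [eval_derivation, commDeriv]
  refine Finset.sum_congr rfl fun x _ => ?_
  congr 1
  obtain ⟨k, l⟩ := x
  rw [adDeriv_X, map_sub, entries, Matrix.sub_apply]
  congr 1
  · split_ifs with h
    · subst h; simp [entries]
    · rw [map_zero]; exact (Matrix.single_mul_apply_of_ne _ _ _ _ _ h _).symm
  · split_ifs with h
    · subst h; simp [entries]
    · rw [map_zero]; exact (Matrix.mul_single_apply_of_ne _ _ _ _ _ h _).symm

section Norms

-- The norm is auxiliary: differentiating the exponential needs a normed algebra, whereas the facts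
-- restated after this section involve only the topology and the entries.
attribute [local instance] Matrix.linftyOpNormedRing Matrix.linftyOpNormedAlgebra

lemma hasDerivAt_conj_exp_aux (K A : Matrix (Fin n) (Fin n) ℂ) (t : ℝ) :
    HasDerivAt (fun s : ℝ => NormedSpace.exp (s • K) * A * NormedSpace.exp (s • (-K)))
      (K * (NormedSpace.exp (t • K) * A * NormedSpace.exp (t • (-K))) -
        (NormedSpace.exp (t • K) * A * NormedSpace.exp (t • (-K))) * K) t := by
  have h1 := (hasDerivAt_exp_smul_const' (𝕂 := ℝ) K t).mul_const A
  have h2 := h1.mul (hasDerivAt_exp_smul_const (𝕂 := ℝ) (-K) t)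
  refine h2.congr_deriv ?_
  noncomm_ring

lemma hasDerivAt_entries_aux {c : ℝ → Matrix (Fin n) (Fin n) ℂ} {c' : Matrix (Fin n) (Fin n) ℂ}
    {t : ℝ} (h : HasDerivAt c c' t) (x : Fin n × Fin n) :
    HasDerivAt (fun s => entries (c s) x) (entries c' x) t := by
  let l : Matrix (Fin n) (Fin n) ℂ →L[ℝ] ℂ :=
    ⟨{ toFun := fun M => M x.1 x.2, map_add' := fun _ _ => rfl, map_smul' := fun _ _ => rfl },
      (continuous_apply x.2).comp (continuous_apply x.1)⟩
  exact l.hasFDerivAt.comp_hasDerivAt t h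

lemma continuous_exp_smul_aux (K : Matrix (Fin n) (Fin n) ℂ) :
    Continuous fun t : ℝ => NormedSpace.exp (t • K) :=
  continuous_iff_continuousAt.mpr fun t =>
    (hasDerivAt_exp_smul_const (𝕂 := ℝ) K t).continuousAt

end Norms

lemma hasDerivAt_entries_conj_exp (K A : Matrix (Fin n) (Fin n) ℂ) (t : ℝ) (x : Fin n × Fin n) :
    HasDerivAt (fun s : ℝ => entries (NormedSpace.exp (s • K) * A * NormedSpace.exp (s • (-K))) x)
      (entries (K * (NormedSpace.exp (t • K) * A * NormedSpace.exp (t • (-K))) -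
        (NormedSpace.exp (t • K) * A * NormedSpace.exp (t • (-K))) * K) x) t :=
  hasDerivAt_entries_aux (hasDerivAt_conj_exp_aux K A t) x

lemma continuous_exp_smul (K : Matrix (Fin n) (Fin n) ℂ) :
    Continuous fun t : ℝ => NormedSpace.exp (t • K) :=
  continuous_exp_smul_aux K

lemma star_exp_smul {K : Matrix (Fin n) (Fin n) ℂ} (hK : star K = -K) (t : ℝ) :
    star (NormedSpace.exp (t • K)) = NormedSpace.exp (t • (-K)) := by
  rw [Matrix.star_eq_conjTranspose, ← Matrix.exp_conjTranspose, ← Matrix.star_eq_conjTranspose,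
    star_smul, hK, star_trivial]

lemma exp_smul_mem_unitary {K : Matrix (Fin n) (Fin n) ℂ} (hK : star K = -K) (t : ℝ) :
    NormedSpace.exp (t • K) ∈ Matrix.unitaryGroup (Fin n) ℂ := by
  rw [Matrix.mem_unitaryGroup_iff, star_exp_smul hK, smul_neg,
    ← Matrix.exp_add_of_commute (t • K) (-(t • K)) ((Commute.refl (t • K)).neg_right),
    add_neg_cancel, NormedSpace.exp_zero]

/-- The one-parameter group of unitary matrices generated by a skew-Hermitian matrix. -/
noncomputable def expPath {K : Matrix (Fin n) (Fin n) ℂ} (hK : star K = -K) (t : ℝ) : UGroup n :=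
  ⟨NormedSpace.exp (t • K), exp_smul_mem_unitary hK t⟩

lemma continuous_expPath {K : Matrix (Fin n) (Fin n) ℂ} (hK : star K = -K) :
    Continuous (expPath hK) := (continuous_exp_smul K).subtype_mk _

lemma expPath_zero {K : Matrix (Fin n) (Fin n) ℂ} (hK : star K = -K) : expPath hK 0 = 1 := by
  apply Subtype.ext
  simp [expPath]

lemma orbitPoint_expPath_mul (B : Matrix (Fin n) (Fin n) ℂ) {K : Matrix (Fin n) (Fin n) ℂ}
    (hK : star K = -K) (t : ℝ) (U : UGroup n) : orbitPoint B (expPath hK t * U) =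
      NormedSpace.exp (t • K) * orbitPoint B U * NormedSpace.exp (t • (-K)) := by
  rw [orbitPoint_mul, ← star_exp_smul hK, expPath]

lemma hasDerivAt_eval_orbitPoint_expPath (B : Matrix (Fin n) (Fin n) ℂ) (f : EntryPoly n)
    {K : Matrix (Fin n) (Fin n) ℂ} (hK : star K = -K) (t : ℝ) (U : UGroup n) :
    HasDerivAt (fun t => MvPolynomial.eval (entries (orbitPoint B (expPath hK t * U))) f)
      (commDeriv f K (orbitPoint B (expPath hK t * U))) t := by
  simp only [orbitPoint_expPath_mul]
  exact hasDerivAt_eval (fun x => hasDerivAt_entries_conj_exp K _ t x) f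

lemma continuous_orbitPoint_expPath (B : Matrix (Fin n) (Fin n) ℂ)
    {K : Matrix (Fin n) (Fin n) ℂ} (hK : star K = -K) :
    Continuous fun p : ℝ × UGroup n => orbitPoint B (expPath hK p.1 * p.2) :=
  (continuous_orbitPoint B).comp
    (((continuous_expPath hK).comp continuous_fst).mul continuous_snd)

/-- The average of `f` over the orbit moved by `exp (t K)` does not depend on `t`, by left
invariance of Haar measure. Differentiating under the integral at `t = 0` gives the claim. -/
lemma integral_commDeriv_of_skew (B : Matrix (Fin n) (Fin n) ℂ) (f : EntryPoly n)
    {K : Matrix (Fin n) (Fin n) ℂ} (hK : star K = -K) :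
    ∫ U, commDeriv f K (orbitPoint B U) ∂haarU n = 0 := by
  have hc : ∀ t, Continuous fun U : UGroup n => orbitPoint B (expPath hK t * U) := fun t =>
    (continuous_orbitPoint B).comp (continuous_const_mul (expPath hK t))
  have hF : ∀ t, Continuous fun U : UGroup n =>
      MvPolynomial.eval (entries (orbitPoint B (expPath hK t * U))) f := fun t =>
    (continuous_eval_entries f).comp (hc t)
  have hF'c : Continuous fun p : ℝ × UGroup n =>
      commDeriv f K (orbitPoint B (expPath hK p.1 * p.2)) :=
    (continuous_commDeriv f K).comp (continuous_orbitPoint_expPath B hK)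
  have hF' : Continuous fun U : UGroup n => commDeriv f K (orbitPoint B (expPath hK 0 * U)) :=
    (continuous_commDeriv f K).comp (hc 0)
  obtain ⟨C, hC⟩ := ((isCompact_Icc (a := (-1 : ℝ)) (b := 1)).prod
    (isCompact_univ (X := UGroup n))).exists_bound_of_continuousOn hF'c.continuousOn
  have hconst : (fun t : ℝ => ∫ U, MvPolynomial.eval
      (entries (orbitPoint B (expPath hK t * U))) f ∂haarU n) =
      fun _ => ∫ U, MvPolynomial.eval (entries (orbitPoint B U)) f ∂haarU n := by
    funext t
    exact integral_mul_left_eq_self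
      (fun U => MvPolynomial.eval (entries (orbitPoint B U)) f) (expPath hK t)
  have h0 : HasDerivAt (fun t : ℝ => ∫ U, MvPolynomial.eval
      (entries (orbitPoint B (expPath hK t * U))) f ∂haarU n)
      (∫ U, commDeriv f K (orbitPoint B (expPath hK 0 * U)) ∂haarU n) 0 := by
    refine (hasDerivAt_integral_of_dominated_loc_of_deriv_le (μ := haarU n)
      (s := Set.Icc (-1) 1) (bound := fun _ => C)
      (F' := fun t U => commDeriv f K (orbitPoint B (expPath hK t * U)))
      (Icc_mem_nhds (by norm_num) (by norm_num)) ?_ ?_ ?_ ?_ (integrable_const C) ?_).2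
    · exact Filter.Eventually.of_forall fun t => (integrable_haarU_of_continuous (hF t)).1
    · exact integrable_haarU_of_continuous (hF 0)
    · exact (integrable_haarU_of_continuous hF').1
    · exact Filter.Eventually.of_forall fun U t ht => hC (t, U) ⟨ht, Set.mem_univ U⟩
    · exact Filter.Eventually.of_forall fun U t _ =>
        hasDerivAt_eval_orbitPoint_expPath B f hK t U
  rw [hconst] at h0
  have h1 := h0.unique (hasDerivAt_const _ _)
  simpa [expPath_zero] using h1

/-- Every matrix is a complex combination of two skew-Hermitian ones, and `commDeriv` is complex
linear in the direction. This complexification is what makes the matrix units available. -/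
lemma integral_commDeriv (B : Matrix (Fin n) (Fin n) ℂ) (f : EntryPoly n)
    (K : Matrix (Fin n) (Fin n) ℂ) :
    ∫ U, commDeriv f K (orbitPoint B U) ∂haarU n = 0 := by
  have h1 : K = (1 / 2 : ℂ) • (K - star K) +
      (-Complex.I / 2) • (Complex.I • (K + star K)) := by
    ext i j
    simp only [Matrix.add_apply, Matrix.smul_apply, Matrix.sub_apply, smul_eq_mul]
    linear_combination ((1 / 2 : ℂ) * (K i j + (star K) i j)) * Complex.I_mul_I
  have hs1 : star (K - star K) = -(K - star K) := by rw [star_sub, star_star, neg_sub]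
  have hs2 : star (Complex.I • (K + star K)) = -(Complex.I • (K + star K)) := by
    rw [star_smul, star_add, star_star, add_comm, ← neg_smul]
    congr 1
    simp
  have hint : ∀ L, Integrable (fun U => commDeriv f L (orbitPoint B U)) (haarU n) := fun L =>
    integrable_haarU_of_continuous ((continuous_commDeriv f L).comp (continuous_orbitPoint B))
  rw [h1]
  simp only [commDeriv_add, commDeriv_smul _ (1 / 2 : ℂ), commDeriv_smul _ (-Complex.I / 2)]
  rw [integral_add ((hint _).const_mul _) ((hint _).const_mul _), integral_const_mul,
    integral_const_mul, integral_commDeriv_of_skew B f hs1, integral_commDeriv_of_skew B f hs2]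
  simp

lemma conjInvariant_orbitFunctional (B : Matrix (Fin n) (Fin n) ℂ) :
    ConjInvariant (orbitFunctional B) := by
  intro i j f
  rw [orbitFunctional_apply]
  simp only [eval_adDeriv]
  exact integral_commDeriv B f _

lemma eval_tracePow (A : Matrix (Fin n) (Fin n) ℂ) (m : ℕ) :
    MvPolynomial.eval (entries A) (tracePow n m) = (A ^ m).trace := by
  have h : (genericMat n).map (MvPolynomial.eval (entries A)) = A := by
    ext1 i j
    simp [genericMat, entries]
  have h3 : ((genericMat n) ^ m).map (MvPolynomial.eval (entries A)) =
      ((genericMat n).map (MvPolynomial.eval (entries A))) ^ m :=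
    Matrix.map_pow (genericMat n) (MvPolynomial.eval (entries A)) m
  have h2 : MvPolynomial.eval (entries A) (tracePow n m) =
      (((genericMat n) ^ m).map (MvPolynomial.eval (entries A))).trace := by
    simp [tracePow, Matrix.trace, map_sum]
  rw [h2, h3, h]

lemma trace_orbitPoint_pow (B : Matrix (Fin n) (Fin n) ℂ) (U : UGroup n) (m : ℕ) :
    (orbitPoint B U ^ m).trace = (B ^ m).trace := by
  have h : orbitPoint B U ^ m = U.1 * B ^ m * star U.1 := by
    induction m with
    | zero => simp
    | succ m ih =>
      rw [pow_succ, ih, orbitPoint, pow_succ]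
      calc _ = U.1 * B ^ m * (star U.1 * U.1) * B * star U.1 := by noncomm_ring
        _ = _ := by rw [Unitary.coe_star_mul_self]; noncomm_ring
  rw [h, Matrix.trace_mul_comm, ← mul_assoc, Unitary.coe_star_mul_self, one_mul]

lemma orbitFunctional_tracePow_mul (B : Matrix (Fin n) (Fin n) ℂ) (m : ℕ) (f : EntryPoly n) :
    orbitFunctional B (tracePow n m * f) = (B ^ m).trace * orbitFunctional B f := by
  rw [orbitFunctional_apply, orbitFunctional_apply, ← integral_const_mul]
  simp only [map_mul, eval_tracePow, trace_orbitPoint_pow]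

lemma eval_diagIncl (A : Matrix (Fin n) (Fin n) ℂ) (q : MvPolynomial (Fin n) ℂ) :
    MvPolynomial.eval (entries A) (diagIncl n q) = MvPolynomial.eval A.diag q := by
  rw [diagIncl, MvPolynomial.eval_rename]
  rfl

lemma permMatrix_conj (σ : Equiv.Perm (Fin n)) (A : Matrix (Fin n) (Fin n) ℂ) :
    (1 : Matrix (Fin n) (Fin n) ℂ).submatrix σ id * A *
      star ((1 : Matrix (Fin n) (Fin n) ℂ).submatrix σ id) = A.submatrix σ σ := by
  rw [Matrix.star_eq_conjTranspose, Matrix.conjTranspose_submatrix, Matrix.conjTranspose_one]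
  conv_lhs => rw [← Matrix.submatrix_id_id A]
  rw [← Matrix.submatrix_mul _ _ _ _ _ Function.bijective_id,
    ← Matrix.submatrix_mul _ _ _ _ _ Function.bijective_id, one_mul, mul_one]

lemma permMatrix_mem_unitary (σ : Equiv.Perm (Fin n)) :
    (1 : Matrix (Fin n) (Fin n) ℂ).submatrix σ id ∈ Matrix.unitaryGroup (Fin n) ℂ := by
  have h := permMatrix_conj σ 1
  rw [mul_one, Matrix.submatrix_one_equiv] at h
  rw [Matrix.mem_unitaryGroup_iff, h]

/-- Permutation matrices are unitary, so permuting the diagonal is a left translation. -/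
lemma orbitFunctional_diagIncl_rename (B : Matrix (Fin n) (Fin n) ℂ) (σ : Equiv.Perm (Fin n))
    (q : MvPolynomial (Fin n) ℂ) :
    orbitFunctional B (diagIncl n (MvPolynomial.rename σ q)) =
      orbitFunctional B (diagIncl n q) := by
  rw [orbitFunctional_apply, orbitFunctional_apply,
    ← integral_mul_left_eq_self _ (⟨_, permMatrix_mem_unitary σ.symm⟩ : UGroup n)]
  refine integral_congr_ae (Filter.Eventually.of_forall fun U => ?_)
  simp only
  rw [eval_diagIncl, eval_diagIncl, MvPolynomial.eval_rename, orbitPoint_mul, permMatrix_conj]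
  refine congrArg (fun a => MvPolynomial.eval a q) ?_
  ext1 i
  simp

end UnitaryGroup

/-! ### The Harish-Chandra–Itzykson–Zuber formula. -/

section HCIZ

open MvPolynomial Filter Topology

variable {n : ℕ}

/-- The Taylor polynomial of `z ↦ exp (∑ i, s i * z i)` with `M` terms. -/
noncomputable def expPoly (s : Fin n → ℂ) (M : ℕ) : MvPolynomial (Fin n) ℂ :=
  ∑ m ∈ Finset.range M, C ((m ! : ℂ)⁻¹) * (∑ i, C (s i) * X i) ^ m

lemma pderiv_expPoly (s : Fin n → ℂ) (M : ℕ) (i : Fin n) :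
    pderiv i (expPoly s (M + 1)) = C (s i) * expPoly s M := by
  have h0 : pderiv i (∑ i, C (s i) * X i : MvPolynomial (Fin n) ℂ) = C (s i) := by
    simp [pderiv_X, Pi.single_apply]
  rw [expPoly, Finset.sum_range_succ', map_add, map_sum, pow_zero, mul_one, pderiv_C, add_zero,
    expPoly, Finset.mul_sum]
  refine Finset.sum_congr rfl fun m _ => ?_
  have h1 : (((m + 1 : ℕ) ! : ℂ)⁻¹) * ((m + 1 : ℕ) : ℂ) = ((m ! : ℂ))⁻¹ := by
    rw [Nat.factorial_succ]
    have : ((m + 1 : ℕ) : ℂ) ≠ 0 := Nat.cast_ne_zero.mpr (Nat.succ_ne_zero m)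
    have h3 : (m ! : ℂ) ≠ 0 := Nat.cast_ne_zero.mpr (Nat.factorial_ne_zero m)
    rw [Nat.cast_mul]
    field_simp
  rw [Derivation.leibniz, Derivation.leibniz_pow, h0, pderiv_C, smul_zero, add_zero, ← h1, map_mul,
    map_natCast, Nat.add_sub_cancel, nsmul_eq_mul]
  simp only [smul_eq_mul]
  ring

/-- Each first-order factor lowers the truncation order of the Taylor polynomial by one, which
accounts for the shift by `t.card`. -/
lemma diffOp_prod_expPoly (s : Fin n → ℂ) (t : Finset (Fin n × Fin n)) (M : ℕ) :
    diffOp (∏ p ∈ t, (X p.2 - X p.1)) (expPoly s (M + t.card)) =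
      C (∏ p ∈ t, (s p.2 - s p.1)) * expPoly s M := by
  induction t using Finset.induction_on generalizing M with
  | empty => simp
  | insert a t ha ih =>
    rw [Finset.prod_insert ha, Finset.prod_insert ha, Finset.card_insert_of_notMem ha, ← add_assoc,
      add_right_comm, sub_mul, map_sub, map_mul, map_mul, diffOp_X, diffOp_X, LinearMap.sub_apply,
      Module.End.mul_apply, Module.End.mul_apply, ih, partialEnd_apply, partialEnd_apply,
      Derivation.leibniz, Derivation.leibniz, pderiv_C, pderiv_C, pderiv_expPoly, pderiv_expPoly]
    simp only [smul_eq_mul, map_mul, map_sub]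
    ring

lemma diffOp_vdm_expPoly (s : Fin n → ℂ) (M : ℕ) :
    diffOp (vdm n) (expPoly s (M + (orderedPairs n).card)) =
      C (Matrix.vandermonde s).det * expPoly s M := by
  rw [vdm_eq_prod, diffOp_prod_expPoly, det_vandermonde_eq_prod_orderedPairs]

lemma eval_expPoly (s a : Fin n → ℂ) (M : ℕ) : eval a (expPoly s M) =
    ∑ m ∈ Finset.range M, (∑ i, s i * a i) ^ m / (m ! : ℂ) := by
  simp only [expPoly, map_sum, map_mul, map_pow, eval_C, eval_X]
  exact Finset.sum_congr rfl fun m _ => by ring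

lemma tendsto_eval_expPoly (s a : Fin n → ℂ) :
    Tendsto (fun M => eval a (expPoly s M)) atTop (𝓝 (Complex.exp (∑ i, s i * a i))) := by
  simp only [eval_expPoly]
  have := (NormedSpace.expSeries_div_hasSum_exp (∑ i, s i * a i : ℂ)).tendsto_sum_nat
  rwa [← Complex.exp_eq_exp_ℂ] at this

lemma norm_eval_expPoly_le (s a : Fin n → ℂ) (M : ℕ) :
    ‖eval a (expPoly s M)‖ ≤ Real.exp ‖∑ i, s i * a i‖ := by
  rw [eval_expPoly]
  refine (norm_sum_le _ _).trans (le_trans (le_of_eq ?_)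
    (Real.sum_le_exp_of_nonneg (norm_nonneg _) M))
  refine Finset.sum_congr rfl fun m _ => ?_
  rw [norm_div, norm_pow, Complex.norm_natCast]

/-- The Harish-Chandra–Itzykson–Zuber integral. -/
noncomputable def hcizIntegral (s : Fin n → ℂ) (B : Matrix (Fin n) (Fin n) ℂ) : ℂ :=
  ∫ U, Complex.exp (∑ i, s i * orbitPoint B U i i) ∂haarU n

lemma continuous_orbitPoint_diag (B : Matrix (Fin n) (Fin n) ℂ) :
    Continuous fun U => (orbitPoint B U).diag :=
  continuous_pi fun i => (continuous_apply i).comp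
    ((continuous_apply i).comp (continuous_orbitPoint B))

lemma continuous_sum_orbitPoint (s : Fin n → ℂ) (B : Matrix (Fin n) (Fin n) ℂ) :
    Continuous fun U => ∑ i, s i * orbitPoint B U i i :=
  continuous_finsetSum _ fun i _ => continuous_const.mul
    ((continuous_pi_iff.mp (continuous_orbitPoint_diag B)) i)

lemma tendsto_integral_expPoly (s : Fin n → ℂ) (B : Matrix (Fin n) (Fin n) ℂ) :
    Tendsto (fun M => ∫ U, eval (orbitPoint B U).diag (expPoly s M) ∂haarU n) atTop
      (𝓝 (hcizIntegral s B)) := by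
  refine tendsto_integral_of_dominated_convergence
    (fun U => Real.exp ‖∑ i, s i * (orbitPoint B U).diag i‖) (fun M => ?_) ?_ (fun M => ?_) ?_
  · exact (integrable_haarU_of_continuous
      ((MvPolynomial.continuous_eval _).comp (continuous_orbitPoint_diag B))).1
  · exact integrable_haarU_of_continuous
      (Real.continuous_exp.comp (continuous_sum_orbitPoint s B).norm)
  · exact Eventually.of_forall fun U => norm_eval_expPoly_le s _ M
  · exact Eventually.of_forall fun U => tendsto_eval_expPoly s _

/-- The Harish-Chandra–Itzykson–Zuber formula, up to the value of a constant. -/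
theorem hciz_formula {B : Matrix (Fin n) (Fin n) ℂ} {x : Fin n → ℂ}
    (hB : ∀ m, (B ^ m).trace = ∑ i, x i ^ m) (s : Fin n → ℂ) :
    n ! * (Matrix.vandermonde x).det * ((Matrix.vandermonde s).det * hcizIntegral s B) =
      vdmConst n * (Matrix.of fun i j => Complex.exp (s i * x j)).det := by
  by_cases hx : Function.Injective x
  -- The derivative principle is applied to a Taylor polynomial truncated late enough to leave `M`
  -- terms after `Δ(∂)`; dominated convergence handles `M → ∞`.
  · have key : ∀ M, n ! * (Matrix.vandermonde x).det * ((Matrix.vandermonde s).det *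
        ∫ U, eval (orbitPoint B U).diag (expPoly s M) ∂haarU n) =
        vdmConst n * ∑ σ : Equiv.Perm (Fin n), ((Equiv.Perm.sign σ : ℤ) : ℂ) *
          eval (x ∘ σ) (expPoly s (M + (orderedPairs n).card)) := by
      intro M
      have h := (conjInvariant_orbitFunctional B).derivative_principle hx
        (fun m f => by rw [orbitFunctional_tracePow_mul, hB])
        (fun σ q => orbitFunctional_diagIncl_rename B σ q)
        (expPoly s (M + (orderedPairs n).card))
      have h1 : orbitFunctional B 1 = 1 := by simp [orbitFunctional_apply]
      rw [diffOp_vdm_expPoly, h1, mul_one, orbitFunctional_apply] at h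
      simp only [eval_diagIncl, map_mul, eval_C] at h
      rw [integral_const_mul] at h
      exact h
    have hl := ((tendsto_integral_expPoly s B).const_mul (Matrix.vandermonde s).det).const_mul
      (n ! * (Matrix.vandermonde x).det : ℂ)
    have hr : Tendsto (fun M => vdmConst n * ∑ σ : Equiv.Perm (Fin n),
        ((Equiv.Perm.sign σ : ℤ) : ℂ) * eval (x ∘ σ) (expPoly s (M + (orderedPairs n).card)))
        atTop (𝓝 (vdmConst n * ∑ σ : Equiv.Perm (Fin n), ((Equiv.Perm.sign σ : ℤ) : ℂ) *
          Complex.exp (∑ i, s i * (x ∘ σ) i))) := by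
      refine Tendsto.const_mul _ (tendsto_finsetSum _ fun σ _ => Tendsto.const_mul _ ?_)
      exact (tendsto_eval_expPoly s (x ∘ σ)).comp (tendsto_add_atTop_nat _)
    rw [funext key] at hl
    rw [tendsto_nhds_unique hl hr, ← Matrix.det_transpose, Matrix.det_apply']
    congr 1
    refine Finset.sum_congr rfl fun σ _ => ?_
    rw [Complex.exp_sum]
    rfl
  -- With a repeated eigenvalue both sides vanish: one has a zero Vandermonde factor, the other two
  -- equal columns.
  · simp only [Function.Injective, not_forall] at hx
    obtain ⟨i, j, hij, hne⟩ := hx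
    have h1 : (Matrix.vandermonde x).det = 0 := by
      by_contra h
      exact hne (Matrix.det_vandermonde_ne_zero_iff.mp h hij)
    have h2 : (Matrix.of fun i j => Complex.exp (s i * x j)).det = 0 :=
      Matrix.det_zero_of_column_eq hne (fun k => by simp [hij])
    rw [h1, h2]
    simp

lemma continuous_hcizIntegral (B : Matrix (Fin n) (Fin n) ℂ) :
    Continuous fun s => hcizIntegral s B := by
  have h : Continuous (Function.uncurry fun (s : Fin n → ℂ) (U : UGroup n) =>
      Complex.exp (∑ i, s i * orbitPoint B U i i)) := by
    refine Complex.continuous_exp.comp (continuous_finsetSum _ fun i _ => Continuous.mul ?_ ?_)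
    · exact (continuous_apply i).comp continuous_fst
    · exact ((continuous_pi_iff.mp (continuous_orbitPoint_diag B)) i).comp continuous_snd
  have := continuous_parametric_integral_of_continuous (μ := haarU n) h isCompact_univ
  simpa only [Measure.restrict_univ] using! this

end HCIZ

/-! ### Measurability of the ordered eigenvalues and the spectral decomposition. -/

section Eigenvalues

variable {n : ℕ}

instance secondCountableTopology_herm : SecondCountableTopology (Herm n) :=
  inferInstanceAs (SecondCountableTopology
    ((selfAdjoint (Matrix (Fin n) (Fin n) ℂ) : Set (Matrix (Fin n) (Fin n) ℂ))))

lemma exists_perm_of_map_univ_eq {α : Type*} [LinearOrder α] {f g : Fin n → α}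
    (h : Finset.univ.val.map f = Finset.univ.val.map g) : ∃ π : Equiv.Perm (Fin n), g = f ∘ π := by
  have hp : (List.ofFn f).Perm (List.ofFn g) := by
    rw [Fin.univ_val_map, Fin.univ_val_map] at h
    exact Multiset.coe_eq_coe.mp h
  have h1 : f ∘ Tuple.sort f = g ∘ Tuple.sort g :=
    List.ofFn_injective
      (((((Tuple.sort f).ofFn_comp_perm f).trans hp).trans
        ((Tuple.sort g).ofFn_comp_perm g).symm).eq_of_pairwise'
        (Tuple.monotone_sort f).sortedLE_ofFn.pairwise
        (Tuple.monotone_sort g).sortedLE_ofFn.pairwise)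
  refine ⟨(Tuple.sort g).symm.trans (Tuple.sort f), ?_⟩
  ext1 i
  have := congrFun h1 ((Tuple.sort g).symm i)
  simp only [Function.comp_apply, Equiv.apply_symm_apply] at this
  rw [← this]
  rfl

/-- The values at the natural numbers of the monic polynomial with roots `x`. -/
noncomputable def rootValues (x : Fin n → ℝ) (q : ℕ) : ℂ := ∏ i, ((q : ℂ) - (x i : ℂ))

/-- Monic polynomials agreeing at infinitely many points are equal, hence have the same multiset of
roots. -/
lemma exists_perm_of_rootValues_eq {x y : Fin n → ℝ} (h : rootValues x = rootValues y) :
    ∃ π : Equiv.Perm (Fin n), y = x ∘ π := by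
  have hpoly : ∏ i, (Polynomial.X - Polynomial.C (x i : ℂ)) =
      ∏ i, (Polynomial.X - Polynomial.C (y i : ℂ)) := by
    refine Polynomial.eq_of_infinite_eval_eq _ _ ?_
    refine (Set.infinite_range_of_injective (Nat.cast_injective (R := ℂ))).mono ?_
    rintro _ ⟨q, rfl⟩
    have := congrFun h q
    simpa [rootValues, Polynomial.eval_prod] using this
  have hroots := congrArg Polynomial.roots hpoly
  rw [Polynomial.roots_prod _ _ (by simp [Finset.prod_ne_zero_iff, Polynomial.X_sub_C_ne_zero]),
    Polynomial.roots_prod _ _ (by simp [Finset.prod_ne_zero_iff, Polynomial.X_sub_C_ne_zero])]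
    at hroots
  simp only [Polynomial.roots_X_sub_C, Multiset.bind_singleton] at hroots
  refine exists_perm_of_map_univ_eq ?_
  have h2 := congrArg (Multiset.map Complex.re) hroots
  simpa [Multiset.map_map, Function.comp_def] using h2

lemma rootValues_eigenvals (A : Herm n) (q : ℕ) :
    rootValues (eigenvals A) q = (Matrix.scalar (Fin n) (q : ℂ) - A.1).det := by
  have hA : Matrix.IsHermitian A.1 := A.2
  have h := congrArg (Polynomial.eval (q : ℂ)) hA.charpoly_eq
  rw [Matrix.eval_charpoly, Polynomial.eval_prod] at h
  rw [h, rootValues]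
  refine Finset.prod_congr rfl fun i _ => ?_
  simp [eigenvals]

lemma continuous_herm_val : Continuous fun A : Herm n => A.1 := continuous_subtype_val

/-- The order in which eigenvalues are listed. -/
noncomputable def eigenvalOrder (n : ℕ) : Fin (Fintype.card (Fin n)) ≃ Fin n :=
  Fintype.equivOfCardEq (Fintype.card_fin _)

lemma antitone_eigenvals_comp (A : Herm n) : Antitone (eigenvals A ∘ eigenvalOrder n) := by
  have hA : Matrix.IsHermitian A.1 := A.2
  have h : eigenvals A ∘ eigenvalOrder n = hA.eigenvalues₀ := by
    ext1 i
    simp [eigenvals, Matrix.IsHermitian.eigenvalues, eigenvalOrder]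
  rw [h]
  exact hA.eigenvalues₀_antitone

/-- The map `rootValues` is continuous, and injective on the closed set `T` of ordered tuples, so by
the Lusin–Souslin theorem it sends closed subsets of `T` to Borel sets. Composed with the
eigenvalues it is a sequence of determinants, continuous in the matrix, so preimages under
`eigenvals` are Borel. -/
lemma measurable_eigenvals : Measurable (eigenvals (n := n)) := by
  set T : Set (Fin n → ℝ) := {x | Antitone (x ∘ eigenvalOrder n)} with hT
  have hTc : IsClosed T := by
    have : T = ⋂ (i) (j) (_ : i ≤ j), {x | x (eigenvalOrder n j) ≤ x (eigenvalOrder n i)} := by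
      ext x
      simp [hT, Antitone]
    rw [this]
    refine isClosed_iInter fun i => isClosed_iInter fun j => isClosed_iInter fun _ => ?_
    exact isClosed_le (continuous_apply _) (continuous_apply _)
  have hinj : Set.InjOn (rootValues (n := n)) T := by
    intro x hx y hy hxy
    obtain ⟨π, rfl⟩ := exists_perm_of_rootValues_eq hxy
    set e := eigenvalOrder n
    -- Two antitone rearrangements of the same tuple coincide, even though the permutation itself
    -- need not be trivial.
    have h1 : (x ∘ e) ∘ (1 : Equiv.Perm (Fin (Fintype.card (Fin n)))) =
        (x ∘ e) ∘ ((e.trans π).trans e.symm) := by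
      refine Tuple.unique_antitone hx ?_
      have : (x ∘ e) ∘ ((e.trans π).trans e.symm) = (x ∘ π) ∘ e := by
        ext1 i
        simp
      rw [this]
      exact hy
    ext1 i
    have := congrFun h1 (e.symm i)
    simpa using this
  have hcont : Continuous (rootValues (n := n)) := by
    unfold rootValues
    refine continuous_pi fun q => continuous_finsetProd _ fun i _ => continuous_const.sub ?_
    exact Complex.continuous_ofReal.comp (continuous_apply i)
  have hg : Measurable fun (A : Herm n) (q : ℕ) =>
      (Matrix.scalar (Fin n) (q : ℂ) - A.1).det := by
    refine Continuous.measurable (continuous_pi fun q => ?_)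
    exact (continuous_const.sub continuous_herm_val).matrix_det
  refine measurable_of_isClosed fun C hC => ?_
  have hpre : eigenvals (n := n) ⁻¹' C = (fun (A : Herm n) (q : ℕ) =>
      (Matrix.scalar (Fin n) (q : ℂ) - A.1).det) ⁻¹' (rootValues '' (C ∩ T)) := by
    ext A
    constructor
    · intro hA
      exact ⟨eigenvals A, ⟨hA, antitone_eigenvals_comp A⟩, funext fun q => rootValues_eigenvals A q⟩
    · rintro ⟨y, ⟨hyC, hyT⟩, hy⟩
      have : y = eigenvals A := hinj hyT (antitone_eigenvals_comp A)
        (hy.trans (funext fun q => (rootValues_eigenvals A q).symm))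
      rw [Set.mem_preimage, ← this]
      exact hyC
  rw [hpre]
  exact hg ((hC.inter hTc).measurableSet.image_of_continuousOn_injOn hcont.continuousOn
    (hinj.mono Set.inter_subset_right))

/-- The diagonal Hermitian matrix with given real diagonal. -/
noncomputable def diagHerm (x : Fin n → ℝ) : Herm n :=
  ⟨Matrix.diagonal fun i => (x i : ℂ), by
    rw [selfAdjoint.mem_iff, Matrix.star_eq_conjTranspose, Matrix.diagonal_conjTranspose]
    congr 1
    ext1 i
    simp⟩

/-- The Hermitian matrix `U diag(x) U*`. -/
noncomputable def liftPoint (p : UGroup n × (Fin n → ℝ)) : Herm n := conjBy p.1.1 (diagHerm p.2)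

lemma conjBy_val (U : Matrix (Fin n) (Fin n) ℂ) (A : Herm n) :
    (conjBy U A).1 = U * A.1 * star U := rfl

lemma continuous_conjBy (U : Matrix (Fin n) (Fin n) ℂ) : Continuous (conjBy (n := n) U) := by
  refine Continuous.subtype_mk ?_ _
  exact (continuous_const.mul continuous_herm_val).mul continuous_const

lemma continuous_diagHerm : Continuous (diagHerm (n := n)) := by
  refine Continuous.subtype_mk ?_ _
  exact Continuous.matrix_diagonal
    (continuous_pi fun i => Complex.continuous_ofReal.comp (continuous_apply i))

lemma continuous_conjBy_unitary :
    Continuous fun p : UGroup n × Herm n => conjBy p.1.1 p.2 := by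
  refine Continuous.subtype_mk ?_ _
  have h1 : Continuous fun p : UGroup n × Herm n => p.1.1 :=
    continuous_subtype_val.comp continuous_fst
  exact (h1.mul (continuous_herm_val.comp continuous_snd)).mul h1.star

lemma continuous_liftPoint : Continuous (liftPoint (n := n)) := by
  refine Continuous.subtype_mk ?_ _
  have h1 : Continuous fun p : UGroup n × (Fin n → ℝ) => p.1.1 :=
    continuous_subtype_val.comp continuous_fst
  exact (h1.mul (continuous_herm_val.comp (continuous_diagHerm.comp continuous_snd))).mul h1.star

lemma exists_eq_liftPoint (A : Herm n) : ∃ V : UGroup n, A = liftPoint (V, eigenvals A) := by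
  have hA : Matrix.IsHermitian A.1 := A.2
  refine ⟨hA.eigenvectorUnitary, Subtype.ext ?_⟩
  have h := hA.spectral_theorem
  rw [Unitary.conjStarAlgAut_apply] at h
  rw [liftPoint, conjBy_val]
  exact h

lemma exists_eigenvals_liftPoint (U : UGroup n) (x : Fin n → ℝ) :
    ∃ π : Equiv.Perm (Fin n), eigenvals (liftPoint (U, x)) = x ∘ π := by
  refine exists_perm_of_rootValues_eq (funext fun q => ?_)
  rw [rootValues_eigenvals, liftPoint, conjBy_val]
  have hU : U.1 * star U.1 = 1 := Unitary.coe_mul_star_self U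
  have h1 : Matrix.scalar (Fin n) (q : ℂ) - U.1 * (diagHerm x).1 * star U.1 =
      U.1 * (Matrix.scalar (Fin n) (q : ℂ) - (diagHerm x).1) * star U.1 := by
    rw [mul_sub, sub_mul, ← (Matrix.scalar_commute (q : ℂ) (fun r => Commute.all _ _) U.1).eq,
      mul_assoc _ U.1, hU, mul_one]
  rw [h1, Matrix.det_mul, Matrix.det_mul, mul_right_comm, ← Matrix.det_mul, hU, Matrix.det_one,
    one_mul]
  have h2 : Matrix.scalar (Fin n) (q : ℂ) - (diagHerm x).1 =
      Matrix.diagonal fun i => (q : ℂ) - (x i : ℂ) := by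
    rw [diagHerm, Matrix.scalar_apply, Matrix.diagonal_sub]
  rw [h2, Matrix.det_diagonal, rootValues]

end Eigenvalues

/-! ### Passing between matrix laws and symmetric eigenvalue laws. -/

section SymmetrizedLaw

variable {n : ℕ}

/-- The law of the eigenvalues, listed in uniformly random order, under a measure on Hermitian
matrices. -/
noncomputable def symLaw (m : Measure (Herm n)) : Measure (Fin n → ℝ) :=
  ((n ! : ℕ) : ℝ≥0∞)⁻¹ • ∑ σ : Equiv.Perm (Fin n), m.map fun A => eigenvals A ∘ σ

lemma measurable_comp_perm (σ : Equiv.Perm (Fin n)) :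
    Measurable fun x : Fin n → ℝ => x ∘ σ :=
  measurable_pi_iff.mpr fun i => measurable_pi_apply (σ i)

lemma measurable_eigenvals_comp (σ : Equiv.Perm (Fin n)) :
    Measurable fun A : Herm n => eigenvals A ∘ σ :=
  (measurable_comp_perm σ).comp measurable_eigenvals

lemma eigenvalueLaw_eq_symLaw {Ω : Type*} [MeasurableSpace Ω] (P : Measure Ω) {X : Ω → Herm n}
    (hX : Measurable X) : eigenvalueLaw P X = symLaw (P.map X) := by
  unfold eigenvalueLaw symLaw
  congr 1
  refine Finset.sum_congr rfl fun σ _ => ?_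
  rw [Measure.map_map (measurable_eigenvals_comp σ) hX]
  rfl

lemma symLaw_apply (m : Measure (Herm n)) {S : Set (Fin n → ℝ)} (hS : MeasurableSet S) :
    symLaw m S = ((n ! : ℕ) : ℝ≥0∞)⁻¹ *
      ∑ σ : Equiv.Perm (Fin n), m ((fun A => eigenvals A ∘ σ) ⁻¹' S) := by
  rw [symLaw, Measure.smul_apply, Measure.coe_finsetSum, Finset.sum_apply, smul_eq_mul]
  congr 1
  refine Finset.sum_congr rfl fun σ _ => ?_
  rw [Measure.map_apply (measurable_eigenvals_comp σ) hS]

lemma symLaw_add (m₁ m₂ : Measure (Herm n)) : symLaw (m₁ + m₂) = symLaw m₁ + symLaw m₂ := by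
  ext S hS
  rw [Measure.add_apply, symLaw_apply _ hS, symLaw_apply _ hS, symLaw_apply _ hS, ← mul_add,
    ← Finset.sum_add_distrib]
  rfl

/-- The law of `U diag(x) U*` for independent Haar distributed `U` and `x` with law `ν`. -/
noncomputable def liftLaw (ν : Measure (Fin n → ℝ)) : Measure (Herm n) :=
  ((haarU n).prod ν).map liftPoint

instance (ν : Measure (Fin n → ℝ)) [IsFiniteMeasure ν] : IsFiniteMeasure (liftLaw ν) := by
  unfold liftLaw; infer_instance

lemma inv_factorial_mul_sum_const (c : ℝ≥0∞) :
    ((n ! : ℕ) : ℝ≥0∞)⁻¹ * ∑ _σ : Equiv.Perm (Fin n), c = c := by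
  rw [Finset.sum_const, Finset.card_univ, Fintype.card_perm, Fintype.card_fin, nsmul_eq_mul,
    ← mul_assoc, ENNReal.inv_mul_cancel (Nat.cast_ne_zero.mpr (Nat.factorial_ne_zero n))
    (ENNReal.natCast_ne_top _), one_mul]

/-- The eigenvalues of `U diag(x) U*` are `x` up to an unknown permutation depending on the point.
Summation over all permutations absorbs it, so no measurable choice is needed. -/
lemma symLaw_liftLaw {ν : Measure (Fin n → ℝ)} [IsFiniteMeasure ν]
    (hν : ∀ σ : Equiv.Perm (Fin n), ν.map (fun x => x ∘ σ) = ν) : symLaw (liftLaw ν) = ν := by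
  ext S hS
  have hmeas : ∀ σ : Equiv.Perm (Fin n),
      MeasurableSet ((fun A : Herm n => eigenvals A ∘ σ) ⁻¹' S) :=
    fun σ => measurable_eigenvals_comp σ hS
  have hmeas2 : ∀ σ : Equiv.Perm (Fin n),
      MeasurableSet ((fun x : Fin n → ℝ => x ∘ σ) ⁻¹' S) := fun σ => measurable_comp_perm σ hS
  have h1 : ∀ σ : Equiv.Perm (Fin n), liftLaw ν ((fun A => eigenvals A ∘ σ) ⁻¹' S) =
      ∫⁻ p, S.indicator 1 (eigenvals (liftPoint p) ∘ σ) ∂((haarU n).prod ν) := by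
    intro σ
    rw [liftLaw, Measure.map_apply continuous_liftPoint.measurable (hmeas σ),
      ← lintegral_indicator_one (continuous_liftPoint.measurable (hmeas σ))]
    rfl
  have hm : ∀ σ : Equiv.Perm (Fin n), Measurable fun p : UGroup n × (Fin n → ℝ) =>
      S.indicator (1 : (Fin n → ℝ) → ℝ≥0∞) (eigenvals (liftPoint p) ∘ σ) := fun σ =>
    (measurable_one.indicator hS).comp
      ((measurable_eigenvals_comp σ).comp continuous_liftPoint.measurable)
  have h2 : ∀ p : UGroup n × (Fin n → ℝ),
      ∑ σ : Equiv.Perm (Fin n), S.indicator (1 : (Fin n → ℝ) → ℝ≥0∞)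
        (eigenvals (liftPoint p) ∘ σ) =
      ∑ σ : Equiv.Perm (Fin n), S.indicator (1 : (Fin n → ℝ) → ℝ≥0∞) (p.2 ∘ σ) := by
    rintro ⟨U, x⟩
    obtain ⟨π, hπ⟩ := exists_eigenvals_liftPoint U x
    rw [hπ]
    exact Fintype.sum_equiv (Equiv.mulLeft π) _ _ fun σ => rfl
  rw [symLaw_apply _ hS, Finset.sum_congr rfl fun σ _ => h1 σ,
    ← lintegral_finsetSum _ fun σ _ => hm σ]
  simp only [h2]
  rw [lintegral_finsetSum]
  · have h3 : ∀ σ : Equiv.Perm (Fin n),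
        ∫⁻ p, S.indicator (1 : (Fin n → ℝ) → ℝ≥0∞) (p.2 ∘ σ) ∂((haarU n).prod ν) = ν S := by
      intro σ
      have hm2 : Measurable fun x : Fin n → ℝ => S.indicator (1 : (Fin n → ℝ) → ℝ≥0∞) (x ∘ σ) :=
        (measurable_one.indicator hS).comp (measurable_comp_perm σ)
      have h4 := lintegral_prod (μ := haarU n) (ν := ν)
        (fun p => S.indicator (1 : (Fin n → ℝ) → ℝ≥0∞) (p.2 ∘ σ))
        (hm2.comp measurable_snd).aemeasurable
      rw [h4]
      simp only [lintegral_const, measure_univ, mul_one]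
      have : ∫⁻ x, S.indicator (1 : (Fin n → ℝ) → ℝ≥0∞) (x ∘ σ) ∂ν =
          ν ((fun x : Fin n → ℝ => x ∘ σ) ⁻¹' S) := by
        rw [← lintegral_indicator_one (hmeas2 σ)]
        rfl
      rw [this, ← Measure.map_apply (measurable_comp_perm σ) hS, hν]
    rw [Finset.sum_congr rfl fun σ _ => h3 σ, inv_factorial_mul_sum_const]
  · intro σ _
    exact ((measurable_one.indicator hS).comp (measurable_comp_perm σ)).comp measurable_snd

end SymmetrizedLaw

/-! ### The characteristic function of the diagonal determines an invariant law. -/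

section CharacteristicFunctions

variable {n : ℕ}

instance isHaarMeasure_haarU : (haarU n).IsHaarMeasure := by
  unfold haarU; infer_instance

/-- A right translate of the Haar probability measure is again a Haar probability measure, hence
equal to it by uniqueness. -/
instance isMulRightInvariant_haarU : (haarU n).IsMulRightInvariant := by
  refine ⟨fun g => ?_⟩
  have h2 : IsProbabilityMeasure ((haarU n).map (· * g)) :=
    Measure.isProbabilityMeasure_map (continuous_mul_const g).aemeasurable
  exact Measure.isHaarMeasure_eq_of_isProbabilityMeasure _ _

lemma hcizIntegral_orbitPoint (s : Fin n → ℂ) (B : Matrix (Fin n) (Fin n) ℂ) (V : UGroup n) :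
    hcizIntegral s (orbitPoint B V) = hcizIntegral s B := by
  have h : ∀ U : UGroup n, orbitPoint (orbitPoint B V) U = orbitPoint B (U * V) := by
    intro U
    rw [orbitPoint_mul]
    rfl
  unfold hcizIntegral
  simp only [h]
  exact integral_mul_right_eq_self (fun U => Complex.exp (∑ i, s i * orbitPoint B U i i)) V

/-- The invariance of a measure on Hermitian matrices under unitary conjugation. -/
def ConjInvariantMeasure (m : Measure (Herm n)) : Prop :=
  ∀ U : UGroup n, m.map (conjBy U.1) = m

/-- The characteristic function of the diagonal entries of a Hermitian matrix. -/
noncomputable def diagChar (m : Measure (Herm n)) (s : Fin n → ℝ) : ℂ :=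
  ∫ A, Complex.exp (∑ j, (s j * Complex.I) * A.1 j j) ∂m

/-- The characteristic function of the diagonal entries of a uniformly random matrix with
spectrum `x`. -/
noncomputable def orbitChar (s x : Fin n → ℝ) : ℂ :=
  hcizIntegral (fun j => s j * Complex.I) (diagHerm x).1

lemma hermitian_diag_re {A : Herm n} (j : Fin n) : A.1 j j = ((A.1 j j).re : ℂ) := by
  have hA : Matrix.IsHermitian A.1 := A.2
  exact (Complex.conj_eq_iff_re.mp (hA.apply j j)).symm

lemma sum_mul_I_diag (s : Fin n → ℝ) (A : Herm n) :
    ∑ j, (s j * Complex.I) * A.1 j j = ((∑ j, s j * (A.1 j j).re : ℝ) : ℂ) * Complex.I := by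
  rw [Complex.ofReal_sum, Finset.sum_mul]
  refine Finset.sum_congr rfl fun j _ => ?_
  conv_lhs => rw [hermitian_diag_re]
  push_cast
  ring

lemma norm_exp_diag (s : Fin n → ℝ) (A : Herm n) :
    ‖Complex.exp (∑ j, (s j * Complex.I) * A.1 j j)‖ = 1 := by
  rw [sum_mul_I_diag, Complex.norm_exp_ofReal_mul_I]

lemma continuous_exp_diag (s : Fin n → ℝ) :
    Continuous fun A : Herm n => Complex.exp (∑ j, (s j * Complex.I) * A.1 j j) := by
  refine Complex.continuous_exp.comp (continuous_finsetSum _ fun j _ => continuous_const.mul ?_)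
  exact (continuous_apply j).comp ((continuous_apply j).comp continuous_herm_val)

lemma integrable_exp_diag (m : Measure (Herm n)) [IsFiniteMeasure m] (s : Fin n → ℝ) :
    Integrable (fun A : Herm n => Complex.exp (∑ j, (s j * Complex.I) * A.1 j j)) m :=
  Integrable.of_bound (continuous_exp_diag s).measurable.aestronglyMeasurable 1
    (Filter.Eventually.of_forall fun A => (norm_exp_diag s A).le)

lemma hcizIntegral_val (s : Fin n → ℝ) (A : Herm n) :
    hcizIntegral (fun j => s j * Complex.I) A.1 =
      ∫ U : UGroup n, Complex.exp (∑ j, (s j * Complex.I) * (conjBy U.1 A).1 j j) ∂haarU n := rfl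

/-- By invariance the integrand may be conjugated by any `U`; averaging over `U` and Fubini produce
the HCIZ integral. -/
lemma diagChar_eq_integral_hciz {m : Measure (Herm n)} [IsFiniteMeasure m]
    (hm : ConjInvariantMeasure m) (s : Fin n → ℝ) :
    diagChar m s = ∫ A, hcizIntegral (fun j => s j * Complex.I) A.1 ∂m := by
  have h1 : ∀ U : UGroup n, diagChar m s =
      ∫ A, Complex.exp (∑ j, (s j * Complex.I) * (conjBy U.1 A).1 j j) ∂m := by
    intro U
    conv_lhs => rw [← hm U]
    unfold diagChar
    rw [integral_map (continuous_conjBy U.1).aemeasurable]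
    exact (continuous_exp_diag s).measurable.aestronglyMeasurable
  have h2 : diagChar m s = ∫ _U : UGroup n, diagChar m s ∂haarU n := by simp
  rw [h2, integral_congr_ae (Filter.Eventually.of_forall h1)]
  simp only [hcizIntegral_val]
  refine integral_integral_swap ?_
  refine Integrable.of_bound ?_ 1 (Filter.Eventually.of_forall fun p => (norm_exp_diag s _).le)
  exact ((continuous_exp_diag s).comp continuous_conjBy_unitary).measurable.aestronglyMeasurable

lemma diagHerm_comp_perm (x : Fin n → ℝ) (σ : Equiv.Perm (Fin n)) :
    ∃ V : UGroup n, diagHerm (x ∘ σ) = conjBy V.1 (diagHerm x) := by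
  refine ⟨⟨_, permMatrix_mem_unitary σ⟩, Subtype.ext ?_⟩
  rw [conjBy_val, permMatrix_conj, diagHerm, diagHerm, Matrix.submatrix_diagonal_equiv]
  rfl

lemma orbitChar_comp_perm (s x : Fin n → ℝ) (σ : Equiv.Perm (Fin n)) :
    orbitChar s (x ∘ σ) = orbitChar s x := by
  obtain ⟨V, hV⟩ := diagHerm_comp_perm x σ
  rw [orbitChar, hV]
  exact hcizIntegral_orbitPoint _ (diagHerm x).1 V

lemma orbitChar_eigenvals (s : Fin n → ℝ) (A : Herm n) :
    orbitChar s (eigenvals A) = hcizIntegral (fun j => s j * Complex.I) A.1 := by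
  obtain ⟨V, hV⟩ := exists_eq_liftPoint A
  conv_rhs => rw [hV]
  exact (hcizIntegral_orbitPoint _ (diagHerm (eigenvals A)).1 V).symm

lemma continuous_orbitChar (s : Fin n → ℝ) : Continuous (orbitChar s) := by
  have h : Continuous (Function.uncurry fun (x : Fin n → ℝ) (U : UGroup n) =>
      Complex.exp (∑ j, (s j * Complex.I) * (liftPoint (U, x)).1 j j)) :=
    ((continuous_exp_diag s).comp continuous_liftPoint).comp continuous_swap
  have := continuous_parametric_integral_of_continuous (μ := haarU n) h isCompact_univ
  simpa only [Measure.restrict_univ] using! this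

lemma continuous_orbitChar_left (x : Fin n → ℝ) : Continuous fun s => orbitChar s x := by
  refine (continuous_hcizIntegral _).comp (continuous_pi fun j => ?_)
  exact (Complex.continuous_ofReal.comp (continuous_apply j)).mul continuous_const

lemma norm_orbitChar_le (s x : Fin n → ℝ) : ‖orbitChar s x‖ ≤ 1 := by
  rw [orbitChar, hcizIntegral_val]
  refine (norm_integral_le_of_norm_le_const
    (Filter.Eventually.of_forall fun U => (norm_exp_diag s _).le)).trans ?_
  simp

lemma diagChar_eq_integral_symLaw {m : Measure (Herm n)} [IsFiniteMeasure m]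
    (hm : ConjInvariantMeasure m) (s : Fin n → ℝ) :
    diagChar m s = ∫ x, orbitChar s x ∂(symLaw m) := by
  have hint : ∀ σ : Equiv.Perm (Fin n),
      Integrable (orbitChar s) (m.map fun A => eigenvals A ∘ σ) := fun σ =>
    Integrable.of_bound (continuous_orbitChar s).measurable.aestronglyMeasurable 1
      (Filter.Eventually.of_forall fun x => norm_orbitChar_le s x)
  have h1 : ∀ σ : Equiv.Perm (Fin n), ∫ x, orbitChar s x ∂(m.map fun A => eigenvals A ∘ σ) =
      diagChar m s := by
    intro σ
    rw [integral_map (measurable_eigenvals_comp σ).aemeasurable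
      (continuous_orbitChar s).measurable.aestronglyMeasurable, diagChar_eq_integral_hciz hm]
    simp only [orbitChar_comp_perm, orbitChar_eigenvals]
  rw [symLaw, integral_smul_measure, integral_finsetSum_measure fun σ _ => hint σ,
    Finset.sum_congr rfl fun σ _ => h1 σ, Finset.sum_const, Finset.card_univ, Fintype.card_perm,
    Fintype.card_fin, ENNReal.toReal_inv, ENNReal.toReal_natCast, ← Nat.cast_smul_eq_nsmul ℝ,
    smul_smul, inv_mul_cancel₀ (Nat.cast_ne_zero.mpr (Nat.factorial_ne_zero n)), one_smul]

lemma conjInvariantMeasure_liftLaw (ν : Measure (Fin n → ℝ)) [IsFiniteMeasure ν] :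
    ConjInvariantMeasure (liftLaw ν) := by
  intro U
  rw [liftLaw, Measure.map_map (continuous_conjBy U.1).measurable continuous_liftPoint.measurable]
  have h1 : conjBy U.1 ∘ liftPoint = liftPoint ∘ (Prod.map (U * ·) (id : (Fin n → ℝ) → _)) := by
    ext1 p
    refine Subtype.ext ?_
    exact (orbitPoint_mul (diagHerm p.2).1 U p.1).symm
  have hU : Measurable fun V : UGroup n => U * V := (continuous_const_mul U).measurable
  rw [h1, ← Measure.map_map continuous_liftPoint.measurable (hU.prodMap measurable_id),
    ← Measure.map_prod_map _ _ hU measurable_id, Measure.map_id, map_mul_left_eq_self]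

/-- Every real linear functional on Hermitian matrices is, up to unitary conjugation, a linear
combination of the diagonal entries. -/
lemma exists_diag_functional (L : (Fin n → Fin n → ℂ) →ₗ[ℝ] ℝ) :
    ∃ (s : Fin n → ℝ) (V : UGroup n), ∀ A : Herm n,
      (L A.1 : ℂ) = ∑ j, s j * (conjBy V.1 A).1 j j := by
  classical
  set E : Fin n → Fin n → ℂ → (Fin n → Fin n → ℂ) := fun i j c => Pi.single i (Pi.single j c)
  -- `T` represents `L` through the real trace pairing, `L A = Re tr (A T)`. On Hermitian `A` only
  -- its Hermitian part `S` matters, and diagonalizing `S` gives `s` and `V`.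
  set T : Matrix (Fin n) (Fin n) ℂ := Matrix.of fun j i =>
    (L (E i j 1) : ℂ) - Complex.I * L (E i j Complex.I) with hT
  have hL : ∀ A : Matrix (Fin n) (Fin n) ℂ, L A = (A * T).trace.re := by
    intro A
    have hA : (A : Fin n → Fin n → ℂ) = ∑ i, ∑ j, ((A i j).re • E i j 1 +
        (A i j).im • E i j Complex.I) := by
      ext i j
      simp only [E, Finset.sum_apply, Pi.add_apply, Pi.smul_apply]
      rw [Finset.sum_eq_single i]
      · rw [Finset.sum_eq_single j]
        · simp [Complex.re_add_im]
        · intro b _ hb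
          simp [Pi.single_eq_of_ne hb.symm]
        · simp
      · intro b _ hb
        simp [Pi.single_eq_of_ne hb.symm]
      · simp
    conv_lhs => rw [hA]
    simp only [map_sum, map_add, map_smul, smul_eq_mul, Matrix.trace, Matrix.diag_apply,
      Matrix.mul_apply, Complex.re_sum]
    refine Finset.sum_congr rfl fun i _ => Finset.sum_congr rfl fun j _ => ?_
    simp [hT]
  set S : Matrix (Fin n) (Fin n) ℂ := (1 / 2 : ℂ) • (T + star T) with hS
  have hSh : S ∈ selfAdjoint (Matrix (Fin n) (Fin n) ℂ) := by
    rw [selfAdjoint.mem_iff, hS, star_smul, star_add, star_star, add_comm]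
    congr 1
    simp
  have htr : ∀ A : Herm n, ((A.1 * T).trace.re : ℂ) = (A.1 * S).trace := by
    intro A
    have h1 : (A.1 * star T).trace = starRingEnd ℂ (A.1 * T).trace := by
      have h2 : star (T * A.1) = A.1 * star T := by
        rw [star_mul, A.2.star_eq]
      rw [← h2, Matrix.star_eq_conjTranspose, Matrix.trace_conjTranspose, Matrix.trace_mul_comm]
      rfl
    rw [hS, mul_smul_comm, Matrix.trace_smul, mul_add, Matrix.trace_add, h1, Complex.add_conj]
    simp
  obtain ⟨W, hW⟩ := exists_eq_liftPoint (⟨S, hSh⟩ : Herm n)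
  set s := eigenvals (⟨S, hSh⟩ : Herm n)
  have hS2 : S = W.1 * (diagHerm s).1 * star W.1 := congrArg Subtype.val hW
  refine ⟨s, W⁻¹, fun A => ?_⟩
  have hinv : (W⁻¹).1 = star W.1 := rfl
  rw [hL, htr, hS2, conjBy_val, hinv, star_star, ← mul_assoc, ← mul_assoc,
    Matrix.trace_mul_comm, ← mul_assoc, ← mul_assoc, Matrix.trace]
  refine Finset.sum_congr rfl fun j _ => ?_
  rw [diagHerm, Matrix.diag_apply, Matrix.mul_diagonal, mul_comm]

/-- The array of entries of a Hermitian matrix. -/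
def hermEntries (A : Herm n) : Fin n → Fin n → ℂ := fun i j => A.1 i j

lemma measurableEmbedding_hermEntries : MeasurableEmbedding (hermEntries (n := n)) := by
  have h : IsClosed {A : Matrix (Fin n) (Fin n) ℂ | star A = A} :=
    isClosed_eq continuous_star continuous_id
  have h2 : Topology.IsClosedEmbedding (hermEntries (n := n)) :=
    Topology.IsClosedEmbedding.subtypeVal h
  exact h2.measurableEmbedding

/-- The two laws are compared as measures on the ambient space of arrays, where characteristic
functions separate finite measures. Each functional there reduces to the diagonal by
`exists_diag_functional` and invariance. -/
lemma ConjInvariantMeasure.ext_of_diagChar {m₁ m₂ : Measure (Herm n)} [IsFiniteMeasure m₁]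
    [IsFiniteMeasure m₂] (h₁ : ConjInvariantMeasure m₁) (h₂ : ConjInvariantMeasure m₂)
    (h : ∀ s, diagChar m₁ s = diagChar m₂ s) : m₁ = m₂ := by
  have he := measurableEmbedding_hermEntries (n := n)
  have key : m₁.map hermEntries =
      m₂.map hermEntries := by
    refine Measure.ext_of_charFunDual (funext fun L => ?_)
    obtain ⟨s, V, hV⟩ := exists_diag_functional L.toLinearMap
    have haux : ∀ m : Measure (Herm n), ConjInvariantMeasure m →
        charFunDual (m.map hermEntries) L = diagChar m s := by
      intro m hm
      rw [charFunDual_apply, he.integral_map]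
      conv_rhs => rw [← hm V]
      rw [diagChar, integral_map (continuous_conjBy V.1).aemeasurable
        (continuous_exp_diag s).measurable.aestronglyMeasurable]
      refine integral_congr_ae (Filter.Eventually.of_forall fun A => ?_)
      have := hV A
      simp only
      congr 1
      refine (congrArg (· * Complex.I) this).trans ?_
      simp only [Finset.sum_mul]
      exact Finset.sum_congr rfl fun j _ => by ring
    rw [haux m₁ h₁, haux m₂ h₂, h]
  rw [← he.comap_map m₁, ← he.comap_map m₂, key]

section Sums

variable {Ω : Type*} [MeasurableSpace Ω] {P : Measure Ω} {X Y : Ω → Herm n}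

lemma UnitarilyInvariant.conjInvariantMeasure (hX : Measurable X)
    (h : UnitarilyInvariant P X) : ConjInvariantMeasure (P.map X) := by
  intro U
  rw [Measure.map_map (continuous_conjBy U.1).measurable hX]
  exact (h U.1 U.2).map_eq

/-- Conjugation by a matrix as an additive homomorphism. -/
noncomputable def conjByHom (U : Matrix (Fin n) (Fin n) ℂ) : Herm n →+ Herm n where
  toFun := conjBy U
  map_zero' := Subtype.ext (by simp [conjBy_val])
  map_add' A B := Subtype.ext (by
    rw [AddSubgroup.coe_add, conjBy_val, conjBy_val, conjBy_val, AddSubgroup.coe_add, mul_add,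
      add_mul])

lemma conjInvariantMeasure_add [IsProbabilityMeasure P] (hX : Measurable X) (hY : Measurable Y)
    (hXY : IndepFun X Y P) (hXi : UnitarilyInvariant P X) (hYi : UnitarilyInvariant P Y) :
    ConjInvariantMeasure (P.map fun ω => X ω + Y ω) := by
  intro U
  have h1 : P.map (fun ω => X ω + Y ω) = (P.map X).conv (P.map Y) :=
    hXY.map_add_eq_map_conv_map hX hY
  rw [h1]
  have h2 := Measure.map_conv_addMonoidHom (M := Herm n) (M' := Herm n) (μ := P.map X)
    (ν := P.map Y) (conjByHom U.1) (continuous_conjBy U.1).measurable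
  refine h2.trans ?_
  congr 1
  · exact hXi.conjInvariantMeasure hX U
  · exact hYi.conjInvariantMeasure hY U

lemma diagChar_add (hX : Measurable X) (hY : Measurable Y) (hXY : IndepFun X Y P)
    (s : Fin n → ℝ) :
    diagChar (P.map fun ω => X ω + Y ω) s = diagChar (P.map X) s * diagChar (P.map Y) s := by
  have hc := (continuous_exp_diag (n := n) s).measurable
  have hm : ∀ m : Measure (Herm n), AEStronglyMeasurable
      (fun A : Herm n => Complex.exp (∑ j, (s j * Complex.I) * A.1 j j)) m :=
    fun m => hc.aestronglyMeasurable
  rw [diagChar, diagChar, diagChar, integral_map (hX.fun_add hY).aemeasurable (hm _),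
    integral_map hX.aemeasurable (hm _), integral_map hY.aemeasurable (hm _)]
  have h := (hXY.comp hc hc).integral_fun_mul_eq_mul_integral
    (hc.comp hX).aestronglyMeasurable (hc.comp hY).aestronglyMeasurable
  rw [Function.comp_def, Function.comp_def] at h
  rw [← h]
  refine integral_congr_ae (Filter.Eventually.of_forall fun ω => ?_)
  simp only
  rw [← Complex.exp_add, ← Finset.sum_add_distrib]
  congr 1
  refine Finset.sum_congr rfl fun j _ => ?_
  rw [AddSubgroup.coe_add, Matrix.add_apply, mul_add]

end Sums

end CharacteristicFunctions

/-! ### Absolutely continuous derivatives, convolution and Fourier transform. -/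

section DerivativeChains

lemma intervalIntegral_integral_comm {E : Type*} [NormedAddCommGroup E] [NormedSpace ℝ E]
    {F : ℝ → ℝ → E} {a b : ℝ} (hF : Integrable (Function.uncurry F)
      ((volume.restrict (Set.uIoc a b)).prod volume)) :
    ∫ x in a..b, ∫ y, F x y = ∫ y, ∫ x in a..b, F x y := by
  rcases le_total a b with h | h
  · simp only [intervalIntegral.integral_of_le h]
    rw [Set.uIoc_of_le h] at hF
    exact integral_integral_swap hF
  · simp only [intervalIntegral.integral_of_ge h, integral_neg]
    rw [Set.uIoc_of_ge h] at hF
    rw [integral_integral_swap hF]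

lemma integrable_pow_mul_of_weighted {m j : ℕ} {f : ℝ → ℝ}
    (h : Integrable fun x => (1 + |x|) ^ m * f x) (hj : j ≤ m) :
    Integrable fun x => x ^ j * f x := by
  have hpos : ∀ x : ℝ, 0 < (1 + |x|) ^ m := fun x => by positivity
  have h1 : Integrable fun x : ℝ => (x ^ j * ((1 + |x|) ^ m)⁻¹) * ((1 + |x|) ^ m * f x) := by
    refine h.bdd_mul (c := 1) ?_ (Filter.Eventually.of_forall fun x => ?_)
    · refine Continuous.aestronglyMeasurable ?_
      exact (continuous_pow j).mul
        (((continuous_const.add continuous_abs).pow m).inv₀ fun x => (hpos x).ne')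
    · rw [norm_mul, norm_inv, norm_pow, Real.norm_eq_abs, Real.norm_of_nonneg (hpos x).le,
        ← div_eq_mul_inv, div_le_one (hpos x)]
      exact (pow_le_pow_left₀ (abs_nonneg x) (by linarith) j).trans
        (pow_le_pow_right₀ (by linarith [abs_nonneg x]) hj)
  refine h1.congr (Filter.Eventually.of_forall fun x => ?_)
  have := (hpos x).ne'
  simp only
  field_simp

lemma integrable_of_weighted {m : ℕ} {f : ℝ → ℝ}
    (h : Integrable fun x => (1 + |x|) ^ m * f x) : Integrable f := by
  simpa using integrable_pow_mul_of_weighted h (Nat.zero_le m)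

/-- A sequence of functions in which each of the first `n` functions is the locally absolutely
continuous derivative of the one before, all of them integrable against `(1 + |x|) ^ (n - 1)`. -/
structure DerivChain (n : ℕ) (g : ℕ → ℝ → ℝ) : Prop where
  weighted : ∀ k, k < n → Integrable fun x => (1 + |x|) ^ (n - 1) * g k x
  sub_eq : ∀ k, k + 1 < n → ∀ a b, g k b - g k a = ∫ x in a..b, g (k + 1) x

variable {n : ℕ} {g : ℕ → ℝ → ℝ}

lemma DerivChain.integrable (h : DerivChain n g) {k : ℕ} (hk : k < n) : Integrable (g k) :=
  integrable_of_weighted (h.weighted k hk)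

lemma DerivChain.eq_add (h : DerivChain n g) {k : ℕ} (hk : k + 1 < n) (a : ℝ) :
    g k = fun x => g k a + ∫ t in a..x, g (k + 1) t := by
  funext x
  rw [← h.sub_eq k hk]
  ring

lemma DerivChain.continuous (h : DerivChain n g) {k : ℕ} (hk : k + 1 < n) : Continuous (g k) := by
  rw [h.eq_add hk 0]
  exact continuous_const.add ((h.integrable hk).continuous_primitive 0)

lemma DerivChain.norm_le (h : DerivChain n g) {k : ℕ} (hk : k + 1 < n) (x : ℝ) :
    ‖g k x‖ ≤ ‖g k 0‖ + ∫ t, ‖g (k + 1) t‖ := by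
  rw [h.eq_add hk 0]
  simp only [intervalIntegral.integral_same, add_zero]
  refine (norm_add_le _ _).trans (add_le_add_right ?_ _)
  refine intervalIntegral.norm_integral_le_integral_norm_uIoc.trans ?_
  exact setIntegral_le_integral (h.integrable hk).norm
    (Filter.Eventually.of_forall fun t => norm_nonneg _)

lemma DerivChain.ae_hasDerivAt (h : DerivChain n g) {k : ℕ} (hk : k + 1 < n) :
    ∀ᵐ x, HasDerivAt (g k) (g (k + 1) x) x := by
  filter_upwards [LocallyIntegrable.ae_hasDerivAt_integral (h.integrable hk).locallyIntegrable]
    with x hx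
  rw [h.eq_add hk 0]
  exact (hx 0).const_add _

lemma DerivChain.hasDerivAt (h : DerivChain n g) {k : ℕ} (hk : k + 2 < n) (x : ℝ) :
    HasDerivAt (g k) (g (k + 1) x) x := by
  have hk1 : k + 1 < n := Nat.lt_of_succ_lt hk
  rw [h.eq_add hk1 0]
  have hc := h.continuous hk
  exact (hc.integral_hasStrictDerivAt 0 x).hasDerivAt.const_add _

lemma DerivChain.iteratedDeriv_eq (h : DerivChain n g) {k : ℕ} (hk : k + 1 < n) :
    iteratedDeriv k (g 0) = g k := by
  induction k with
  | zero => exact iteratedDeriv_zero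
  | succ k ih =>
    rw [iteratedDeriv_succ, ih (Nat.lt_of_succ_lt hk)]
    exact funext fun x => (h.hasDerivAt hk x).deriv

/-- Equality everywhere is available only for `k + 1 < n`: the last function of a chain need not be
continuous, so it is a derivative only almost everywhere. -/
lemma DerivChain.iteratedDeriv_ae_eq (h : DerivChain n g) {k : ℕ} (hk : k < n) :
    iteratedDeriv k (g 0) =ᵐ[volume] g k := by
  cases k with
  | zero => rw [iteratedDeriv_zero]
  | succ k =>
    rw [iteratedDeriv_succ, h.iteratedDeriv_eq hk]
    filter_upwards [h.ae_hasDerivAt hk] with x hx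
    exact hx.deriv

lemma DerivChain.absolutelyContinuous (h : DerivChain n g) {k : ℕ} (hk : k + 1 < n) (a b : ℝ) :
    AbsolutelyContinuousOnInterval (g k) a b := by
  rw [h.eq_add hk a]
  have h1 := (h.integrable hk).intervalIntegrable
    (a := a) (b := b) |>.absolutelyContinuousOnInterval_intervalIntegral Set.left_mem_uIcc
  have h2 : AbsolutelyContinuousOnInterval (fun _ : ℝ => g k a) a b :=
    (LipschitzWith.const (g k a)).lipschitzOnWith.absolutelyContinuousOnInterval
  exact h2.add h1

lemma DerivChain.hasDerivativesBelow (h : DerivChain n g) : HasDerivativesBelow n (g 0) := by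
  intro k hk a b
  rw [h.iteratedDeriv_eq hk]
  exact h.absolutelyContinuous hk a b

lemma DerivChain.iteratedDeriv (h : DerivChain n g) :
    DerivChain n fun k => _root_.iteratedDeriv k (g 0) := by
  constructor
  · intro k hk
    refine (h.weighted k hk).congr ?_
    filter_upwards [h.iteratedDeriv_ae_eq hk] with x hx
    rw [hx]
  · intro k hk a b
    rw [h.iteratedDeriv_eq hk, h.sub_eq k hk]
    refine intervalIntegral.integral_congr_ae ?_
    filter_upwards [h.iteratedDeriv_ae_eq hk] with x hx _
    exact hx.symm

lemma HasDerivativesBelow.sub_eq {w : ℝ → ℝ} (h : HasDerivativesBelow n w) {k : ℕ}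
    (hk : k + 1 < n) (a b : ℝ) : _root_.iteratedDeriv k w b - _root_.iteratedDeriv k w a =
      ∫ x in a..b, _root_.iteratedDeriv (k + 1) w x := by
  rw [iteratedDeriv_succ, (h k hk a b).integral_deriv_eq_sub]

lemma HasDerivativesBelow.intervalIntegrable {w : ℝ → ℝ} (h : HasDerivativesBelow n w) {k : ℕ}
    (hk : k < n) (hn : 1 < n) (a b : ℝ) :
    IntervalIntegrable (_root_.iteratedDeriv k w) volume a b := by
  cases k with
  | zero => exact (h 0 (by omega) a b).continuousOn.intervalIntegrable
  | succ k =>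
    rw [iteratedDeriv_succ]
    exact (h k hk a b).intervalIntegrable_deriv

lemma conv_apply (f v : ℝ → ℝ) (x : ℝ) : conv f v x = ∫ t, f t * v (x - t) := rfl

lemma conv_apply_swap (f v : ℝ → ℝ) (x : ℝ) : conv f v x = ∫ y, f (x - y) * v y := by
  unfold conv
  rw [convolution_eq_swap]
  rfl

lemma integrable_conv_integrand {f v : ℝ → ℝ} (hf : Integrable f) (hv : Integrable v) :
    Integrable (fun p : ℝ × ℝ => f p.2 * v (p.1 - p.2)) (volume.prod volume) :=
  hf.convolution_integrand (ContinuousLinearMap.mul ℝ ℝ) hv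

/-- The weight is submultiplicative, `1 + |x| ≤ (1 + |t|) (1 + |x - t|)`, so Fubini applies to the
weighted integrand. -/
lemma weighted_conv {m : ℕ} {f v : ℝ → ℝ} (hf : Integrable fun x => (1 + |x|) ^ m * f x)
    (hv : Integrable fun x => (1 + |x|) ^ m * v x) :
    Integrable fun x => (1 + |x|) ^ m * conv f v x := by
  have hf0 := integrable_of_weighted hf
  have hv0 := integrable_of_weighted hv
  have h1 := integrable_conv_integrand hf hv
  have h2 : Integrable (fun p : ℝ × ℝ => (1 + |p.1|) ^ m * (f p.2 * v (p.1 - p.2)))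
      (volume.prod volume) := by
    refine h1.mono ?_ (Filter.Eventually.of_forall fun p => ?_)
    · refine AEStronglyMeasurable.mul ?_ (integrable_conv_integrand hf0 hv0).1
      exact ((continuous_const.add (continuous_abs.comp continuous_fst)).pow m).aestronglyMeasurable
    · have h3 : (1 + |p.1|) ≤ (1 + |p.2|) * (1 + |p.1 - p.2|) := by
        have : |p.1| ≤ |p.2| + |p.1 - p.2| := by
          calc |p.1| = |p.2 + (p.1 - p.2)| := by rw [add_sub_cancel]
            _ ≤ _ := abs_add_le _ _
        nlinarith [abs_nonneg p.2, abs_nonneg (p.1 - p.2)]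
      have h4 : (1 + |p.1|) ^ m ≤ (1 + |p.2|) ^ m * (1 + |p.1 - p.2|) ^ m := by
        rw [← mul_pow]
        exact pow_le_pow_left₀ (by positivity) h3 m
      have h5 : ∀ x : ℝ, ‖(1 + |x|) ^ m‖ = (1 + |x|) ^ m := fun x =>
        Real.norm_of_nonneg (by positivity)
      rw [norm_mul, norm_mul, norm_mul, norm_mul, norm_mul, h5, h5, h5]
      calc _ ≤ ((1 + |p.2|) ^ m * (1 + |p.1 - p.2|) ^ m) * (‖f p.2‖ * ‖v (p.1 - p.2)‖) :=
            mul_le_mul_of_nonneg_right h4 (by positivity)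
        _ = _ := by ring
  refine h2.integral_prod_left.congr (Filter.Eventually.of_forall fun x => ?_)
  simp only [conv_apply]
  exact integral_const_mul _ _

/-- All derivatives are placed on the first factor, so `v` needs integrability but no smoothness.
The fundamental theorem of calculus passes through the convolution by Fubini. -/
lemma DerivChain.conv (hg : DerivChain n g) {v : ℝ → ℝ}
    (hv : Integrable fun x => (1 + |x|) ^ (n - 1) * v x) :
    DerivChain n fun k => conv (g k) v := by
  have hv0 := integrable_of_weighted hv
  refine ⟨fun k hk => weighted_conv (hg.weighted k hk) hv, fun k hk a b => ?_⟩
  have hint : ∀ x, Integrable fun y => g k (x - y) * v y := by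
    intro x
    refine hv0.bdd_mul ?_ (Filter.Eventually.of_forall fun y => hg.norm_le hk (x - y))
    exact ((hg.continuous hk).comp (continuous_const.sub continuous_id)).aestronglyMeasurable
  have hprod : Integrable (Function.uncurry fun x y : ℝ => g (k + 1) (x - y) * v y)
      ((volume.restrict (Set.uIoc a b)).prod volume) := by
    have h1 : Integrable (fun p : ℝ × ℝ => v p.2 * g (k + 1) (p.1 - p.2))
      (volume.prod volume) := integrable_conv_integrand hv0 (hg.integrable hk)
    have h2 : Integrable (Function.uncurry fun x y : ℝ => g (k + 1) (x - y) * v y)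
        (volume.prod volume) := h1.congr (Filter.Eventually.of_forall fun p => mul_comm _ _)
    refine h2.mono_measure ?_
    exact Measure.prod_mono Measure.restrict_le_self le_rfl
  simp only [conv_apply_swap]
  rw [intervalIntegral_integral_comm hprod, ← integral_sub (hint b) (hint a)]
  refine integral_congr_ae (Filter.Eventually.of_forall fun y => ?_)
  simp only
  rw [intervalIntegral.integral_mul_const, ← sub_mul, hg.sub_eq k hk,
    intervalIntegral.integral_comp_sub_right]

/-- The Fourier transform of a function on the line. -/
noncomputable def lineChar (f : ℝ → ℝ) (s : ℝ) : ℂ := 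
  ∫ x : ℝ, Complex.exp (s * x * Complex.I) * f x

lemma norm_exp_mul_mul_I (s x : ℝ) : ‖Complex.exp (s * x * Complex.I)‖ = 1 := by
  rw [← Complex.ofReal_mul, Complex.norm_exp_ofReal_mul_I]

lemma continuous_exp_mul_mul_I (s : ℝ) :
    Continuous fun x : ℝ => Complex.exp (s * x * Complex.I) := by fun_prop

lemma integrable_exp_mul {f : ℝ → ℝ} (hf : Integrable f) (s : ℝ) :
    Integrable fun x : ℝ => Complex.exp (s * x * Complex.I) * f x :=
  hf.ofReal.bdd_mul (c := 1) (continuous_exp_mul_mul_I s).aestronglyMeasurable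
    (Filter.Eventually.of_forall fun x => (norm_exp_mul_mul_I s x).le)

lemma continuous_lineChar {f : ℝ → ℝ} (hf : Integrable f) : Continuous (lineChar f) := by
  refine continuous_of_dominated (bound := fun x => ‖f x‖) (fun s => (integrable_exp_mul hf s).1)
    (fun s => Filter.Eventually.of_forall fun x => ?_) hf.norm
    (Filter.Eventually.of_forall fun x => by fun_prop)
  rw [norm_mul, norm_exp_mul_mul_I, one_mul, Complex.norm_real]

lemma lineChar_zero (f : ℝ → ℝ) : lineChar f 0 = ((∫ x, f x : ℝ) : ℂ) := by
  unfold lineChar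
  rw [← integral_complex_ofReal]
  simp

lemma lineChar_comp_add (f : ℝ → ℝ) (s t : ℝ) :
    ∫ x : ℝ, Complex.exp (s * x * Complex.I) * f (x + t) =
      Complex.exp (-(s * Complex.I) * t) * lineChar f s := by
  rw [← integral_sub_right_eq_self _ t, lineChar, ← integral_const_mul]
  refine integral_congr_ae (Filter.Eventually.of_forall fun x => ?_)
  simp only [sub_add_cancel]
  rw [← mul_assoc, ← Complex.exp_add]
  congr 2
  push_cast
  ring

lemma exists_integral_exp_ne_zero (s : ℝ) :
    ∃ h : ℝ, ∫ t in (0 : ℝ)..h, Complex.exp (-(s * Complex.I) * t) ≠ 0 := by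
  by_cases hs : s = 0
  · exact ⟨1, by simp [hs]⟩
  · refine ⟨Real.pi / s, ?_⟩
    have hs' : (s : ℂ) ≠ 0 := Complex.ofReal_ne_zero.mpr hs
    have h1 : -(s * Complex.I) ≠ 0 := neg_ne_zero.mpr (mul_ne_zero hs' Complex.I_ne_zero)
    rw [integral_exp_mul_complex h1]
    have h2 : -(s * Complex.I) * ((Real.pi / s : ℝ) : ℂ) = -(Real.pi * Complex.I) := by
      push_cast
      field_simp
    rw [h2, Complex.exp_neg, Complex.exp_pi_mul_I]
    refine div_ne_zero ?_ h1
    norm_num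

/-- Boundary terms at infinity are avoided. Integrating the transform of the translates `g (k + 1)
(· + t)` over `t` from `0` to `r` in both orders gives `c * lineChar (g (k + 1)) s = (exp (-i s r) -
1) * lineChar (g k) s`, where the right-hand factor is `-i s c`. Choosing `r` with `c ≠ 0` allows
cancellation, also at `s = 0`. -/
lemma DerivChain.lineChar_succ (h : DerivChain n g) {k : ℕ} (hk : k + 1 < n) (s : ℝ) :
    lineChar (g (k + 1)) s = -(s * Complex.I) * lineChar (g k) s := by
  obtain ⟨r, hr⟩ := exists_integral_exp_ne_zero s
  set c : ℂ := ∫ t in (0 : ℝ)..r, Complex.exp (-(s * Complex.I) * t) with hc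
  have hk0 := h.integrable (Nat.lt_of_succ_lt hk)
  have hk1 := h.integrable hk
  have hexp : Complex.exp (-(s * Complex.I) * r) - 1 = -(s * Complex.I) * c := by
    by_cases hs : s = 0
    · simp [hs]
    · have h1 : -((s : ℂ) * Complex.I) ≠ 0 :=
        neg_ne_zero.mpr (mul_ne_zero (Complex.ofReal_ne_zero.mpr hs) Complex.I_ne_zero)
      rw [hc, integral_exp_mul_complex h1, mul_div_cancel₀ _ h1]
      simp
  have hprod : Integrable (Function.uncurry fun t x : ℝ =>
      Complex.exp (s * x * Complex.I) * g (k + 1) (x + t))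
      ((volume.restrict (Set.uIoc 0 r)).prod volume) := by
    have hm : AEStronglyMeasurable (fun p : ℝ × ℝ => g (k + 1) (p.2 + p.1))
        ((volume.restrict (Set.uIoc 0 r)).prod volume) := by
      simp only [add_comm]
      exact hk1.1.comp_quasiMeasurePreserving
        (quasiMeasurePreserving_add (volume.restrict (Set.uIoc (0 : ℝ) r)) (volume : Measure ℝ))
    refine (integrable_prod_iff ?_).mpr ⟨Filter.Eventually.of_forall fun t => ?_, ?_⟩
    · refine AEStronglyMeasurable.mul ?_ (Complex.continuous_ofReal.comp_aestronglyMeasurable hm)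
      exact ((continuous_exp_mul_mul_I s).comp continuous_snd).aestronglyMeasurable
    · exact integrable_exp_mul (hk1.comp_add_right t) s
    · have : ∀ t : ℝ, ∫ x : ℝ, ‖Complex.exp (s * x * Complex.I) * (g (k + 1) (x + t) : ℂ)‖ =
          ∫ x, ‖g (k + 1) x‖ := by
        intro t
        rw [← integral_add_right_eq_self (fun x => ‖g (k + 1) x‖) t]
        refine integral_congr_ae (Filter.Eventually.of_forall fun x => ?_)
        simp only
        rw [norm_mul, norm_exp_mul_mul_I, one_mul, Complex.norm_real]
      simp only [Function.uncurry_apply_pair, this]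
      exact integrableOn_const (by simp [Set.uIoc])
  have hswap := intervalIntegral_integral_comm hprod
  simp only [lineChar_comp_add] at hswap
  rw [intervalIntegral.integral_mul_const, ← hc] at hswap
  have hinner : ∀ x : ℝ,
      ∫ t in (0 : ℝ)..r, Complex.exp (s * x * Complex.I) * (g (k + 1) (x + t) : ℂ) =
      Complex.exp (s * x * Complex.I) * g k (x + r) - Complex.exp (s * x * Complex.I) * g k x := by
    intro x
    have h1 : ∫ t in (0 : ℝ)..r, g (k + 1) (x + t) = g k (x + r) - g k x := by
      rw [intervalIntegral.integral_comp_add_left, h.sub_eq k hk, add_zero]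
    rw [intervalIntegral.integral_const_mul, intervalIntegral.integral_ofReal, h1]
    push_cast
    ring
  simp only [hinner] at hswap
  rw [integral_sub (integrable_exp_mul (hk0.comp_add_right r) s) (integrable_exp_mul hk0 s),
    lineChar_comp_add] at hswap
  have h3 : c * lineChar (g (k + 1)) s = c * (-(s * Complex.I) * lineChar (g k) s) := by
    rw [hswap, ← mul_assoc, mul_comm c, ← hexp, sub_mul, one_mul, lineChar]
  exact mul_left_cancel₀ hr h3

lemma DerivChain.lineChar_eq (h : DerivChain n g) {k : ℕ} (hk : k < n) (s : ℝ) :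
    lineChar (g k) s = (-(s * Complex.I)) ^ k * lineChar (g 0) s := by
  induction k with
  | zero => simp
  | succ k ih => rw [h.lineChar_succ hk, ih (Nat.lt_of_succ_lt hk), pow_succ']; ring

lemma lineChar_conv {f v : ℝ → ℝ} (hf : Integrable f) (hv : Integrable v) (s : ℝ) :
    lineChar (conv f v) s = lineChar f s * lineChar v s := by
  have h := integral_convolution (ContinuousLinearMap.mul ℝ ℂ) (integrable_exp_mul hf s)
    (integrable_exp_mul hv s)
  rw [ContinuousLinearMap.mul_apply'] at h
  rw [lineChar, lineChar, lineChar, ← h]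
  refine integral_congr_ae (Filter.Eventually.of_forall fun x => ?_)
  simp only [convolution_def, ContinuousLinearMap.mul_apply', conv_apply]
  rw [← integral_complex_ofReal, ← integral_const_mul]
  refine integral_congr_ae (Filter.Eventually.of_forall fun t => ?_)
  have : Complex.exp (s * x * Complex.I) =
      Complex.exp (s * t * Complex.I) * Complex.exp (s * (x - t : ℝ) * Complex.I) := by
    rw [← Complex.exp_add]
    congr 1
    push_cast
    ring
  simp only
  rw [this]
  push_cast
  ring

end DerivativeChains

/-! ### Weighted integrability of the ensemble functions from that of the density. -/

section WeightedIntegrability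

lemma ae_integrable_update {m : ℕ} {D : (Fin (m + 1) → ℝ) → ℝ} (hD : Integrable D)
    (i : Fin (m + 1)) : ∀ᵐ x : Fin (m + 1) → ℝ, Integrable fun t => D (Function.update x i t) := by
  have hp := volume_preserving_piFinSuccAbove (fun _ : Fin (m + 1) => ℝ) i
  have h1 : Integrable (D ∘ (MeasurableEquiv.piFinSuccAbove (fun _ => ℝ) i).symm)
      (volume : Measure (ℝ × (Fin m → ℝ))) :=
    (hp.symm.integrable_comp_emb (MeasurableEquiv.measurableEmbedding _)).mpr hD
  have h2 := Integrable.prod_left_ae h1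
  have h3 : ∀ᵐ p : ℝ × (Fin m → ℝ), Integrable fun t =>
      D ((MeasurableEquiv.piFinSuccAbove (fun _ => ℝ) i).symm (t, p.2)) :=
    Measure.quasiMeasurePreserving_snd.ae h2
  filter_upwards [hp.quasiMeasurePreserving.ae h3] with x hx
  refine hx.congr (Filter.Eventually.of_forall fun t => ?_)
  simp only
  congr 1
  rw [MeasurableEquiv.piFinSuccAbove_symm_apply, MeasurableEquiv.piFinSuccAbove_apply]
  exact Fin.insertNth_removeNth i t x

variable {n : ℕ}

lemma le_card_orderedPairs_filter (i : Fin n) :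
    n - 1 ≤ ((orderedPairs n).filter fun p => p.1 = i ∨ p.2 = i).card := by
  have h1 : (Finset.univ.erase i).card = n - 1 := by
    rw [Finset.card_erase_of_mem (Finset.mem_univ i), Finset.card_univ, Fintype.card_fin]
  rw [← h1]
  refine Finset.card_le_card_of_injOn (fun j => if i < j then (i, j) else (j, i)) ?_ ?_
  · intro j hj
    have hj' : j ≠ i := Finset.ne_of_mem_erase hj
    simp only [Finset.coe_filter, Set.mem_ofPred_eq, orderedPairs, Finset.mem_filter,
      Finset.mem_univ, true_and]
    split_ifs with h
    · exact ⟨h, Or.inl rfl⟩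
    · exact ⟨lt_of_le_of_ne (not_lt.mp h) hj', Or.inr rfl⟩
  · intro j hj k hk hjk
    have hj' : j ≠ i := Finset.ne_of_mem_erase hj
    have hk' : k ≠ i := Finset.ne_of_mem_erase hk
    simp only at hjk
    split_ifs at hjk with h1 h2 h2
    · exact (Prod.mk.inj hjk).2
    · exact absurd (Prod.mk.inj hjk).1 hk'.symm
    · exact absurd (Prod.mk.inj hjk).1 hj'
    · exact (Prod.mk.inj hjk).1

/-- Factors involving the index `i` grow linearly in `t`, and there are at least `n - 1` of them;
the others form the positive constant `c₀`. -/
lemma exists_le_abs_det_vandermonde_update {x : Fin n → ℝ} (hx : Function.Injective x)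
    (i : Fin n) : ∃ c : ℝ, 0 < c ∧ ∃ R : ℝ, ∀ t : ℝ, R ≤ |t| →
      c * (1 + |t|) ^ (n - 1) ≤ |(Matrix.vandermonde (Function.update x i t)).det| := by
  set q : Fin n × Fin n → Prop := fun p => p.1 = i ∨ p.2 = i with hq
  set N := ((orderedPairs n).filter q).card with hN
  set c₀ : ℝ := ∏ p ∈ (orderedPairs n).filter (fun p => ¬ q p), |x p.2 - x p.1| with hc₀
  have hc₀pos : 0 < c₀ := by
    refine Finset.prod_pos fun p hp => abs_pos.mpr (sub_ne_zero.mpr fun h => ?_)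
    have h1 := (Finset.mem_filter.mp hp).1
    simp only [orderedPairs, Finset.mem_filter, Finset.mem_univ, true_and] at h1
    exact h1.ne' (hx h)
  refine ⟨(1 / 4) ^ N * c₀, by positivity, 1 + 2 * ∑ j, |x j|, fun t ht => ?_⟩
  have hxj : ∀ j, |x j| ≤ ∑ j, |x j| := fun j =>
    Finset.single_le_sum (f := fun j => |x j|) (fun k _ => abs_nonneg _) (Finset.mem_univ j)
  have hfar : ∀ j, 1 / 4 * (1 + |t|) ≤ |t - x j| := by
    intro j
    have h1 := abs_sub_abs_le_abs_sub t (x j)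
    have h2 := hxj j
    have h3 := abs_nonneg (x j)
    linarith
  rw [det_vandermonde_eq_prod_orderedPairs, Finset.abs_prod,
    ← Finset.prod_filter_mul_prod_filter_not _ q]
  have h1 : (1 / 4 * (1 + |t|)) ^ N ≤ ∏ p ∈ (orderedPairs n).filter q,
      |Function.update x i t p.2 - Function.update x i t p.1| := by
    rw [hN, ← Finset.prod_const]
    refine Finset.prod_le_prod (fun p _ => by positivity) fun p hp => ?_
    obtain ⟨hp1, hp2⟩ := Finset.mem_filter.mp hp
    simp only [orderedPairs, Finset.mem_filter, Finset.mem_univ, true_and] at hp1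
    rcases hp2 with h | h
    · rw [← h, Function.update_self, Function.update_of_ne hp1.ne', abs_sub_comm]
      exact hfar _
    · rw [← h, Function.update_self, Function.update_of_ne hp1.ne]
      exact hfar _
  have h2 : ∏ p ∈ (orderedPairs n).filter (fun p => ¬ q p),
      |Function.update x i t p.2 - Function.update x i t p.1| = c₀ := by
    refine Finset.prod_congr rfl fun p hp => ?_
    have h3 := (Finset.mem_filter.mp hp).2
    rw [hq, not_or] at h3
    rw [Function.update_of_ne h3.1, Function.update_of_ne h3.2]
  rw [h2]
  have h4 : (1 + |t|) ^ (n - 1) ≤ (1 + |t|) ^ N :=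
    pow_le_pow_right₀ (by linarith [abs_nonneg t]) (le_card_orderedPairs_filter i)
  calc (1 / 4) ^ N * c₀ * (1 + |t|) ^ (n - 1) ≤ (1 / 4) ^ N * c₀ * (1 + |t|) ^ N :=
        mul_le_mul_of_nonneg_left h4 (by positivity)
    _ = (1 / 4 * (1 + |t|)) ^ N * c₀ := by rw [mul_pow]; ring
    _ ≤ _ := mul_le_mul_of_nonneg_right h1 hc₀pos.le

lemma polyDensity_update (v : Fin n → ℝ → ℝ) (Z : ℝ) (x : Fin n → ℝ) (i : Fin n) (t : ℝ) :
    polyDensity v Z (Function.update x i t) =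
      Z⁻¹ * (Matrix.vandermonde (Function.update x i t)).det *
        ((Matrix.of fun j k => v k (x j)).updateRow i fun k => v k t).det := by
  rw [polyDensity]
  congr 2
  ext j k
  by_cases h : j = i
  · subst h; simp
  · simp [Matrix.updateRow_ne h, Function.update_of_ne h]

/-- Moving one coordinate of a good point `x` gives integrable sections, equal to a Vandermonde
factor of growth `|t|^m` times a combination `h i` of the `v k`. Thus each `h i` is integrable with
the weight, and Cramer's rule recovers each `v k` from the `h i`. -/
lemma weighted_of_integrable_polyDensity {m : ℕ} {v : Fin (m + 1) → ℝ → ℝ} {Z : ℝ} (hZ : Z ≠ 0)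
    (hloc : ∀ k a b, IntervalIntegrable (v k) volume a b) (hv : ∀ k, AEMeasurable (v k) volume)
    (hD : Integrable (polyDensity v Z)) (h0 : ¬ polyDensity v Z =ᵐ[volume] 0) (k : Fin (m + 1)) :
    Integrable fun x => (1 + |x|) ^ m * v k x := by
  obtain ⟨x, hx0, hxi⟩ : ∃ x, polyDensity v Z x ≠ 0 ∧
      ∀ i, Integrable fun t => polyDensity v Z (Function.update x i t) := by
    have h1 : ∃ᶠ x in ae (volume : Measure (Fin (m + 1) → ℝ)), polyDensity v Z x ≠ 0 :=
      Filter.not_eventually.mp h0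
    exact (h1.and_eventually (ae_all_iff.mpr fun i => ae_integrable_update hD i)).exists
  set M : Matrix (Fin (m + 1)) (Fin (m + 1)) ℝ := Matrix.of fun j k => v k (x j) with hM
  have hdet : M.det ≠ 0 := right_ne_zero_of_mul hx0
  have hinj : Function.Injective x :=
    Matrix.det_vandermonde_ne_zero_iff.mp (right_ne_zero_of_mul (left_ne_zero_of_mul hx0))
  set h : Fin (m + 1) → ℝ → ℝ := fun i t => (M.updateRow i fun k => v k t).det with hh
  have hsum : ∀ i t, h i t = ∑ k, M.transpose.adjugate i k * v k t := by
    intro i t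
    rw [hh]
    simp only
    rw [← Matrix.cramer_transpose_apply, Matrix.cramer_eq_adjugate_mulVec]
    rfl
  have hcr : ∀ t, v k t = M.det⁻¹ * ∑ i, M i k * h i t := by
    intro t
    have h1 := congrFun (Matrix.mulVec_cramer M.transpose fun k => v k t) k
    simp only [Matrix.mulVec, dotProduct, Matrix.cramer_transpose_apply, Matrix.transpose_apply,
      Matrix.det_transpose, Pi.smul_apply, smul_eq_mul] at h1
    rw [eq_inv_mul_iff_mul_eq₀ hdet, ← h1]
  have hmeas : ∀ i, AEStronglyMeasurable (fun t => (1 + |t|) ^ m * h i t) volume := by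
    intro i
    simp only [hsum]
    refine AEStronglyMeasurable.mul
      ((continuous_const.add continuous_abs).pow m).aestronglyMeasurable ?_
    refine Finset.aestronglyMeasurable_fun_sum _ fun k _ => ?_
    exact (hv k).aestronglyMeasurable.const_mul _
  have hmain : ∀ i, Integrable fun t => (1 + |t|) ^ m * h i t := by
    intro i
    obtain ⟨c, hc, R, hR⟩ := exists_le_abs_det_vandermonde_update hinj i
    -- Near the other points the Vandermonde factor may vanish and bounds nothing, so local
    -- integrability is used on a compact interval.
    have hI : IntegrableOn (fun t => (1 + |t|) ^ m * h i t) (Set.Icc (-|R|) |R|) := by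
      rw [← intervalIntegrable_iff_integrableOn_Icc_of_le (by linarith [abs_nonneg R])]
      refine IntervalIntegrable.continuousOn_mul ?_
        ((continuous_const.add continuous_abs).pow m).continuousOn
      rw [funext (hsum i)]
      have hs : IntervalIntegrable (∑ k, fun t => M.transpose.adjugate i k * v k t) volume
          (-|R|) |R| := IntervalIntegrable.sum _ fun k _ => (hloc k _ _).const_mul _
      rwa [Finset.sum_fn] at hs
    refine (((hxi i).norm.const_mul (c⁻¹ * |Z|)).add
      (IntegrableOn.integrable_indicator hI.norm measurableSet_Icc)).mono' (hmeas i)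
      (Filter.Eventually.of_forall fun t => ?_)
    simp only [Pi.add_apply]
    by_cases ht : t ∈ Set.Icc (-|R|) |R|
    · rw [Set.indicator_of_mem ht]
      exact le_add_of_nonneg_left (by positivity)
    · rw [Set.indicator_of_notMem ht, add_zero]
      have ht2 : R ≤ |t| := by
        rw [Set.mem_Icc, ← abs_le, not_le] at ht
        exact (le_abs_self R).trans ht.le
      have h1 := hR t ht2
      rw [Nat.add_sub_cancel] at h1
      have h3 : (1 + |t|) ^ m ≤ c⁻¹ * |(Matrix.vandermonde (Function.update x i t)).det| := by
        rw [le_inv_mul_iff₀ hc]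
        exact h1
      rw [polyDensity_update, norm_mul, norm_mul, norm_mul, Real.norm_of_nonneg (by positivity),
        norm_inv, Real.norm_eq_abs Z, Real.norm_eq_abs (Matrix.det _)]
      have hZ' : |Z| ≠ 0 := abs_ne_zero.mpr hZ
      calc (1 + |t|) ^ m * ‖h i t‖ ≤
            (c⁻¹ * |(Matrix.vandermonde (Function.update x i t)).det|) * ‖h i t‖ :=
            mul_le_mul_of_nonneg_right h3 (norm_nonneg _)
        _ = c⁻¹ * |Z| * (|Z|⁻¹ * |(Matrix.vandermonde (Function.update x i t)).det| * ‖h i t‖) := by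
            field_simp
  have h5 := (integrable_finsetSum Finset.univ fun i _ =>
    (hmain i).const_mul (M i k)).const_mul M.det⁻¹
  refine h5.congr (Filter.Eventually.of_forall fun t => ?_)
  simp only [hcr t, Finset.mul_sum]
  exact Finset.sum_congr rfl fun i _ => by ring

/-- For `n = 1` the regularity condition is empty, so local integrability must come from the
density, which is then a multiple of `v 0`. -/
lemma intervalIntegrable_of_integrable_polyDensity_one {v : Fin 1 → ℝ → ℝ} {Z : ℝ} (hZ : Z ≠ 0)
    (hD : Integrable (polyDensity v Z)) (a b : ℝ) : IntervalIntegrable (v 0) volume a b := by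
  obtain ⟨x, hx⟩ := (ae_integrable_update (m := 0) hD 0).exists
  have h1 := hx.const_mul Z
  refine (h1.congr (Filter.Eventually.of_forall fun t => ?_)).intervalIntegrable
  simp only
  rw [polyDensity, Matrix.det_fin_one, Matrix.det_fin_one, Matrix.vandermonde_apply]
  simp [hZ]

lemma aemeasurable_polyDensity {v : Fin n → ℝ → ℝ} (hv : ∀ k, AEMeasurable (v k) volume) (Z : ℝ) :
    AEMeasurable (polyDensity v Z) (volume : Measure (Fin n → ℝ)) := by
  have h1 : ∀ k j, AEMeasurable (fun x : Fin n → ℝ => v k (x j)) volume := fun k j =>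
    (hv k).comp_quasiMeasurePreserving
      (Measure.quasiMeasurePreserving_eval (fun _ : Fin n => (volume : Measure ℝ)) j)
  unfold polyDensity
  refine AEMeasurable.mul (AEMeasurable.const_mul ?_ _) ?_
  · refine Continuous.aemeasurable (Continuous.matrix_det ?_)
    exact continuous_pi fun j => continuous_pi fun k => (continuous_apply j).pow _
  · simp only [Matrix.det_apply', Matrix.of_apply]
    refine Finset.aemeasurable_fun_sum _ fun σ _ => AEMeasurable.const_mul ?_ _
    exact Finset.aemeasurable_fun_prod _ fun j _ => h1 _ _

lemma symLaw_univ (m : Measure (Herm n)) : symLaw m Set.univ = m Set.univ := by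
  rw [symLaw_apply _ MeasurableSet.univ]
  simp only [Set.preimage_univ]
  exact inv_factorial_mul_sum_const _

variable {Ω : Type*} [MeasurableSpace Ω] {P : Measure Ω} {X : Ω → Herm n}

lemma eigenvalueLaw_univ [IsProbabilityMeasure P] (hX : Measurable X) :
    eigenvalueLaw P X Set.univ = 1 := by
  rw [eigenvalueLaw_eq_symLaw P hX, symLaw_univ, Measure.map_apply hX MeasurableSet.univ,
    Set.preimage_univ, measure_univ]

lemma integrable_of_eigenvalueLaw [IsProbabilityMeasure P] (hX : Measurable X)
    {D : (Fin n → ℝ) → ℝ} (hm : AEMeasurable D volume) (h0 : ∀ᵐ x, 0 ≤ D x)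
    (hlaw : eigenvalueLaw P X = volume.withDensity fun x => ENNReal.ofReal (D x)) :
    Integrable D ∧ ¬ D =ᵐ[volume] 0 := by
  have h1 := eigenvalueLaw_univ (P := P) hX
  rw [hlaw, withDensity_apply _ MeasurableSet.univ, Measure.restrict_univ] at h1
  refine ⟨⟨hm.aestronglyMeasurable, ?_⟩, fun h => ?_⟩
  · rw [hasFiniteIntegral_iff_ofReal h0, h1]
    exact ENNReal.one_lt_top
  · have h2 : ∫⁻ x, ENNReal.ofReal (D x) = 0 := by
      rw [lintegral_congr_ae (g := fun _ => 0)]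
      · simp
      · filter_upwards [h] with x hx
        simp [hx]
    rw [h2] at h1
    exact zero_ne_one h1

lemma IsDPE.derivChain [IsProbabilityMeasure P] (hn : 0 < n) (hX : Measurable X) {w : ℝ → ℝ}
    (h : IsDPE P X w) : DerivChain n fun k => iteratedDeriv k w := by
  obtain ⟨hder, hv, Z, hZ, hnonneg, hlaw⟩ := h
  obtain ⟨hD, hne⟩ := integrable_of_eigenvalueLaw hX (aemeasurable_polyDensity hv Z) hnonneg hlaw
  refine ⟨fun k hk => ?_, fun k hk a b => hder.sub_eq hk a b⟩
  obtain ⟨m, rfl⟩ := Nat.exists_eq_succ_of_ne_zero hn.ne'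
  refine weighted_of_integrable_polyDensity hZ (fun j a b => ?_) hv hD hne ⟨k, hk⟩
  rcases Nat.eq_zero_or_pos m with h0 | h0
  · subst h0
    have hj : j = 0 := Fin.ext (by omega)
    subst hj
    exact intervalIntegrable_of_integrable_polyDensity_one hZ hD a b
  · exact hder.intervalIntegrable j.2 (by omega) a b

end WeightedIntegrability

/-! ### Andréief's integral identity. -/

section Andreief

variable {n : ℕ} {𝕜 : Type*} [RCLike 𝕜]

lemma det_mul_det_eq_sum (a b : Fin n → ℝ → 𝕜) (x : Fin n → ℝ) :
    (Matrix.of fun i j => a i (x j)).det * (Matrix.of fun j k => b k (x j)).det =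
      ∑ τ : Equiv.Perm (Fin n), ∑ σ : Equiv.Perm (Fin n),
        (((Equiv.Perm.sign τ : ℤ) : 𝕜) * ((Equiv.Perm.sign σ : ℤ) : 𝕜)) *
          ∏ j, (a (σ j) (x j) * b (τ j) (x j)) := by
  rw [← Matrix.det_transpose (Matrix.of fun j k => b k (x j)), Matrix.det_apply', Matrix.det_apply',
    mul_comm, Finset.sum_mul_sum]
  refine Finset.sum_congr rfl fun τ _ => Finset.sum_congr rfl fun σ _ => ?_
  simp only [Finset.prod_mul_distrib, Matrix.transpose_apply, Matrix.of_apply]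
  ring

lemma sum_sum_prod_eq_det (M : Matrix (Fin n) (Fin n) 𝕜) :
    ∑ τ : Equiv.Perm (Fin n), ∑ σ : Equiv.Perm (Fin n),
      (((Equiv.Perm.sign τ : ℤ) : 𝕜) * ((Equiv.Perm.sign σ : ℤ) : 𝕜)) * ∏ j, M (σ j) (τ j) =
      n ! * M.det := by
  have h : ∀ τ : Equiv.Perm (Fin n), ∑ σ : Equiv.Perm (Fin n),
      (((Equiv.Perm.sign τ : ℤ) : 𝕜) * ((Equiv.Perm.sign σ : ℤ) : 𝕜)) * ∏ j, M (σ j) (τ j) =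
      M.det := by
    intro τ
    have h1 := Matrix.det_permute' τ M
    rw [Matrix.det_apply'] at h1
    simp only [Matrix.submatrix_apply, id_eq] at h1
    simp only [mul_assoc]
    rw [← Finset.mul_sum, h1, ← mul_assoc]
    have h2 : ((Equiv.Perm.sign τ : ℤ) : 𝕜) * ((Equiv.Perm.sign τ : ℤ) : 𝕜) = 1 := by
      rw [← Int.cast_mul, ← Units.val_mul, Int.units_mul_self]
      simp
    rw [h2, one_mul]
  rw [Finset.sum_congr rfl fun τ _ => h τ, Finset.sum_const, Finset.card_univ, Fintype.card_perm,
    Fintype.card_fin, nsmul_eq_mul]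

lemma integrable_det_mul_det {a b : Fin n → ℝ → 𝕜}
    (h : ∀ i k, Integrable fun t => a i t * b k t) :
    Integrable fun x : Fin n → ℝ =>
      (Matrix.of fun i j => a i (x j)).det * (Matrix.of fun j k => b k (x j)).det := by
  simp only [det_mul_det_eq_sum]
  refine integrable_finsetSum _ fun τ _ => integrable_finsetSum _ fun σ _ => Integrable.const_mul ?_ _
  exact Integrable.fintype_prod (f := fun j t => a (σ j) t * b (τ j) t) fun j => h _ _

/-- Andréief's identity. -/
lemma integral_det_mul_det {a b : Fin n → ℝ → 𝕜}
    (h : ∀ i k, Integrable fun t => a i t * b k t) :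
    ∫ x : Fin n → ℝ, (Matrix.of fun i j => a i (x j)).det * (Matrix.of fun j k => b k (x j)).det =
      n ! * (Matrix.of fun i k => ∫ t, a i t * b k t).det := by
  have hint : ∀ τ σ : Equiv.Perm (Fin n), Integrable fun x : Fin n → ℝ =>
      (((Equiv.Perm.sign τ : ℤ) : 𝕜) * ((Equiv.Perm.sign σ : ℤ) : 𝕜)) *
          ∏ j, (a (σ j) (x j) * b (τ j) (x j)) := fun τ σ =>
    Integrable.const_mul
      (Integrable.fintype_prod (f := fun j t => a (σ j) t * b (τ j) t) fun j => h _ _) _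
  simp only [det_mul_det_eq_sum]
  rw [integral_finsetSum _ fun τ _ => integrable_finsetSum _ fun σ _ => hint τ σ,
    ← sum_sum_prod_eq_det]
  refine Finset.sum_congr rfl fun τ _ => ?_
  rw [integral_finsetSum _ fun σ _ => hint τ σ]
  refine Finset.sum_congr rfl fun σ _ => ?_
  rw [integral_const_mul,
    integral_fintype_prod_volume_eq_prod (fun j t => a (σ j) t * b (τ j) t)]
  rfl

end Andreief

/-! ### Characteristic function of a polynomial ensemble of derivative type. -/

section DensityCharacteristicFunction

variable {n : ℕ} {g : ℕ → ℝ → ℝ}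

/-- Expanding both determinants leaves products of `t^i g k t` with `i ≤ n - 1`, which the weight
`(1 + |t|)^(n-1)` controls. -/
lemma DerivChain.integrable_polyDensity (h : DerivChain n g) (Z : ℝ) :
    Integrable (polyDensity (fun k : Fin n => g k) Z) := by
  have h1 := (integrable_det_mul_det (𝕜 := ℝ) (n := n) (a := fun i t => t ^ (i : ℕ))
    (b := fun k => g k) fun i k =>
      integrable_pow_mul_of_weighted (h.weighted k k.2) (Nat.le_sub_one_of_lt i.2)).const_mul Z⁻¹
  refine h1.congr (Filter.Eventually.of_forall fun x => ?_)
  simp only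
  rw [polyDensity, ← Matrix.det_transpose (Matrix.vandermonde x), mul_assoc]
  rfl

/-- The constant relating the characteristic function of a polynomial ensemble of derivative type
to the Fourier transform of its weight. -/
noncomputable def ensembleConst (n : ℕ) : ℂ := vdmConst n * ∏ _p ∈ orderedPairs n, (-1 : ℂ)

lemma det_vandermonde_neg (v : Fin n → ℂ) : (Matrix.vandermonde fun i => -v i).det =
    (∏ _p ∈ orderedPairs n, (-1 : ℂ)) * (Matrix.vandermonde v).det := by
  rw [det_vandermonde_eq_prod_orderedPairs, det_vandermonde_eq_prod_orderedPairs,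
    ← Finset.prod_mul_distrib]
  exact Finset.prod_congr rfl fun p _ => by ring

lemma trace_diagHerm_pow (x : Fin n → ℝ) (m : ℕ) :
    ((diagHerm x).1 ^ m).trace = ∑ i, ((x i : ℂ)) ^ m := by
  rw [diagHerm, Matrix.diagonal_pow, Matrix.trace_diagonal]
  rfl

/-- The HCIZ formula absorbs the Vandermonde factor of the density, leaving a product of two
determinants to which Andréief's identity applies. Clearing the denominator in `s` keeps the
identity valid for coinciding `s i`. -/
lemma orbitChar_mul_polyDensity (v : Fin n → ℝ → ℝ) (Z : ℝ) (s x : Fin n → ℝ) :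
    (n ! * (Matrix.vandermonde fun i => (s i : ℂ) * Complex.I).det) *
      (orbitChar s x * (polyDensity v Z x : ℂ)) =
    (vdmConst n * (Z : ℂ)⁻¹) *
      ((Matrix.of fun i j => Complex.exp (s i * x j * Complex.I)).det *
        (Matrix.of fun j k => (v k (x j) : ℂ)).det) := by
  have h := hciz_formula (trace_diagHerm_pow x) (fun i => (s i : ℂ) * Complex.I)
  have h1 : ((Matrix.vandermonde x).det : ℂ) = (Matrix.vandermonde fun i => (x i : ℂ)).det := by
    refine (Complex.ofRealHom.map_det _).trans (congrArg Matrix.det ?_)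
    ext i j
    simp [Matrix.vandermonde_apply]
  have h2 : ((Matrix.of fun j k => v k (x j)).det : ℂ) =
      (Matrix.of fun j k => (v k (x j) : ℂ)).det := Complex.ofRealHom.map_det _
  have h3 : (Matrix.of fun i j => Complex.exp ((s i : ℂ) * Complex.I * x j)) =
      Matrix.of fun i j => Complex.exp (s i * x j * Complex.I) := by
    ext i j
    rw [Matrix.of_apply, Matrix.of_apply, mul_right_comm]
  rw [h3] at h
  rw [polyDensity, Complex.ofReal_mul, Complex.ofReal_mul, h1, h2, Complex.ofReal_inv, orbitChar]
  linear_combination ((Z : ℂ)⁻¹ * (Matrix.of fun j k => (v k (x j) : ℂ)).det) * h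

/-- The transform of `g k` is `(-i s)^k` times that of `g 0`, so Andréief's determinant is a
Vandermonde determinant in `-i s` times a product; distinct `s i` permit division by it. -/
lemma DerivChain.integral_orbitChar_mul_of_injective (h : DerivChain n g) (Z : ℝ) {s : Fin n → ℝ}
    (hs : Function.Injective s) :
    ∫ x, orbitChar s x * (polyDensity (fun k : Fin n => g k) Z x : ℂ) =
      (Z : ℂ)⁻¹ * ensembleConst n * ∏ i, lineChar (g 0) (s i) := by
  set V := (Matrix.vandermonde fun i => (s i : ℂ) * Complex.I).det with hV
  have hV0 : V ≠ 0 := Matrix.det_vandermonde_ne_zero_iff.mpr fun i j hij =>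
    hs (Complex.ofReal_injective (mul_right_cancel₀ Complex.I_ne_zero hij))
  have hn0 : (n ! : ℂ) ≠ 0 := Nat.cast_ne_zero.mpr (Nat.factorial_ne_zero n)
  have hA := integral_det_mul_det (𝕜 := ℂ) (n := n)
    (a := fun i t => Complex.exp (s i * t * Complex.I)) (b := fun k t => (g k t : ℂ))
    fun i k => integrable_exp_mul (h.integrable k.2) (s i)
  have hdet : (Matrix.of fun i k : Fin n =>
      ∫ t : ℝ, Complex.exp (s i * t * Complex.I) * (g k t : ℂ)).det =
      (∏ i, lineChar (g 0) (s i)) * ((∏ _p ∈ orderedPairs n, (-1 : ℂ)) * V) := by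
    rw [hV, ← det_vandermonde_neg, ← Matrix.det_mul_column]
    congr 1
    ext i k
    rw [Matrix.of_apply, Matrix.of_apply, Matrix.vandermonde_apply, mul_comm]
    exact h.lineChar_eq k.2 (s i)
  rw [hdet] at hA
  have hI : (n ! * V) * ∫ x, orbitChar s x * (polyDensity (fun k : Fin n => g k) Z x : ℂ) =
      (vdmConst n * (Z : ℂ)⁻¹) *
        (n ! * ((∏ i, lineChar (g 0) (s i)) * ((∏ _p ∈ orderedPairs n, (-1 : ℂ)) * V))) := by
    rw [← hA, ← integral_const_mul, ← integral_const_mul]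
    exact integral_congr_ae (Filter.Eventually.of_forall fun x =>
      orbitChar_mul_polyDensity (fun k : Fin n => g k) Z s x)
  refine mul_left_cancel₀ (mul_ne_zero hn0 hV0) ?_
  rw [hI, ensembleConst]
  ring

lemma eventually_injective_add_smul (s : Fin n → ℝ) :
    ∀ᶠ ε in nhdsWithin (0 : ℝ) {0}ᶜ, Function.Injective fun i : Fin n => s i + ε * ((i : ℕ) : ℝ) := by
  have h : ∀ p : Fin n × Fin n, ∀ᶠ ε in nhdsWithin (0 : ℝ) {0}ᶜ, p.1 ≠ p.2 →
      s p.1 + ε * ((p.1 : ℕ) : ℝ) ≠ s p.2 + ε * ((p.2 : ℕ) : ℝ) := by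
    rintro ⟨i, j⟩
    by_cases hs : s i = s j
    · filter_upwards [self_mem_nhdsWithin] with ε hε hij heq
      simp only [hs, add_right_inj] at heq
      exact hij (Fin.ext (Nat.cast_injective (mul_left_cancel₀ hε heq)))
    · have hc : ContinuousAt (fun ε : ℝ => s i + ε * ((i : ℕ) : ℝ) - (s j + ε * ((j : ℕ) : ℝ))) 0 := by
        fun_prop
      have h0 : s i + (0 : ℝ) * ((i : ℕ) : ℝ) - (s j + 0 * ((j : ℕ) : ℝ)) ≠ 0 := by
        simpa [sub_eq_zero] using hs
      filter_upwards [nhdsWithin_le_nhds (hc.eventually_ne h0)] with ε hε _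
      exact sub_ne_zero.mp hε
  filter_upwards [Filter.eventually_all.mpr h] with ε hε i j hij
  by_contra hne
  exact hε (i, j) hne hij

lemma continuous_integral_orbitChar_mul {D : (Fin n → ℝ) → ℝ} (hD : Integrable D) :
    Continuous fun s => ∫ x, orbitChar s x * (D x : ℂ) := by
  refine continuous_of_dominated (bound := fun x => ‖D x‖) (fun s => ?_)
    (fun s => Filter.Eventually.of_forall fun x => ?_) hD.norm
    (Filter.Eventually.of_forall fun x => (continuous_orbitChar_left x).mul continuous_const)
  · exact (continuous_orbitChar s).aestronglyMeasurable.mul hD.ofReal.aestronglyMeasurable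
  · rw [norm_mul, Complex.norm_real]
    exact mul_le_of_le_one_left (norm_nonneg _) (norm_orbitChar_le s x)

lemma DerivChain.integral_orbitChar_mul (hn : 0 < n) (h : DerivChain n g) (Z : ℝ)
    (s : Fin n → ℝ) :
    ∫ x, orbitChar s x * (polyDensity (fun k : Fin n => g k) Z x : ℂ) =
      (Z : ℂ)⁻¹ * ensembleConst n * ∏ i, lineChar (g 0) (s i) := by
  -- Coinciding `s i` are separated by the perturbation `s i + ε i`, and both sides are continuous
  -- as `ε → 0`.
  have hc : Continuous fun ε : ℝ => fun i : Fin n => s i + ε * ((i : ℕ) : ℝ) := by fun_prop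
  have h1 := (continuous_integral_orbitChar_mul (h.integrable_polyDensity Z)).comp hc
  have h2 : Continuous fun ε : ℝ => (Z : ℂ)⁻¹ * ensembleConst n *
      ∏ i : Fin n, lineChar (g 0) (s i + ε * ((i : ℕ) : ℝ)) := by
    refine continuous_const.mul (continuous_finsetProd _ fun i _ => ?_)
    exact (continuous_lineChar (h.integrable hn)).comp (by fun_prop)
  have h3 := (h1.tendsto 0).mono_left (nhdsWithin_le_nhds (s := {0}ᶜ))
  have h4 := (h2.tendsto 0).mono_left (nhdsWithin_le_nhds (s := {0}ᶜ))
  have h5 := h3.congr' ((eventually_injective_add_smul s).mono fun ε hε =>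
    h.integral_orbitChar_mul_of_injective Z hε)
  have h6 := tendsto_nhds_unique h5 h4
  simpa using h6

lemma polyDensity_comp_perm (v : Fin n → ℝ → ℝ) (Z : ℝ) (σ : Equiv.Perm (Fin n))
    (x : Fin n → ℝ) : polyDensity v Z (x ∘ σ) = polyDensity v Z x := by
  have h1 : (Matrix.vandermonde (x ∘ σ)).det =
      (Equiv.Perm.sign σ : ℤ) * (Matrix.vandermonde x).det := Matrix.det_permute σ (Matrix.vandermonde x)
  have h2 : (Matrix.of fun j k => v k ((x ∘ σ) j)).det =
      (Equiv.Perm.sign σ : ℤ) * (Matrix.of fun j k => v k (x j)).det :=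
    Matrix.det_permute σ (Matrix.of fun j k => v k (x j))
  have h3 : ((Equiv.Perm.sign σ : ℤ) : ℝ) * ((Equiv.Perm.sign σ : ℤ) : ℝ) = 1 := by
    rw [← Int.cast_mul, ← Units.val_mul, Int.units_mul_self]
    simp
  rw [polyDensity, polyDensity, h1, h2]
  linear_combination (Z⁻¹ * (Matrix.vandermonde x).det *
    (Matrix.of fun j k => v k (x j)).det) * h3

lemma measurePreserving_comp_perm (σ : Equiv.Perm (Fin n)) :
    MeasurePreserving (fun x : Fin n → ℝ => x ∘ σ) volume volume := by
  have h := volume_measurePreserving_piCongrLeft (fun _ : Fin n => ℝ) σ.symm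
  have h1 : ⇑(MeasurableEquiv.piCongrLeft (fun _ : Fin n => ℝ) σ.symm) = fun x => x ∘ σ := by
    funext x j
    have := MeasurableEquiv.piCongrLeft_apply_apply (β := fun _ : Fin n => ℝ) σ.symm x (σ j)
    simpa using this
  rwa [h1] at h

lemma map_withDensity_comp_perm {f : (Fin n → ℝ) → ℝ≥0∞}
    (hf : ∀ (σ : Equiv.Perm (Fin n)) x, f (x ∘ σ) = f x) (σ : Equiv.Perm (Fin n)) :
    (volume.withDensity f).map (fun x => x ∘ σ) = volume.withDensity f := by
  ext S hS
  have hm := measurable_comp_perm σ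
  rw [Measure.map_apply hm hS, withDensity_apply _ (hm hS), withDensity_apply _ hS,
    ← lintegral_indicator (hm hS), ← lintegral_indicator hS]
  have he : MeasurableEmbedding fun x : Fin n → ℝ => x ∘ σ := by
    refine MeasurableEquiv.measurableEmbedding ⟨⟨_, fun x => x ∘ σ.symm, fun x => ?_, fun x => ?_⟩,
      hm, measurable_comp_perm σ.symm⟩
    · funext j; simp
    · funext j; simp
  rw [← (measurePreserving_comp_perm σ).lintegral_comp_emb he (S.indicator f)]
  refine lintegral_congr fun x => ?_
  have hfσ : (f ∘ fun x => x ∘ σ) = f := funext (hf σ)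
  conv_lhs => rw [← hfσ]
  exact Set.indicator_comp_right (s := S) (g := f) fun x : Fin n → ℝ => x ∘ σ

lemma integral_orbitChar_withDensity {D : (Fin n → ℝ) → ℝ} (hD : AEMeasurable D volume)
    (s : Fin n → ℝ) :
    ∫ x, orbitChar s x ∂(volume.withDensity fun x => ENNReal.ofReal (D x)) =
      ∫ x, orbitChar s x * ((max (D x) 0 : ℝ) : ℂ) := by
  rw [integral_withDensity_eq_integral_toReal_smul₀ hD.ennreal_ofReal
    (Filter.Eventually.of_forall fun x => ENNReal.ofReal_lt_top)]
  refine integral_congr_ae (Filter.Eventually.of_forall fun x => ?_)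
  simp only
  rw [ENNReal.toReal_ofReal', Complex.real_smul, mul_comm]

lemma integrable_orbitChar_mul {D : (Fin n → ℝ) → ℝ} (hD : Integrable D) (s : Fin n → ℝ) :
    Integrable fun x => orbitChar s x * (D x : ℂ) :=
  hD.ofReal.bdd_mul (continuous_orbitChar s).aestronglyMeasurable
    (Filter.Eventually.of_forall fun x => norm_orbitChar_le s x)

lemma diagChar_add_measure (m₁ m₂ : Measure (Herm n)) [IsFiniteMeasure m₁] [IsFiniteMeasure m₂]
    (s : Fin n → ℝ) : diagChar (m₁ + m₂) s = diagChar m₁ s + diagChar m₂ s :=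
  integral_add_measure (integrable_exp_diag m₁ s) (integrable_exp_diag m₂ s)

lemma ConjInvariantMeasure.add {m₁ m₂ : Measure (Herm n)} (h₁ : ConjInvariantMeasure m₁)
    (h₂ : ConjInvariantMeasure m₂) : ConjInvariantMeasure (m₁ + m₂) := by
  intro U
  rw [Measure.map_add _ _ (continuous_conjBy U.1).measurable, h₁ U, h₂ U]

lemma isFiniteMeasure_withDensity_of_integrable {D : (Fin n → ℝ) → ℝ} (hD : Integrable D) :
    IsFiniteMeasure (volume.withDensity fun x => ENNReal.ofReal (D x)) := by
  refine isFiniteMeasure_withDensity_ofReal hD.2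

/-- A unitarily invariant measure is determined by the pairing of its characteristic function with
a symmetric integrable function, which is then the density of the eigenvalues. -/
lemma ConjInvariantMeasure.symLaw_eq_withDensity {m : Measure (Herm n)} [IsFiniteMeasure m]
    (hm : ConjInvariantMeasure m) {D : (Fin n → ℝ) → ℝ} (hD : Integrable D)
    (hsym : ∀ (σ : Equiv.Perm (Fin n)) x, D (x ∘ σ) = D x)
    (h : ∀ s, diagChar m s = ∫ x, orbitChar s x * (D x : ℂ)) :
    (∀ᵐ x, 0 ≤ D x) ∧ symLaw m = volume.withDensity fun x => ENNReal.ofReal (D x) := by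
  set νp : Measure (Fin n → ℝ) := volume.withDensity fun x => ENNReal.ofReal (D x) with hνp
  set νm : Measure (Fin n → ℝ) := volume.withDensity fun x => ENNReal.ofReal (-D x) with hνm
  have hfp : IsFiniteMeasure νp := isFiniteMeasure_withDensity_of_integrable hD
  have hfm : IsFiniteMeasure νm := isFiniteMeasure_withDensity_of_integrable hD.neg
  have hsp : symLaw (liftLaw νp) = νp := symLaw_liftLaw (map_withDensity_comp_perm
    (f := fun x => ENNReal.ofReal (D x)) fun σ x => by simp only [hsym])
  have hsm : symLaw (liftLaw νm) = νm := symLaw_liftLaw (map_withDensity_comp_perm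
    (f := fun x => ENNReal.ofReal (-D x)) fun σ x => by simp only [hsym])
  have hcp : ∀ s, diagChar (liftLaw νp) s = ∫ x, orbitChar s x * ((max (D x) 0 : ℝ) : ℂ) := by
    intro s
    rw [diagChar_eq_integral_symLaw (conjInvariantMeasure_liftLaw νp), hsp,
      integral_orbitChar_withDensity hD.aemeasurable]
  have hcm : ∀ s, diagChar (liftLaw νm) s = ∫ x, orbitChar s x * ((max (-D x) 0 : ℝ) : ℂ) := by
    intro s
    rw [diagChar_eq_integral_symLaw (conjInvariantMeasure_liftLaw νm), hsm,
      integral_orbitChar_withDensity (D := fun x => -D x) hD.aemeasurable.neg]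
  -- Since `D` is not yet known to be nonnegative, its negative part is moved to the other side;
  -- uniqueness then compares two positive invariant measures.
  have hmeas : m + liftLaw νm = liftLaw νp := by
    refine (hm.add (conjInvariantMeasure_liftLaw νm)).ext_of_diagChar
      (conjInvariantMeasure_liftLaw νp) fun s => ?_
    rw [diagChar_add_measure, h, hcm, hcp, ← integral_add (integrable_orbitChar_mul hD s)
      (integrable_orbitChar_mul hD.neg_part s)]
    refine integral_congr_ae (Filter.Eventually.of_forall fun x => ?_)
    simp only
    rw [← mul_add, ← Complex.ofReal_add]
    congr 2
    rcases le_total 0 (D x) with h0 | h0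
    · rw [max_eq_left h0, max_eq_right (neg_nonpos.mpr h0), add_zero]
    · rw [max_eq_right h0, max_eq_left (neg_nonneg.mpr h0), add_neg_cancel]
  have hsymm : symLaw m + νm = νp := by
    conv_lhs => rw [← hsm, ← symLaw_add, hmeas, hsp]
  -- The negative part of `D` is now dominated by its positive part, which is possible only where `D
  -- ≥ 0`.
  have hle : (fun x => ENNReal.ofReal (-D x)) ≤ᵐ[volume] fun x => ENNReal.ofReal (D x) := by
    refine ae_le_of_forall_setLIntegral_le_of_sigmaFinite₀ hD.aemeasurable.neg.ennreal_ofReal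
      fun S hS _ => ?_
    rw [← withDensity_apply _ hS, ← withDensity_apply _ hS]
    change νm S ≤ νp S
    rw [← hsymm, Measure.add_apply]
    exact le_add_self
  have hnonneg : ∀ᵐ x, 0 ≤ D x := by
    filter_upwards [hle] with x hx
    by_contra hneg
    rw [not_le] at hneg
    rw [ENNReal.ofReal_of_nonpos hneg.le, nonpos_iff_eq_zero, ENNReal.ofReal_eq_zero] at hx
    linarith
  refine ⟨hnonneg, ?_⟩
  have hzero : νm = 0 := by
    rw [hνm, withDensity_congr_ae (g := 0), withDensity_zero]
    filter_upwards [hnonneg] with x hx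
    exact ENNReal.ofReal_of_nonpos (neg_nonpos.mpr hx)
  rw [← hsymm, hzero, add_zero]

end DensityCharacteristicFunction

/-! ### Closure of the derivative type ensembles under independent sums. -/

section Sum

variable {n : ℕ} {Ω : Type*} [MeasurableSpace Ω] {P : Measure Ω} [IsProbabilityMeasure P]
  {X Y : Ω → Herm n} {w w₁ w₂ : ℝ → ℝ}

lemma IsDPE.exists_diagChar_eq (hn : 0 < n) (hX : Measurable X) (hXi : UnitarilyInvariant P X)
    (h : IsDPE P X w) : ∃ Z : ℝ, Z ≠ 0 ∧ ∀ s, diagChar (P.map X) s =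
      (Z : ℂ)⁻¹ * ensembleConst n * ∏ i, lineChar w (s i) := by
  have hch := h.derivChain hn hX
  obtain ⟨hder, hv, Z, hZ, hnonneg, hlaw⟩ := h
  have : IsProbabilityMeasure (P.map X) := Measure.isProbabilityMeasure_map hX.aemeasurable
  refine ⟨Z, hZ, fun s => ?_⟩
  rw [diagChar_eq_integral_symLaw (hXi.conjInvariantMeasure hX), ← eigenvalueLaw_eq_symLaw P hX,
    hlaw, integral_orbitChar_withDensity (aemeasurable_polyDensity hv Z)]
  have h1 := hch.integral_orbitChar_mul hn Z s
  rw [iteratedDeriv_zero] at h1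
  rw [← h1]
  refine integral_congr_ae ?_
  filter_upwards [hnonneg] with x hx
  rw [max_eq_left hx]

lemma diagChar_zero (m : Measure (Herm n)) [IsProbabilityMeasure m] : diagChar m 0 = 1 := by
  simp [diagChar]

theorem IsDPE.add (hn : 0 < n) (hX : Measurable X) (hY : Measurable Y) (hXY : IndepFun X Y P)
    (hXi : UnitarilyInvariant P X) (hYi : UnitarilyInvariant P Y) (h₁ : IsDPE P X w₁)
    (h₂ : IsDPE P Y w₂) : IsDPE P (fun ω => X ω + Y ω) (conv w₁ w₂) := by
  have hch₁ := h₁.derivChain hn hX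
  have hch₂ := h₂.derivChain hn hY
  have hw₁ : Integrable w₁ := by simpa using hch₁.integrable hn
  have hw₂ : Integrable w₂ := by simpa using hch₂.integrable hn
  have hw₂' : Integrable fun x => (1 + |x|) ^ (n - 1) * w₂ x := by simpa using hch₂.weighted 0 hn
  have hcv := hch₁.conv hw₂'
  have hchain := hcv.iteratedDeriv
  have hder := hcv.hasDerivativesBelow
  simp only [iteratedDeriv_zero] at hchain hder
  obtain ⟨Z₁, hZ₁, hψ₁⟩ := h₁.exists_diagChar_eq hn hX hXi
  obtain ⟨Z₂, hZ₂, hψ₂⟩ := h₂.exists_diagChar_eq hn hY hYi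
  have hPX : IsProbabilityMeasure (P.map X) := Measure.isProbabilityMeasure_map hX.aemeasurable
  have hPXY : IsProbabilityMeasure (P.map fun ω => X ω + Y ω) :=
    Measure.isProbabilityMeasure_map (hX.fun_add hY).aemeasurable
  set I : ℝ := ∫ x, w₁ x with hI
  -- Evaluation at `s = 0`, where a characteristic function equals `1`, shows that `∫ w₁ ≠ 0` and
  -- determines `ensembleConst n` as `Z₁ / I ^ n`.
  have hone : (Z₁ : ℂ)⁻¹ * ensembleConst n * (I : ℂ) ^ n = 1 := by
    have h0 := hψ₁ 0
    rw [diagChar_zero] at h0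
    simpa [lineChar_zero] using h0.symm
  have hI0 : I ^ n ≠ 0 := by
    intro h0
    rw [← Complex.ofReal_pow, h0] at hone
    simp at hone
  have hI0' : (I : ℂ) ^ n ≠ 0 := by
    rw [← Complex.ofReal_pow]
    exact Complex.ofReal_ne_zero.mpr hI0
  have hZ₁' : (Z₁ : ℂ) ≠ 0 := Complex.ofReal_ne_zero.mpr hZ₁
  have hconst : ensembleConst n = Z₁ * ((I : ℂ) ^ n)⁻¹ := by
    rw [eq_mul_inv_iff_mul_eq₀ hI0', ← mul_one (Z₁ : ℂ), ← hone]
    field_simp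
  -- Matching constants requires `1 / Z = ensembleConst n / (Z₁ Z₂)`; with the value just found this
  -- is the manifestly real `Z₂ * I ^ n`.
  set Z : ℝ := Z₂ * I ^ n with hZ
  refine ⟨hder, fun k => (hchain.integrable k.2).aemeasurable, Z, mul_ne_zero hZ₂ hI0, ?_⟩
  rw [eigenvalueLaw_eq_symLaw P (hX.fun_add hY)]
  refine (conjInvariantMeasure_add hX hY hXY hXi hYi).symLaw_eq_withDensity
    (hchain.integrable_polyDensity Z) (fun σ x => polyDensity_comp_perm _ Z σ x) fun s => ?_
  rw [hchain.integral_orbitChar_mul hn Z s, diagChar_add hX hY hXY, hψ₁, hψ₂]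
  simp only [iteratedDeriv_zero, lineChar_conv hw₁ hw₂, Finset.prod_mul_distrib]
  rw [hconst, hZ]
  push_cast
  field_simp

end Sum

end RandomHermitian

theorem mainTheorem4 {Ω : Type*} [MeasurableSpace Ω] (P : MeasureTheory.Measure Ω)
    [MeasureTheory.IsProbabilityMeasure P] (n : ℕ) (hn : 0 < n)
    (X Y : Ω → RandomHermitian.Herm n) (hX : Measurable X) (hY : Measurable Y)
    (hXY : ProbabilityTheory.IndepFun X Y P)
    (hXinv : RandomHermitian.UnitarilyInvariant P X)
    (hYinv : RandomHermitian.UnitarilyInvariant P Y)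
    (w₁ w₂ : ℝ → ℝ)
    (hXw : RandomHermitian.IsDPE P X w₁) (hYw : RandomHermitian.IsDPE P Y w₂) :
    (∀ᵐ x : ℝ, MeasureTheory.ConvolutionExistsAt w₁ w₂ x (ContinuousLinearMap.mul ℝ ℝ)
      MeasureTheory.volume) ∧
    RandomHermitian.IsDPE P (fun ω => X ω + Y ω) (RandomHermitian.conv w₁ w₂) := by
  refine ⟨?_, hXw.add hn hX hY hXY hXinv hYinv hYw⟩
  have h₁ : MeasureTheory.Integrable w₁ := by simpa using (hXw.derivChain hn hX).integrable hn
  have h₂ : MeasureTheory.Integrable w₂ := by simpa using (hYw.derivChain hn hY).integrable hn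
  exact h₁.ae_convolution_exists (ContinuousLinearMap.mul ℝ ℝ) h₂
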